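/- Let $p>3$ be a prime, $G=\mathrm{SL}_2(\mathbb Q_p)\times \mathrm{SL}_2(\mathbb Q_p)$, $H=\{(h,h): h\in \mathrm{SL}_2(\mathbb Q_p)\}$ and $K=\mathrm{SL}_2(\mathbb Z_p)\times \mathrm{SL}_2(\mathbb Z_p)$; let $\mu_H$ be the Haar measure on $H$ with $\mu_H(K\cap H)=1$. **The lattice.** Let $F$ be a totally real number field, $v_0$ a finite place of $F$ with $F_{v_0}\cong\mathbb Q_p$, and $\tilde{\mathbf G}\subset \mathrm{SL}_M$ an algebraic $F$-group (not necessarily $F$-simple) such that $\tilde{\mathbf G}(F_v)$ is compact for every archimedean place $v$ of $F$. Let $\rho$ be an isogeny of algebraic groups over $F_{v_0}=\mathbb Q_p$ from $\tilde{\mathbf G}$ to $\mathrm{SL}_2\times \mathrm{SL}_2$, that is, a morphism of algebraic groups that is surjective with finite kernel over $\overline{\mathbb Q}_p$. Let $\mathcal S$ consist of $v_0$ and the archimedean places, let $\mathcal O_{\mathcal S}=\{x\in F: |x|_v\le 1 \text{ for all } v\notin\mathcal S\}$, $\mathrm{ht}(x)=\prod_{v\in \mathcal S}|x|_v$, and $\Gamma_{\mathcal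 S}=\tilde{\mathbf G}(\mathcal O_{\mathcal S})$. Let $\Gamma$ be a lattice in $G$ which is a subgroup of finite index in $\rho(\Gamma_{\mathcal S})$. **The volume.** For $g\in G$ such that the orbit $Hg\Gamma\subset G/\Gamma$ is periodic, i.e. such that $H\cap g\Gamma g^{-1}$ is a lattice in $H$, let $\mathrm{vol}(Hg\Gamma)$ be the total mass of the measure induced by $\mu_H$ on $Hg\Gamma\cong H/(H\cap g\Gamma g^{-1})$. **The discriminant.** Let $\tilde{\mathfrak g}$ be the Lie algebra of $\tilde{\mathbf G}$ over $F$, $B$ its Killing form, $\tilde{\mathfrak g}_{\mathcal O_{\mathcal S}}=\tilde{\mathfrak g}\cap \mathfrak{sl}_M(\mathcal O_{\mathcal S})$, and let $\tilde V_{\mathcal O_{\mathcal S}}=(\wedge^3\tilde{\mathfrak g}_{\mathcal O_{\mathcal S}})^{\otimes 2}$, viewed as an $\mathcal O_{\mathcal S}$-submodule of $(\wedge^3\tilde{\mathfrak g})^{\otimes 2}$. If $Hg\Gamma$ is closed, let $\tilde{\mathbf L}$ be the Zariski closure in $\tilde{\mathbf G}$, over $F$, of $\{\tilde\gamma\in\Gamma_{\mathcal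 S}:\rho(\tilde\gamma)\in g^{-1}Hg\}$. Its Lie algebra $\tilde{\mathfrak l}$ has dimension $3$ over $F$; for a basis $e_1,e_2,e_3$ of $\tilde{\mathfrak l}$ the vector $$\tilde v=\frac{(e_1\wedge e_2\wedge e_3)^{\otimes 2}}{\det (B(e_i,e_j))}$$ does not depend on the basis, and $$\mathrm{disc}(Hg\Gamma)=\min\{\mathrm{ht}(x): 0\ne x\in\mathcal O_{\mathcal S},\ x\tilde v\in \tilde V_{\mathcal O_{\mathcal S}}\}.$$ **Claim.** There is a constant $C>0$, depending only on $p$, $\Gamma$ and the arithmetic data $(F,v_0,\tilde{\mathbf G}\subset \mathrm{SL}_M,\rho)$ from which $\Gamma$ is constructed, such that for every $g\in G$ for which $Hg\Gamma$ is closed in $G/\Gamma$, the orbit $Hg\Gamma$ is periodic and $$\mathrm{vol}(Hg\Gamma)\le C\,\mathrm{disc}(Hg\Gamma)^6 .$$ -/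

import Mathlib

open MeasureTheory NumberField
open scoped MatrixGroups TensorProduct

namespace PadicOrbit

attribute [local instance 100] LieRing.ofAssociativeRing

/-! ### Linear algebraic groups in matrix coordinates -/

/-- The `R`-points, along `φ : F →+* R`, of the closed subscheme of the space of `M × M` matrices
cut out by an ideal `I` of polynomials over `F` in the matrix entries. -/
def zeros {F : Type} [Field F] {M : ℕ} (I : Ideal (MvPolynomial (Fin M × Fin M) F))
    {R : Type} [CommRing R] (φ : F →+* R) : Set (Matrix (Fin M) (Fin M) R) :=
  {A | ∀ f ∈ I, MvPolynomial.eval₂ φ (fun ij => A ij.1 ij.2) f = 0}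

/-- An algebraic `F`-group embedded as a closed subgroup (scheme) of `SL_M`: an ideal of
polynomials in the matrix entries, containing `det - 1`, whose solutions in every commutative
`F`-algebra form a subgroup of `SL_M`. -/
structure LinearGroup (F : Type) [Field F] (M : ℕ) where
  ideal : Ideal (MvPolynomial (Fin M × Fin M) F)
  det_sub_one_mem : (Matrix.mvPolynomialX (Fin M) (Fin M) F).det - 1 ∈ ideal
  one_mem : ∀ (R : Type) [CommRing R] (φ : F →+* R),
    (1 : Matrix (Fin M) (Fin M) R) ∈ zeros ideal φ
  mul_mem : ∀ (R : Type) [CommRing R] (φ : F →+* R)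
    (a b : Matrix.SpecialLinearGroup (Fin M) R),
    a.val ∈ zeros ideal φ → b.val ∈ zeros ideal φ → (a * b).val ∈ zeros ideal φ
  inv_mem : ∀ (R : Type) [CommRing R] (φ : F →+* R)
    (a : Matrix.SpecialLinearGroup (Fin M) R),
    a.val ∈ zeros ideal φ → (a⁻¹).val ∈ zeros ideal φ

/-- The group of `R`-points of an `F`-group, for the `F`-algebra given by `φ : F →+* R`. -/
def LinearGroup.points {F : Type} [Field F] {M : ℕ} (𝒢 : LinearGroup F M)
    {R : Type} [CommRing R] (φ : F →+* R) : Subgroup (Matrix.SpecialLinearGroup (Fin M) R) where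
  carrier := {a | a.val ∈ zeros 𝒢.ideal φ}
  mul_mem' {a b} ha hb := 𝒢.mul_mem R φ a b ha hb
  one_mem' := 𝒢.one_mem R φ
  inv_mem' {a} ha := 𝒢.inv_mem R φ a ha

/-- The differential at the identity matrix of a polynomial `f` in the matrix entries, applied to
the tangent vector `X`. -/
noncomputable def diffAtOne {F : Type} [Field F] {M : ℕ} (f : MvPolynomial (Fin M × Fin M) F)
    (X : Matrix (Fin M) (Fin M) F) : F :=
  ∑ ij : Fin M × Fin M, X ij.1 ij.2 *
    MvPolynomial.eval (fun kl => (1 : Matrix (Fin M) (Fin M) F) kl.1 kl.2)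
      (MvPolynomial.pderiv ij f)

/-- The Zariski tangent space at the identity of the closed subscheme cut out by `I` (which is
meant to pass through the identity). -/
noncomputable def tangentAtOne {F : Type} [Field F] {M : ℕ}
    (I : Ideal (MvPolynomial (Fin M × Fin M) F)) : Submodule F (Matrix (Fin M) (Fin M) F) where
  carrier := {X | ∀ f ∈ I, diffAtOne f X = 0}
  zero_mem' := fun f _ => by simp [diffAtOne]
  add_mem' := fun {X Y} hX hY f hf => by
    have h1 := hX f hf
    have h2 := hY f hf
    unfold diffAtOne at *
    simp only [Matrix.add_apply, add_mul, Finset.sum_add_distrib, h1, h2, add_zero]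
  smul_mem' := fun c X hX f hf => by
    have h1 := hX f hf
    unfold diffAtOne at *
    simp only [Matrix.smul_apply, smul_eq_mul, mul_assoc, ← Finset.mul_sum, h1, mul_zero]

/-- First order Taylor expansion at the identity. -/
theorem eval₂_one_add {F : Type} [Field F] {M : ℕ} {R : Type} [CommRing R] (φ : F →+* R)
    (t : R) (ht : t * t = 0) (X : Matrix (Fin M) (Fin M) F)
    (f : MvPolynomial (Fin M × Fin M) F) :
    MvPolynomial.eval₂ φ
        (fun ij => (1 + t • X.map φ : Matrix (Fin M) (Fin M) R) ij.1 ij.2) f =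
      φ (MvPolynomial.eval (fun kl => (1 : Matrix (Fin M) (Fin M) F) kl.1 kl.2) f) +
        t * φ (diffAtOne f X) := by
  induction f using MvPolynomial.induction_on with
  | C a => simp [diffAtOne]
  | add f g hf hg =>
    have hd : diffAtOne (f + g) X = diffAtOne f X + diffAtOne g X := by
      simp [diffAtOne, mul_add, Finset.sum_add_distrib]
    rw [MvPolynomial.eval₂_add, hf, hg, hd]
    simp only [map_add]
    ring
  | mul_X f ij hf =>
    have hd : diffAtOne (f * MvPolynomial.X ij) X =
        diffAtOne f X * (1 : Matrix (Fin M) (Fin M) F) ij.1 ij.2 +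
        MvPolynomial.eval (fun kl => (1 : Matrix (Fin M) (Fin M) F) kl.1 kl.2) f
          * X ij.1 ij.2 := by
      simp only [diffAtOne, Derivation.leibniz, smul_eq_mul, map_add, map_mul,
        MvPolynomial.eval_X, MvPolynomial.pderiv_X, mul_add, Finset.sum_add_distrib]
      rw [add_comm, Finset.sum_mul]
      congr 1
      · exact Finset.sum_congr rfl fun _ _ => by ring
      · rw [Finset.sum_eq_single ij]
        · simp [mul_comm]
        · intro b _ hb
          simp [hb.symm]
        · simp
    have h1 : (1 : Matrix (Fin M) (Fin M) R) ij.1 ij.2 =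
        φ ((1 : Matrix (Fin M) (Fin M) F) ij.1 ij.2) := by
      simp only [Matrix.one_apply]
      split_ifs <;> simp
    rw [MvPolynomial.eval₂_mul, hf, hd, MvPolynomial.eval₂_X]
    simp only [Matrix.add_apply, Matrix.smul_apply, Matrix.map_apply, smul_eq_mul, h1,
      map_add, map_mul, MvPolynomial.eval_X]
    linear_combination (φ (diffAtOne f X) * φ (X ij.1 ij.2)) * ht

theorem LinearGroup.eval_one_eq_zero {F : Type} [Field F] {M : ℕ} (𝒢 : LinearGroup F M)
    {f : MvPolynomial (Fin M × Fin M) F} (hf : f ∈ 𝒢.ideal) :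
    MvPolynomial.eval (fun kl => (1 : Matrix (Fin M) (Fin M) F) kl.1 kl.2) f = 0 :=
  𝒢.one_mem F (RingHom.id F) f hf

/-- A tangent vector `X` gives the point `1 + t X` whenever `t² = 0`. -/
theorem LinearGroup.exists_one_add {F : Type} [Field F] {M : ℕ} (𝒢 : LinearGroup F M)
    {R : Type} [CommRing R] (φ : F →+* R) (t : R) (ht : t * t = 0)
    {X : Matrix (Fin M) (Fin M) F} (hX : X ∈ tangentAtOne 𝒢.ideal) :
    ∃ a ∈ 𝒢.points φ, a.val = 1 + t • X.map φ := by
  have hz : (1 + t • X.map φ : Matrix (Fin M) (Fin M) R) ∈ zeros 𝒢.ideal φ := fun f hf => by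
    rw [eval₂_one_add φ t ht, 𝒢.eval_one_eq_zero hf, hX f hf]
    simp
  have hdet : (1 + t • X.map φ : Matrix (Fin M) (Fin M) R).det = 1 := by
    have h := hz _ 𝒢.det_sub_one_mem
    rw [← MvPolynomial.coe_eval₂Hom, map_sub, map_one, RingHom.map_det, sub_eq_zero] at h
    rw [← h]
    congr 1
    ext i j
    simp [Matrix.mvPolynomialX]
  exact ⟨⟨_, hdet⟩, hz, rfl⟩

/-- The group commutator of `1 + P` and `1 + Q` for suitably nilpotent `P` and `Q`. -/
theorem commutator_one_add {A : Type} [Ring A] (P Q : A) (z1 : P * P = 0) (z2 : Q * Q = 0)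
    (z3 : P * Q * P = 0) (z4 : Q * P * Q = 0) :
    (1 + P) * (1 + Q) * (1 + -P) * (1 + -Q) = 1 + (P * Q - Q * P) := by
  calc (1 + P) * (1 + Q) * (1 + -P) * (1 + -Q)
      = 1 + (P * Q - Q * P) - P * P - Q * Q + P * P * Q + Q * P * Q - P * Q * P
          - P * (Q * Q) + P * Q * P * Q := by noncomm_ring
    _ = _ := by rw [z1, z2, z3, z4]; simp

/-- If `X` and `Y` are tangent vectors and `s² = t² = 0`, then `s t` kills the differential of
the equations on the bracket of `X` and `Y`. -/
theorem LinearGroup.diffAtOne_bracket {F : Type} [Field F] {M : ℕ} (𝒢 : LinearGroup F M)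
    {R : Type} [CommRing R] (φ : F →+* R) (s t : R) (hs : s * s = 0) (ht : t * t = 0)
    {X Y : Matrix (Fin M) (Fin M) F} (hX : X ∈ tangentAtOne 𝒢.ideal)
    (hY : Y ∈ tangentAtOne 𝒢.ideal) {f : MvPolynomial (Fin M × Fin M) F} (hf : f ∈ 𝒢.ideal) :
    (s * t) * φ (diffAtOne f (X * Y - Y * X)) = 0 := by
  obtain ⟨a, ha, ha'⟩ := 𝒢.exists_one_add φ s hs hX
  obtain ⟨b, hb, hb'⟩ := 𝒢.exists_one_add φ t ht hY
  obtain ⟨c, hc, hc'⟩ := 𝒢.exists_one_add φ s hs ((tangentAtOne 𝒢.ideal).neg_mem hX)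
  obtain ⟨d, hd, hd'⟩ := 𝒢.exists_one_add φ t ht ((tangentAtOne 𝒢.ideal).neg_mem hY)
  have hmem : (a * b * c * d).val ∈ zeros 𝒢.ideal φ :=
    (𝒢.points φ).mul_mem ((𝒢.points φ).mul_mem ((𝒢.points φ).mul_mem ha hb) hc) hd
  have hval : (a * b * c * d).val = 1 + (s * t) • (X * Y - Y * X).map φ := by
    have e1 : (-X).map φ = -(X.map φ) := by ext; simp
    have e2 : (-Y).map φ = -(Y.map φ) := by ext; simp
    have e3 : (X * Y - Y * X).map φ = X.map φ * Y.map φ - Y.map φ * X.map φ := by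
      have h1 : (X * Y).map φ = X.map φ * Y.map φ := Matrix.map_mul
      have h2 : (Y * X).map φ = Y.map φ * X.map φ := Matrix.map_mul
      rw [← h1, ← h2]
      exact Matrix.map_sub φ (map_sub φ) _ _
    have z5 : (s * t) • (X.map φ * Y.map φ - Y.map φ * X.map φ) =
        (s • X.map φ) * (t • Y.map φ) - (t • Y.map φ) * (s • X.map φ) := by
      simp only [Matrix.smul_mul, Matrix.mul_smul, smul_smul, smul_sub, mul_comm t s]
    change a.val * b.val * c.val * d.val = _
    rw [ha', hb', hc', hd', e1, e2, e3, z5, smul_neg, smul_neg]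
    apply commutator_one_add
    · rw [Matrix.smul_mul, Matrix.mul_smul, smul_smul, hs, zero_smul]
    · rw [Matrix.smul_mul, Matrix.mul_smul, smul_smul, ht, zero_smul]
    · simp only [Matrix.smul_mul, Matrix.mul_smul, smul_smul]
      rw [show s * (t * s) = (s * s) * t by ring, hs, zero_mul, zero_smul]
    · simp only [Matrix.smul_mul, Matrix.mul_smul, smul_smul]
      rw [show t * (s * t) = (t * t) * s by ring, ht, zero_mul, zero_smul]
  have hst : (s * t) * (s * t) = 0 := by
    rw [show (s * t) * (s * t) = (s * s) * (t * t) by ring, hs, zero_mul]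
  have h := hmem f hf
  rwa [hval, eval₂_one_add φ _ hst, 𝒢.eval_one_eq_zero hf, map_zero, zero_add] at h

/-- The Lie algebra of an `F`-group inside `SL_M`, a Lie subalgebra of `gl_M(F)`. -/
noncomputable def LinearGroup.lieAlgebra {F : Type} [Field F] {M : ℕ} (𝒢 : LinearGroup F M) :
    LieSubalgebra F (Matrix (Fin M) (Fin M) F) :=
  { tangentAtOne 𝒢.ideal with
    lie_mem' := fun {X Y} hX hY f hf => by
      have h := 𝒢.diffAtOne_bracket (R := DualNumber (DualNumber F))
        ((TrivSqZeroExt.inlHom (DualNumber F) (DualNumber F)).comp (TrivSqZeroExt.inlHom F F))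
        (TrivSqZeroExt.inl DualNumber.eps) DualNumber.eps
        (((TrivSqZeroExt.inl_mul (DualNumber F) _ _).symm.trans
          (congrArg TrivSqZeroExt.inl DualNumber.eps_mul_eps)).trans
          (TrivSqZeroExt.inl_zero _))
        (DualNumber.eps_mul_eps (R := DualNumber F)) hX hY hf
      have h2 := congrArg (fun r => TrivSqZeroExt.snd (TrivSqZeroExt.snd r)) h
      have h3 : diffAtOne f (X * Y - Y * X) = 0 := by simpa using h2
      exact h3 }

/-! ### The `p`-adic groups -/

/-- `G = SL₂(ℚ_p) × SL₂(ℚ_p)`. -/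
abbrev G (p : ℕ) [Fact p.Prime] : Type := SL(2, ℚ_[p]) × SL(2, ℚ_[p])

/-- `H = {(h, h)}`, the diagonal copy of `SL₂(ℚ_p)` in `G`. -/
noncomputable def H (p : ℕ) [Fact p.Prime] : Subgroup (G p) :=
  ((MonoidHom.id SL(2, ℚ_[p])).prod (MonoidHom.id SL(2, ℚ_[p]))).range

/-- `K = SL₂(ℤ_p) × SL₂(ℤ_p)`, as a subgroup of `G`. -/
noncomputable def K (p : ℕ) [Fact p.Prime] : Subgroup (G p) :=
  (Matrix.SpecialLinearGroup.map (n := Fin 2) (PadicInt.Coe.ringHom (p := p))).range.prod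
    (Matrix.SpecialLinearGroup.map (n := Fin 2) (PadicInt.Coe.ringHom (p := p))).range

/-- A lattice in a group `L` with Haar measure `μ`: a discrete subgroup such that the quotient
`L / Λ` has finite volume. -/
def IsLattice {L : Type*} [Group L] [TopologicalSpace L] [MeasurableSpace L] (μ : Measure L)
    (Λ : Subgroup L) : Prop :=
  DiscreteTopology Λ ∧ HasFundamentalDomain Λ.op L μ ∧ covolume Λ.op L μ < ⊤

/-- The group `H ∩ g Γ g⁻¹`, as the stabilizer in `H` of the point `g Γ` of `G / Γ`. -/
noncomputable def stab {p : ℕ} [Fact p.Prime] (Γ : Subgroup (G p)) (g : G p) : Subgroup (H p) :=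
  MulAction.stabilizer (H p) (g : G p ⧸ Γ)

/-- The orbit `H g Γ` in `G / Γ`. -/
noncomputable def orbit {p : ℕ} [Fact p.Prime] (Γ : Subgroup (G p)) (g : G p) : Set (G p ⧸ Γ) :=
  MulAction.orbit (H p) (g : G p ⧸ Γ)

/-- The volume of `H g Γ` for the measure induced by `μ` on `H g Γ = H / (H ∩ g Γ g⁻¹)`. -/
noncomputable def vol {p : ℕ} [Fact p.Prime] [MeasurableSpace (G p)] (μ : Measure (H p))
    (Γ : Subgroup (G p)) (g : G p) : ENNReal :=
  covolume (stab Γ g).op (H p) μ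

/-! ### Isogenies and arithmetic lattices -/

/-- A morphism of algebraic groups over `ℚ_p` from `𝒢` (base changed along `σ : F →+* ℚ_p`) to
`SL₂ × SL₂`, given by polynomials in the matrix entries. -/
structure MorphismToSL2SL2 {p : ℕ} [Fact p.Prime] {F : Type} [Field F] {M : ℕ}
    (𝒢 : LinearGroup F M) (σ : F →+* ℚ_[p]) where
  coord : Fin 2 → Matrix (Fin 2) (Fin 2) (MvPolynomial (Fin M × Fin M) ℚ_[p])
  det_eq_one : ∀ (R : Type) [CommRing R] (ψ : ℚ_[p] →+* R), ∀ a ∈ 𝒢.points (ψ.comp σ), ∀ k,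
    ((coord k).map (MvPolynomial.eval₂ ψ (fun ij => a.val ij.1 ij.2))).det = 1
  map_mul : ∀ (R : Type) [CommRing R] (ψ : ℚ_[p] →+* R),
    ∀ a ∈ 𝒢.points (ψ.comp σ), ∀ b ∈ 𝒢.points (ψ.comp σ), ∀ k,
    (coord k).map (MvPolynomial.eval₂ ψ (fun ij => (a * b).val ij.1 ij.2)) =
      (coord k).map (MvPolynomial.eval₂ ψ (fun ij => a.val ij.1 ij.2)) *
      (coord k).map (MvPolynomial.eval₂ ψ (fun ij => b.val ij.1 ij.2))

/-- The homomorphism on `R`-points defined by a morphism of algebraic groups. -/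
noncomputable def MorphismToSL2SL2.onPoints {p : ℕ} [Fact p.Prime] {F : Type} [Field F] {M : ℕ}
    {𝒢 : LinearGroup F M} {σ : F →+* ℚ_[p]} (ρ : MorphismToSL2SL2 𝒢 σ)
    {R : Type} [CommRing R] (ψ : ℚ_[p] →+* R) :
    𝒢.points (ψ.comp σ) →* SL(2, R) × SL(2, R) :=
  MonoidHom.mk'
    (fun a => (⟨_, ρ.det_eq_one R ψ a.1 a.2 0⟩, ⟨_, ρ.det_eq_one R ψ a.1 a.2 1⟩))
    (fun a b => Prod.ext (Subtype.ext (ρ.map_mul R ψ a.1 a.2 b.1 b.2 0))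
      (Subtype.ext (ρ.map_mul R ψ a.1 a.2 b.1 b.2 1)))

/-- An isogeny: surjective with finite kernel on points over the algebraic closure. -/
def MorphismToSL2SL2.IsIsogeny {p : ℕ} [Fact p.Prime] {F : Type} [Field F] {M : ℕ}
    {𝒢 : LinearGroup F M} {σ : F →+* ℚ_[p]} (ρ : MorphismToSL2SL2 𝒢 σ) : Prop :=
  Function.Surjective (ρ.onPoints (algebraMap ℚ_[p] (AlgebraicClosure ℚ_[p]))) ∧
    Finite (ρ.onPoints (algebraMap ℚ_[p] (AlgebraicClosure ℚ_[p]))).ker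

/-- The data from which an arithmetic lattice in `G` is built: a totally real number field `F`,
a finite place `v₀` with `F_{v₀} = ℚ_p`, an `F`-group `𝒢` in `SL_M` that is compact at all
archimedean places, and an isogeny `ρ` from `𝒢` to `SL₂ × SL₂` over `F_{v₀} = ℚ_p`.
The identification `F_{v₀} = ℚ_p` is given by the embedding `σ` of `F` in `ℚ_p` that induces `v₀`;
the `v₀`-absolute value of `x` is `‖σ x‖`. -/
structure ArithmeticData (p : ℕ) [Fact p.Prime] (F : Type) [Field F] [NumberField F]
    (M : ℕ) where
  totallyReal : IsTotallyReal F
  v₀ : IsDedekindDomain.HeightOneSpectrum (𝓞 F)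
  σ : F →+* ℚ_[p]
  mem_v₀_iff : ∀ x : 𝓞 F, x ∈ v₀.asIdeal ↔ ‖σ x‖ < 1
  𝒢 : LinearGroup F M
  compact_arch : ∀ τ : F →+* ℝ, IsCompact (𝒢.points τ : Set (Matrix.SpecialLinearGroup (Fin M) ℝ))
  ρ : MorphismToSL2SL2 𝒢 σ
  isIsogeny : ρ.IsIsogeny

namespace ArithmeticData

variable {p : ℕ} [Fact p.Prime] {F : Type} [Field F] [NumberField F] {M : ℕ}
  (D : ArithmeticData p F M)

/-- The ring `𝓞_S ⊆ F` of `S`-integers, `S` being the archimedean places together with `v₀`. -/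
noncomputable def integers : Subalgebra (𝓞 F) F :=
  ({D.v₀} : Set (IsDedekindDomain.HeightOneSpectrum (𝓞 F))).integer F

/-- The `S`-height `∏_{v ∈ S} |x|_v` of an element of `F`. -/
noncomputable def height (x : F) : ℝ := (∏ v : InfinitePlace F, v x) * ‖D.σ x‖

/-- The map `𝒢(F) → 𝒢(F_{v₀}) → G`, the second arrow being `ρ`. -/
noncomputable def toG : D.𝒢.points (RingHom.id F) →* G p :=
  (D.ρ.onPoints (RingHom.id ℚ_[p])).comp
    (((Matrix.SpecialLinearGroup.map D.σ).comp (D.𝒢.points (RingHom.id F)).subtype).codRestrict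
      (D.𝒢.points ((RingHom.id ℚ_[p]).comp D.σ)) (by
        intro a f hf
        have h := congrArg D.σ (a.2 f hf)
        rw [MvPolynomial.hom_eval₂, map_zero] at h
        exact h))

/-- `Γ_S = 𝒢(𝓞_S)`: the elements of `𝒢(F)` whose entries are `S`-integers. -/
noncomputable def ΓS : Subgroup (D.𝒢.points (RingHom.id F)) :=
  (Matrix.SpecialLinearGroup.map (n := Fin M)
    (D.integers.toSubring.subtype)).range.subgroupOf (D.𝒢.points (RingHom.id F))

/-- The image of `Γ_S` in `G`. -/
noncomputable def arithmeticGroup : Subgroup (G p) := D.ΓS.map D.toG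

/-- `Λ = {γ ∈ Γ_S : ρ(γ) ∈ g⁻¹ H g}`. -/
def Λ (g : G p) : Set (D.𝒢.points (RingHom.id F)) :=
  {γ | γ ∈ D.ΓS ∧ g * D.toG γ * g⁻¹ ∈ H p}

/-- The ideal over `F` of the Zariski closure of `Λ`. -/
noncomputable def closureIdeal (g : G p) : Ideal (MvPolynomial (Fin M × Fin M) F) :=
  MvPolynomial.vanishingIdeal F
    {x : Fin M × Fin M → F | ∃ γ ∈ D.Λ g, x = fun ij => γ.1.val ij.1 ij.2}

/-- The Lie algebra of the Zariski closure of `Λ`, as an `F`-subspace of the Lie algebra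
of `𝒢`. -/
noncomputable def 𝔩 (g : G p) : Submodule F D.𝒢.lieAlgebra :=
  (tangentAtOne (D.closureIdeal g)).comap (D.𝒢.lieAlgebra.toSubmodule.subtype)

/-- The space `(⋀³ 𝔤)^{⊗ 2}`, for `𝔤` the Lie algebra of `𝒢` over `F`. -/
abbrev V : Type :=
  (⋀[F]^3 D.𝒢.lieAlgebra) ⊗[F] (⋀[F]^3 D.𝒢.lieAlgebra)

/-- The `𝓞_S`-module `(⋀³ 𝔤(𝓞_S))^{⊗ 2}` in `(⋀³ 𝔤)^{⊗ 2}`, where `𝔤(𝓞_S)` consists of the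
elements of `𝔤` with entries in `𝓞_S`. -/
noncomputable def integralV : Submodule D.integers D.V :=
  Submodule.span D.integers
    {w | ∃ a b : Fin 3 → D.𝒢.lieAlgebra,
      (∀ k i j, (a k).val i j ∈ D.integers) ∧ (∀ k i j, (b k).val i j ∈ D.integers) ∧
      w = exteriorPower.ιMulti F 3 a ⊗ₜ[F] exteriorPower.ιMulti F 3 b}

/-- `(e₁ ∧ e₂ ∧ e₃)^{⊗ 2} / det (B (eᵢ, eⱼ))`, where `B` is the Killing form of `𝔤`. -/
noncomputable def vec (e : Fin 3 → D.𝒢.lieAlgebra) : D.V :=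
  (Matrix.of fun i j => killingForm F D.𝒢.lieAlgebra (e i) (e j)).det⁻¹ •
    (exteriorPower.ιMulti F 3 e ⊗ₜ[F] exteriorPower.ιMulti F 3 e)

/-- The discriminant of `H g Γ`: the least height of a nonzero `S`-integer `x` such that
`x • (e₁ ∧ e₂ ∧ e₃)^{⊗ 2} / det (B (eᵢ, eⱼ))` lies in `(⋀³ 𝔤(𝓞_S))^{⊗ 2}`, for a basis `e` of the
Lie algebra of the Zariski closure of `Λ` (the vector does not depend on the basis). -/
noncomputable def disc (g : G p) : ℝ :=
  sInf {r : ℝ | ∃ x ∈ D.integers, x ≠ 0 ∧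
    (∃ e : Module.Basis (Fin 3) F (D.𝔩 g), x • D.vec (fun i => (e i : D.𝒢.lieAlgebra)) ∈
      D.integralV) ∧ r = D.height x}

end ArithmeticData

end PadicOrbit

/-! The volume of a closed orbit is bounded by a number of double cosets, and these are told apart
by S-integers of controlled size.

Since p > 3, the principal congruence subgroup U = `principalSq p` of K is torsion free. Being
compact and open, it meets every conjugate of the discrete group Γ trivially. Each double coset U r
Γ therefore takes up volume μ(U) in G/Γ, so a lattice has finitely many of them, with
representatives r ∈ R, and G/Γ is compact. A closed orbit is then compact, and H is a finite
disjoint union of double cosets of U ∩ H and H ∩ gΓg⁻¹, with representatives s ∈ S. This gives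
periodicity and vol ≤ |S| (`isLattice_stab`); what remains is to bound |S|.

The differential of the isogeny identifies the Lie algebra of the F-group, after extension of
scalars, with sl₂ × sl₂. It is injective because an algebraic group with finitely many points has
trivial tangent space in characteristic zero, and surjective because the preimage of a unipotent
one-parameter group is infinite and so has a nonzero tangent vector. Hence the Lie algebra has
dimension 6 and its Killing form becomes 4 ∑ tr (`σ_killingForm`). At the archimedean places the
Killing form is negative semidefinite by compactness (`killingForm_self_nonpos`). The stabilizer of
a point of a closed orbit is cocompact in SL₂(ℚ_p) and contains no unipotent other than 1, so it
acts irreducibly on sl₂. This forces dim 𝔩 = 3 (`finrank_𝔩`), and over ℚ_p the space 𝔩 spans the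
graph of Ad a, where a = g₂⁻¹g₁.

For s ∈ S write s g = u r γ. Transporting 𝔩 by γ keeps x • v integral, and turns a into a_s =
r₂⁻¹(u₂⁻¹u₁)r₁, which stays in a fixed compact set. Let P_s be the orthogonal projection to the
transported subalgebra. Contracting v against dual bases yields the coefficients 2B(P_s X, Y), so x
B(P_s X, Y) is an S-integer up to a fixed denominator. Its size at each place of S is at most a
constant times that of x: at archimedean places because an orthogonal projection contracts a
semidefinite form, at v₀ because a_s is bounded. By the product formula only O(ht x) elements of F
satisfy these conditions (`exists_card_le`).

A single vector P_s X is described by six such coefficients. If the two components of X do not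
commute after being brought together by a_s, then P_s X determines a_s up to sign
(`IsDiagonal.eq_or_eq_neg`). The sign is excluded because −1 ∉ U, and r together with a_s determines
the double coset of s. A suitable X can be found among 36 sums of basis vectors, so |S| ≤ C ht(x)⁶
for every admissible x, hence for the discriminant. -/

namespace PadicOrbit

attribute [local instance 100] LieRing.ofAssociativeRing

/-! ### Invariant derivations, the formal exponential, and groups with finitely many points -/

section AlgebraicGroups

variable {F K : Type} [Field F] [Field K] {M : ℕ}

theorem mem_zeros_iff_le_ker {I : Ideal (MvPolynomial (Fin M × Fin M) F)} {R : Type} [CommRing R]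
    {φ : F →+* R} {A : Matrix (Fin M) (Fin M) R} :
    A ∈ zeros I φ ↔ I ≤ RingHom.ker (MvPolynomial.eval₂Hom φ (fun ij => A ij.1 ij.2)) :=
  Iff.rfl

theorem mem_zeros_map {I : Ideal (MvPolynomial (Fin M × Fin M) F)} (φ : F →+* K)
    {R : Type} [CommRing R] (ψ : K →+* R) {A : Matrix (Fin M) (Fin M) R} :
    A ∈ zeros (I.map (MvPolynomial.map φ)) ψ ↔ A ∈ zeros I (ψ.comp φ) := by
  rw [mem_zeros_iff_le_ker, Ideal.map_le_iff_le_comap]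
  refine forall_congr' fun f => forall_congr' fun _ => ?_
  simp [RingHom.mem_ker]

theorem map_mem_zeros {I : Ideal (MvPolynomial (Fin M × Fin M) F)} {R S : Type} [CommRing R]
    [CommRing S] {φ : F →+* R} {A : Matrix (Fin M) (Fin M) R} (hA : A ∈ zeros I φ) (θ : R →+* S) :
    A.map θ ∈ zeros I (θ.comp φ) := fun f hf => by
  have h := congrArg θ (hA f hf)
  rw [MvPolynomial.hom_eval₂, map_zero] at h
  exact h

/-- Extension of the base field of an algebraic group. -/
noncomputable def LinearGroup.baseChange (𝒢 : LinearGroup F M) (φ : F →+* K) :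
    LinearGroup K M where
  ideal := 𝒢.ideal.map (MvPolynomial.map φ)
  det_sub_one_mem := by
    have h := Ideal.mem_map_of_mem (MvPolynomial.map φ) 𝒢.det_sub_one_mem
    rw [map_sub, map_one, RingHom.map_det] at h
    convert h using 3
    ext i j
    simp [Matrix.mvPolynomialX]
  one_mem R _ ψ := (mem_zeros_map φ ψ).2 (𝒢.one_mem R _)
  mul_mem R _ ψ a b ha hb := (mem_zeros_map φ ψ).2
    (𝒢.mul_mem R _ a b ((mem_zeros_map φ ψ).1 ha) ((mem_zeros_map φ ψ).1 hb))
  inv_mem R _ ψ a ha := (mem_zeros_map φ ψ).2 (𝒢.inv_mem R _ a ((mem_zeros_map φ ψ).1 ha))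

/-- The tangent space at the identity, via dual numbers. -/
theorem LinearGroup.mem_tangentAtOne_iff (𝒢 : LinearGroup F M) {X : Matrix (Fin M) (Fin M) F} :
    X ∈ tangentAtOne 𝒢.ideal ↔
      (1 + (DualNumber.eps : DualNumber F) • X.map (TrivSqZeroExt.inlHom F F) :
        Matrix (Fin M) (Fin M) (DualNumber F)) ∈ zeros 𝒢.ideal (TrivSqZeroExt.inlHom F F) := by
  refine forall_congr' fun f => forall_congr' fun hf => ?_
  rw [eval₂_one_add _ _ DualNumber.eps_mul_eps, 𝒢.eval_one_eq_zero hf, map_zero, zero_add]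
  constructor
  · intro h
    rw [h, map_zero, mul_zero]
  · intro h
    simpa using congrArg TrivSqZeroExt.snd h

theorem diffAtOne_add (f g : MvPolynomial (Fin M × Fin M) F) (X : Matrix (Fin M) (Fin M) F) :
    diffAtOne (f + g) X = diffAtOne f X + diffAtOne g X := by
  simp [diffAtOne, mul_add, Finset.sum_add_distrib]

/-- The differential at the identity as a bilinear map. -/
noncomputable def diffAtOneHom :
    MvPolynomial (Fin M × Fin M) F →ₗ[F] Module.Dual F (Matrix (Fin M) (Fin M) F) where
  toFun f :=
    { toFun := diffAtOne f
      map_add' := fun X Y => by simp [diffAtOne, add_mul, Finset.sum_add_distrib]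
      map_smul' := fun c X => by simp [diffAtOne, mul_assoc, Finset.mul_sum] }
  map_add' f g := by
    ext1 X
    exact diffAtOne_add f g X
  map_smul' c f := by
    ext1 X
    change diffAtOne (c • f) X = c * diffAtOne f X
    simp [diffAtOne, Finset.mul_sum, mul_left_comm]

@[simp] theorem diffAtOneHom_apply (f : MvPolynomial (Fin M × Fin M) F)
    (X : Matrix (Fin M) (Fin M) F) : diffAtOneHom f X = diffAtOne f X := rfl

theorem diffAtOne_mul (f g : MvPolynomial (Fin M × Fin M) F) (X : Matrix (Fin M) (Fin M) F) :
    diffAtOne (f * g) X =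
      MvPolynomial.eval (fun kl => (1 : Matrix (Fin M) (Fin M) F) kl.1 kl.2) f * diffAtOne g X +
      MvPolynomial.eval (fun kl => (1 : Matrix (Fin M) (Fin M) F) kl.1 kl.2) g *
        diffAtOne f X := by
  simp only [diffAtOne, Derivation.leibniz, smul_eq_mul, map_add, map_mul, mul_add,
    Finset.sum_add_distrib, Finset.mul_sum]
  congr 1 <;> exact Finset.sum_congr rfl fun _ _ => by ring

theorem diffAtOne_C (c : F) (X : Matrix (Fin M) (Fin M) F) :
    diffAtOne (MvPolynomial.C c) X = 0 := by
  simp [diffAtOne]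

/-- The left-invariant derivation attached to a matrix `X`. -/
noncomputable def leftDeriv (X : Matrix (Fin M) (Fin M) F) :
    Derivation F (MvPolynomial (Fin M × Fin M) F) (MvPolynomial (Fin M × Fin M) F) :=
  MvPolynomial.mkDerivation F
    (fun ij => ∑ k, MvPolynomial.X (ij.1, k) * MvPolynomial.C (X k ij.2))

/-- The left-invariant field is the first order term of right translation by 1 + tX. Unlike the
expansion at the identity, this one holds at every point A. -/
theorem eval₂_mul_one_add {R : Type} [CommRing R] (φ : F →+* R) (t : R) (ht : t * t = 0)
    (A : Matrix (Fin M) (Fin M) R) (X : Matrix (Fin M) (Fin M) F)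
    (f : MvPolynomial (Fin M × Fin M) F) :
    MvPolynomial.eval₂ φ (fun ij => (A * (1 + t • X.map φ)) ij.1 ij.2) f =
      MvPolynomial.eval₂ φ (fun ij => A ij.1 ij.2) f +
        t * MvPolynomial.eval₂ φ (fun ij => A ij.1 ij.2) (leftDeriv X f) := by
  induction f using MvPolynomial.induction_on with
  | C a => simp [leftDeriv, ← MvPolynomial.algebraMap_eq]
  | add f g hf hg =>
    rw [MvPolynomial.eval₂_add, hf, hg, map_add, MvPolynomial.eval₂_add, MvPolynomial.eval₂_add]
    ring
  | mul_X f ij hf =>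
    have h1 : (A * (1 + t • X.map φ)) ij.1 ij.2 =
        A ij.1 ij.2 + t * ∑ k, A ij.1 k * φ (X k ij.2) := by
      rw [mul_add, mul_one, Matrix.mul_smul, Matrix.add_apply, Matrix.smul_apply,
        Matrix.mul_apply]
      rfl
    have h2 : leftDeriv X (MvPolynomial.X ij) =
        ∑ k, MvPolynomial.X (ij.1, k) * MvPolynomial.C (X k ij.2) := by
      simp [leftDeriv]
    rw [MvPolynomial.eval₂_mul, hf, MvPolynomial.eval₂_X, h1, Derivation.leibniz, h2,
      MvPolynomial.eval₂_add, smul_eq_mul, smul_eq_mul, MvPolynomial.eval₂_mul,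
      MvPolynomial.eval₂_mul, MvPolynomial.eval₂_mul, MvPolynomial.eval₂_X,
      MvPolynomial.eval₂_sum]
    simp only [MvPolynomial.eval₂_mul, MvPolynomial.eval₂_X, MvPolynomial.eval₂_C]
    linear_combination (MvPolynomial.eval₂ φ (fun ij => A ij.1 ij.2) (leftDeriv X f) *
      ∑ k, A ij.1 k * φ (X k ij.2)) * ht

theorem LinearGroup.exists_val_eq (𝒢 : LinearGroup F M) {R : Type} [CommRing R] {φ : F →+* R}
    {A : Matrix (Fin M) (Fin M) R} (hA : A ∈ zeros 𝒢.ideal φ) :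
    ∃ a ∈ 𝒢.points φ, a.val = A := by
  have hdet : A.det = 1 := by
    have h := hA _ 𝒢.det_sub_one_mem
    rw [← MvPolynomial.coe_eval₂Hom, map_sub, map_one, RingHom.map_det, sub_eq_zero] at h
    rw [← h]
    congr 1
    ext i j
    simp [Matrix.mvPolynomialX]
  exact ⟨⟨A, hdet⟩, hA, rfl⟩

/-- The images of the coordinate functions form a tautological Q-point A of the group. Multiplying
it by 1 + εX over the dual numbers of Q stays in the group, and the ε-part of the equation f = 0
there is the claim. With Q the coordinate ring this says that the ideal is stable under
left-invariant derivations. -/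
theorem LinearGroup.leftDeriv_mem_ker (𝒢 : LinearGroup F M) {X : Matrix (Fin M) (Fin M) F}
    (hX : X ∈ tangentAtOne 𝒢.ideal) {Q : Type} [CommRing Q]
    (π : MvPolynomial (Fin M × Fin M) F →+* Q) (hπ : ∀ f ∈ 𝒢.ideal, π f = 0)
    {f : MvPolynomial (Fin M × Fin M) F} (hf : f ∈ 𝒢.ideal) :
    π (leftDeriv X f) = 0 := by
  let ι : Q →+* DualNumber Q := TrivSqZeroExt.inlHom Q Q
  let φ : F →+* Q := π.comp MvPolynomial.C
  let A : Matrix (Fin M) (Fin M) Q := Matrix.of fun i j => π (MvPolynomial.X (i, j))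
  have hev : ∀ f, MvPolynomial.eval₂ φ (fun ij => A ij.1 ij.2) f = π f := fun f => by
    conv_rhs => rw [← MvPolynomial.eval₂_eta f]
    rw [MvPolynomial.hom_eval₂]
    rfl
  have hA : A ∈ zeros 𝒢.ideal φ := fun f hf => (hev f).trans (hπ f hf)
  obtain ⟨a, ha, ha'⟩ := 𝒢.exists_val_eq (map_mem_zeros hA ι)
  obtain ⟨b, hb, hb'⟩ := 𝒢.exists_one_add (ι.comp φ) DualNumber.eps DualNumber.eps_mul_eps hX
  have h := 𝒢.mul_mem _ _ a b ha hb f hf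
  rw [Matrix.SpecialLinearGroup.coe_mul, hb', eval₂_mul_one_add _ _ DualNumber.eps_mul_eps,
    ha f hf, zero_add, ha'] at h
  have h3 : MvPolynomial.eval₂ (ι.comp φ) (fun ij => (A.map ι) ij.1 ij.2) (leftDeriv X f) =
      ι (π (leftDeriv X f)) := by
    rw [← hev, MvPolynomial.hom_eval₂]
    rfl
  rw [h3] at h
  simpa [ι] using congrArg TrivSqZeroExt.snd h

theorem LinearGroup.leftDeriv_mem (𝒢 : LinearGroup F M) {X : Matrix (Fin M) (Fin M) F}
    (hX : X ∈ tangentAtOne 𝒢.ideal) {f : MvPolynomial (Fin M × Fin M) F} (hf : f ∈ 𝒢.ideal) :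
    leftDeriv X f ∈ 𝒢.ideal :=
  Ideal.Quotient.eq_zero_iff_mem.1 (𝒢.leftDeriv_mem_ker hX (Ideal.Quotient.mk 𝒢.ideal)
    (fun _ h => Ideal.Quotient.eq_zero_iff_mem.2 h) hf)

/-- The exponential of `t X` as a matrix of formal power series. -/
noncomputable def formalExp (X : Matrix (Fin M) (Fin M) F) : Matrix (Fin M) (Fin M) (PowerSeries F) :=
  Matrix.of fun i j => PowerSeries.mk fun n => (X ^ n) i j / (n.factorial : F)

theorem derivative_formalExp [CharZero F] (X : Matrix (Fin M) (Fin M) F) (i j : Fin M) :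
    PowerSeries.derivative F (formalExp X i j) =
      ∑ k, formalExp X i k * PowerSeries.C (X k j) := by
  ext n
  rw [PowerSeries.coeff_derivative, map_sum]
  simp only [formalExp, Matrix.of_apply, PowerSeries.coeff_mk, PowerSeries.coeff_mul_C]
  rw [pow_succ, Matrix.mul_apply, Nat.factorial_succ, Finset.sum_div, Finset.sum_mul]
  refine Finset.sum_congr rfl fun k _ => ?_
  have h1 : ((n : F) + 1) ≠ 0 := by exact_mod_cast Nat.succ_ne_zero n
  have h2 : ((n.factorial : ℕ) : F) ≠ 0 := by exact_mod_cast n.factorial_ne_zero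
  push_cast
  field_simp

theorem derivative_eval₂_formalExp [CharZero F] (X : Matrix (Fin M) (Fin M) F)
    (f : MvPolynomial (Fin M × Fin M) F) :
    PowerSeries.derivative F (MvPolynomial.eval₂ PowerSeries.C
      (fun ij => formalExp X ij.1 ij.2) f) =
    MvPolynomial.eval₂ PowerSeries.C (fun ij => formalExp X ij.1 ij.2) (leftDeriv X f) := by
  induction f using MvPolynomial.induction_on with
  | C a => simp [leftDeriv, ← MvPolynomial.algebraMap_eq]
  | add f g hf hg => simp only [MvPolynomial.eval₂_add, map_add, hf, hg]
  | mul_X f ij hf =>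
    have h2 : leftDeriv X (MvPolynomial.X ij) =
        ∑ k, MvPolynomial.X (ij.1, k) * MvPolynomial.C (X k ij.2) := by
      simp [leftDeriv]
    simp only [MvPolynomial.eval₂_mul, MvPolynomial.eval₂_X, Derivation.leibniz, hf, h2,
      MvPolynomial.eval₂_add, smul_eq_mul, MvPolynomial.eval₂_sum, derivative_formalExp,
      MvPolynomial.eval₂_C]

theorem constantCoeff_eval₂_formalExp (X : Matrix (Fin M) (Fin M) F)
    (f : MvPolynomial (Fin M × Fin M) F) :
    PowerSeries.constantCoeff (MvPolynomial.eval₂ PowerSeries.C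
      (fun ij => formalExp X ij.1 ij.2) f) =
    MvPolynomial.eval (fun kl => (1 : Matrix (Fin M) (Fin M) F) kl.1 kl.2) f := by
  rw [MvPolynomial.hom_eval₂, ← MvPolynomial.eval₂_id]
  have h1 : (PowerSeries.constantCoeff (R := F)).comp PowerSeries.C = RingHom.id F := by
    ext; simp
  have h2 : (fun ij : Fin M × Fin M => PowerSeries.constantCoeff (formalExp X ij.1 ij.2)) = fun kl => (1 : Matrix (Fin M) (Fin M) F) kl.1 kl.2 := by
    funext ij
    simp [formalExp, ← PowerSeries.coeff_zero_eq_constantCoeff_apply]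
  rw [h1, h2]

/-- Differentiating f(exp tX) replaces f by `leftDeriv X f`, which is again in the ideal. So all
derivatives vanish at t = 0, and in characteristic zero the power series is zero. -/
theorem LinearGroup.formalExp_mem [CharZero F] (𝒢 : LinearGroup F M)
    {X : Matrix (Fin M) (Fin M) F} (hX : X ∈ tangentAtOne 𝒢.ideal) :
    formalExp X ∈ zeros 𝒢.ideal PowerSeries.C := by
  have key : ∀ n, ∀ f ∈ 𝒢.ideal, PowerSeries.coeff n (MvPolynomial.eval₂ PowerSeries.C
      (fun ij => formalExp X ij.1 ij.2) f) = 0 := by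
    intro n
    induction n with
    | zero =>
      intro f hf
      rw [PowerSeries.coeff_zero_eq_constantCoeff, constantCoeff_eval₂_formalExp,
        𝒢.eval_one_eq_zero hf]
    | succ n ih =>
      intro f hf
      have h := ih _ (𝒢.leftDeriv_mem hX hf)
      rw [← derivative_eval₂_formalExp, PowerSeries.coeff_derivative] at h
      exact (mul_eq_zero.1 h).resolve_right (by exact_mod_cast Nat.succ_ne_zero n)
  intro f hf
  ext n
  simpa using key n f hf

/-- An algebraic group in characteristic zero with finitely many points over an algebraically
closed field has trivial Lie algebra. -/
theorem LinearGroup.tangentAtOne_eq_bot_of_finite [CharZero F] [IsAlgClosed F]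
    (𝒢 : LinearGroup F M) (hfin : (zeros 𝒢.ideal (RingHom.id F)).Finite) :
    tangentAtOne 𝒢.ideal = ⊥ := by
  rw [Submodule.eq_bot_iff]
  intro X hX
  ext i j
  -- A polynomial in the single coordinate (i, j) which vanishes at all of the finitely many points;
  -- by the Nullstellensatz a power of it lies in the ideal.
  let q : MvPolynomial (Fin M × Fin M) F :=
    ∏ A ∈ hfin.toFinset, (MvPolynomial.X (i, j) - MvPolynomial.C (A i j))
  have hq : q ∈ 𝒢.ideal.radical := by
    rw [← MvPolynomial.vanishingIdeal_zeroLocus_eq_radical (K := F)]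
    intro x hx
    have hA : (Matrix.of fun i j => x (i, j)) ∈ hfin.toFinset := by
      rw [Set.Finite.mem_toFinset]
      intro f hf
      have h := hx f hf
      rw [MvPolynomial.aeval_def] at h
      exact h
    simp only [q, map_prod]
    refine Finset.prod_eq_zero hA ?_
    simp
  obtain ⟨m, hm⟩ := hq
  -- Power series form a domain, so the (i, j) entry of exp tX equals a constant A i j, and its
  -- linear coefficient X i j is zero.
  have h := 𝒢.formalExp_mem hX _ hm
  rw [MvPolynomial.eval₂_pow] at h
  have h1 := eq_zero_of_pow_eq_zero h
  rw [← MvPolynomial.coe_eval₂Hom, map_prod, Finset.prod_eq_zero_iff] at h1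
  obtain ⟨A, -, hA⟩ := h1
  have h2 := congrArg (PowerSeries.coeff 1) hA
  simpa [formalExp, PowerSeries.coeff_C] using h2

end AlgebraicGroups


/-! ### The real exponential of the Lie algebra -/

section Exponential

variable {M : ℕ}

open scoped Matrix.Norms.Operator in
theorem hasDerivAt_eval_exp (X : Matrix (Fin M) (Fin M) ℝ)
    (f : MvPolynomial (Fin M × Fin M) ℝ) (t : ℝ) :
    HasDerivAt (fun t : ℝ => MvPolynomial.eval (fun ij => NormedSpace.exp (t • X) ij.1 ij.2) f)
      (MvPolynomial.eval (fun ij => NormedSpace.exp (t • X) ij.1 ij.2) (leftDeriv X f)) t := by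
  induction f using MvPolynomial.induction_on with
  | C a =>
    have h : leftDeriv X (MvPolynomial.C a) = 0 := by
      simp [leftDeriv, ← MvPolynomial.algebraMap_eq]
    simpa [h] using hasDerivAt_const t a
  | add f g hf hg => simpa only [map_add] using! hf.add hg
  | mul_X f ij hf =>
    have h2 : leftDeriv X (MvPolynomial.X ij) =
        ∑ k, MvPolynomial.X (ij.1, k) * MvPolynomial.C (X k ij.2) := by
      simp [leftDeriv]
    have h3 : HasDerivAt (fun t : ℝ => NormedSpace.exp (t • X) ij.1 ij.2)
        (∑ k, NormedSpace.exp (t • X) ij.1 k * X k ij.2) t := by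
      have h := hasDerivAt_exp_smul_const (𝕂 := ℝ) X t
      have h4 : HasDerivAt (fun t : ℝ => NormedSpace.exp (t • X) ij.1 ij.2)
          ((NormedSpace.exp (t • X) * X) ij.1 ij.2) t :=
        (Matrix.entryLinearMap ℝ ℝ ij.1 ij.2).toContinuousLinearMap.hasFDerivAt.comp_hasDerivAt t h
      rwa [Matrix.mul_apply] at h4
    have h := hf.mul h3
    simp only [map_mul, MvPolynomial.eval_X, Derivation.leibniz, h2, smul_eq_mul, map_add, map_sum,
      MvPolynomial.eval_C]
    refine h.congr_deriv ?_
    ring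

open scoped Matrix.Norms.Operator in
theorem analyticAt_eval_exp (X : Matrix (Fin M) (Fin M) ℝ)
    (f : MvPolynomial (Fin M × Fin M) ℝ) (t : ℝ) :
    AnalyticAt ℝ
      (fun t : ℝ => MvPolynomial.eval (fun ij => NormedSpace.exp (t • X) ij.1 ij.2) f) t := by
  induction f using MvPolynomial.induction_on with
  | C a => simpa using analyticAt_const
  | add f g hf hg => simpa only [map_add] using! hf.add hg
  | mul_X f ij hf =>
    have h0 : AnalyticAt ℝ (fun t : ℝ => t • X) t := analyticAt_id.smul analyticAt_const
    have h1 : AnalyticAt ℝ (fun t : ℝ => NormedSpace.exp (t • X)) t :=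
      AnalyticAt.fun_comp (f := fun t : ℝ => t • X)
        (NormedSpace.exp_analytic (𝕂 := ℝ) (t • X)) h0
    have h2 : AnalyticAt ℝ (fun t : ℝ => NormedSpace.exp (t • X) ij.1 ij.2) t :=
      AnalyticAt.fun_comp (f := fun t : ℝ => NormedSpace.exp (t • X))
        ((Matrix.entryLinearMap ℝ ℝ ij.1 ij.2).toContinuousLinearMap.analyticAt
          (NormedSpace.exp (t • X))) h1
    simpa only [map_mul, MvPolynomial.eval_X] using! hf.mul h2

/-- The exponential of the Lie algebra lies in the group of real points. -/
theorem LinearGroup.exp_mem (𝒢 : LinearGroup ℝ M) {X : Matrix (Fin M) (Fin M) ℝ}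
    (hX : X ∈ tangentAtOne 𝒢.ideal) (t : ℝ) :
    NormedSpace.exp (t • X) ∈ zeros 𝒢.ideal (RingHom.id ℝ) := by
  intro f hf
  let h : ℝ → ℝ := fun t => MvPolynomial.eval (fun ij => NormedSpace.exp (t • X) ij.1 ij.2) f
  -- The induction ranges over all f in the ideal at once, since each derivative replaces f by
  -- `leftDeriv X f`. Vanishing of the Taylor series then gives vanishing for all real t by
  -- analyticity.
  have hd : ∀ n, ∀ f ∈ 𝒢.ideal, iteratedDeriv n (fun t : ℝ =>
      MvPolynomial.eval (fun ij => NormedSpace.exp (t • X) ij.1 ij.2) f) 0 = 0 := by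
    intro n
    induction n with
    | zero =>
      intro f hf
      simpa using 𝒢.eval_one_eq_zero hf
    | succ n ih =>
      intro f hf
      have hder : deriv (fun t : ℝ =>
          MvPolynomial.eval (fun ij => NormedSpace.exp (t • X) ij.1 ij.2) f) = fun t : ℝ =>
          MvPolynomial.eval (fun ij => NormedSpace.exp (t • X) ij.1 ij.2) (leftDeriv X f) :=
        funext fun t => (hasDerivAt_eval_exp X f t).deriv
      rw [iteratedDeriv_succ', hder]
      exact ih _ (𝒢.leftDeriv_mem hX hf)
  have h0 : ∀ᶠ t in nhds (0 : ℝ), h t = 0 := by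
    have ha := (analyticAt_eval_exp X f 0).hasFPowerSeriesAt
    have : (fun n => iteratedDeriv n (fun t : ℝ =>
        MvPolynomial.eval (fun ij => NormedSpace.exp (t • X) ij.1 ij.2) f) 0 / n.factorial) =
        0 := by
      funext n
      simp [hd n f hf]
    rw [this] at ha
    have h00 : FormalMultilinearSeries.ofScalars ℝ (0 : ℕ → ℝ) = 0 := by
      ext; simp [FormalMultilinearSeries.ofScalars]
    rw [h00] at ha
    exact ha.eventually_eq_zero
  have hall : Set.EqOn h 0 Set.univ :=
    AnalyticOnNhd.eqOn_zero_of_preconnected_of_eventuallyEq_zero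
      (fun t _ => analyticAt_eval_exp X f t) isPreconnected_univ (Set.mem_univ 0) h0
  have := hall (Set.mem_univ t)
  rw [MvPolynomial.eval₂_id]
  exact this

end Exponential

/-! ### Tangent vectors of the closure of an infinite group -/

section InfiniteSubgroup

variable {K : Type} [Field K] {M : ℕ}

/-- The ideal of polynomials vanishing on a set of matrices. -/
noncomputable def vanishing (S : Set (Matrix (Fin M) (Fin M) K)) :
    Ideal (MvPolynomial (Fin M × Fin M) K) :=
  MvPolynomial.vanishingIdeal K ((fun A ij => A ij.1 ij.2) '' S)

theorem mem_vanishing {S : Set (Matrix (Fin M) (Fin M) K)} {f : MvPolynomial (Fin M × Fin M) K} :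
    f ∈ vanishing S ↔ ∀ A ∈ S, MvPolynomial.eval (fun ij => A ij.1 ij.2) f = 0 := by
  simp [vanishing, MvPolynomial.aeval_def, MvPolynomial.eval₂_id]

/-- The maximal ideal of the identity matrix. -/
noncomputable def maxIdealOne (K : Type) [Field K] (M : ℕ) :
    Ideal (MvPolynomial (Fin M × Fin M) K) :=
  RingHom.ker (MvPolynomial.eval (fun kl => (1 : Matrix (Fin M) (Fin M) K) kl.1 kl.2))

/-- First order Taylor expansion modulo the square of the maximal ideal of a. It turns statements on
differentials into statements modulo 𝔪², to which Nakayama's lemma applies. -/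
theorem sub_taylor_mem {σ : Type} [Fintype σ] (a : σ → K) (f : MvPolynomial σ K) :
    f - MvPolynomial.C (MvPolynomial.eval a f) - ∑ i, MvPolynomial.C (MvPolynomial.eval a
        (MvPolynomial.pderiv i f)) * (MvPolynomial.X i - MvPolynomial.C (a i)) ∈
      RingHom.ker (MvPolynomial.eval a) * RingHom.ker (MvPolynomial.eval a) := by
  classical
  induction f using MvPolynomial.induction_on with
  | C c => simp
  | add f g hf hg =>
    have h := add_mem hf hg
    simp only [map_add, add_mul, Finset.sum_add_distrib]
    convert h using 1
    ring
  | mul_X f i hf =>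
    have hsum : ∑ k, MvPolynomial.C (MvPolynomial.eval a
        (MvPolynomial.pderiv k (f * MvPolynomial.X i))) *
        (MvPolynomial.X k - MvPolynomial.C (a k)) =
        MvPolynomial.C (a i) * ∑ k, MvPolynomial.C (MvPolynomial.eval a (MvPolynomial.pderiv k f)) *
        (MvPolynomial.X k - MvPolynomial.C (a k)) +
        MvPolynomial.C (MvPolynomial.eval a f) * (MvPolynomial.X i - MvPolynomial.C (a i)) := by
      have h1 : ∀ k, MvPolynomial.C (MvPolynomial.eval a
          (MvPolynomial.pderiv k (f * MvPolynomial.X i))) *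
          (MvPolynomial.X k - MvPolynomial.C (a k)) =
          MvPolynomial.C (a i) * (MvPolynomial.C (MvPolynomial.eval a (MvPolynomial.pderiv k f)) *
          (MvPolynomial.X k - MvPolynomial.C (a k))) +
          (if k = i then MvPolynomial.C (MvPolynomial.eval a f) *
            (MvPolynomial.X i - MvPolynomial.C (a i)) else 0) := by
        intro k
        rw [Derivation.leibniz]
        by_cases hk : k = i
        · subst hk
          simp only [MvPolynomial.pderiv_X_self, smul_eq_mul, map_add, map_mul, map_one,
            MvPolynomial.eval_X, if_true]
          ring
        · have : MvPolynomial.pderiv k (MvPolynomial.X i : MvPolynomial σ K) = 0 := by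
            rw [MvPolynomial.pderiv_X, Pi.single_eq_of_ne (fun h => hk h.symm)]
          simp only [this, smul_eq_mul, map_mul, mul_zero, zero_add,
            MvPolynomial.eval_X, if_neg hk]
          ring
      rw [Finset.sum_congr rfl fun k _ => h1 k, Finset.sum_add_distrib, Finset.mul_sum]
      simp
    rw [hsum]
    have hym : MvPolynomial.X i - MvPolynomial.C (a i) ∈ RingHom.ker (MvPolynomial.eval a) := by
      simp [RingHom.mem_ker]
    have hfm : f - MvPolynomial.C (MvPolynomial.eval a f) ∈ RingHom.ker (MvPolynomial.eval a) := by
      simp [RingHom.mem_ker]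
    have h2 := Ideal.mul_mem_mul hfm hym
    have h3 := Ideal.mul_mem_left _ (MvPolynomial.C (a i)) hf
    convert add_mem h2 h3 using 1
    simp only [map_mul, MvPolynomial.eval_X]
    ring

/-- If the tangent space at the identity of the locus of `J` vanishes, then a polynomial separates
the identity from the rest of that locus. -/
theorem exists_separating_of_tangentAtOne_eq_bot {J : Ideal (MvPolynomial (Fin M × Fin M) K)}
    (hJ1 : J ≤ maxIdealOne K M) (hJ : tangentAtOne J = ⊥) :
    ∃ r : MvPolynomial (Fin M × Fin M) K,
      MvPolynomial.eval (fun kl => (1 : Matrix (Fin M) (Fin M) K) kl.1 kl.2) r = 1 ∧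
      ∀ ij, r * (MvPolynomial.X ij - MvPolynomial.C ((1 : Matrix (Fin M) (Fin M) K) ij.1 ij.2)) ∈
        J := by
  -- A zero tangent space means that the differentials of elements of J have no common zero, hence
  -- fill the whole dual space.
  have hW : (J.restrictScalars K).map (diffAtOneHom (F := K) (M := M)) = ⊤ := by
    set W := (J.restrictScalars K).map (diffAtOneHom (F := K) (M := M)) with hWdef
    have h0 : W.dualCoannihilator = ⊥ := by
      rw [Submodule.eq_bot_iff] at hJ ⊢
      intro X hX
      refine hJ X fun f hf => ?_
      rw [Submodule.mem_dualCoannihilator] at hX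
      exact hX _ ⟨f, hf, rfl⟩
    rw [← Subspace.dualCoannihilator_dualAnnihilator_eq (W := W), h0,
      Submodule.dualAnnihilator_bot]
  have hlin : ∀ ij : Fin M × Fin M, MvPolynomial.X ij -
      MvPolynomial.C ((1 : Matrix (Fin M) (Fin M) K) ij.1 ij.2) ∈
      J ⊔ maxIdealOne K M * maxIdealOne K M := by
    intro ij
    have hm : Matrix.entryLinearMap K K ij.1 ij.2 ∈
      (J.restrictScalars K).map (diffAtOneHom (F := K) (M := M)) := by rw [hW]; trivial
    obtain ⟨f, hf, hfe⟩ := hm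
    have h1 := sub_taylor_mem (fun kl => (1 : Matrix (Fin M) (Fin M) K) kl.1 kl.2) f
    have hf0 : MvPolynomial.eval (fun kl => (1 : Matrix (Fin M) (Fin M) K) kl.1 kl.2) f = 0 :=
      hJ1 hf
    have hpd : ∀ kl, MvPolynomial.eval (fun kl => (1 : Matrix (Fin M) (Fin M) K) kl.1 kl.2)
        (MvPolynomial.pderiv kl f) = if kl = ij then 1 else 0 := by
      intro kl
      have h := LinearMap.congr_fun hfe (Matrix.single kl.1 kl.2 1)
      rw [diffAtOneHom_apply, diffAtOne, Finset.sum_eq_single kl] at h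
      · simp only [Matrix.single_apply_same, one_mul] at h
        rw [h]
        simp [Matrix.single_apply, Prod.ext_iff]
      · intro b _ hb
        rw [Matrix.single_apply, if_neg, zero_mul]
        rintro ⟨h1, h2⟩
        exact hb (Prod.ext h1.symm h2.symm)
      · simp
    rw [hf0] at h1
    simp only [hpd, map_zero, sub_zero, apply_ite MvPolynomial.C, map_one, ite_mul, one_mul,
      zero_mul, Finset.sum_ite_eq', Finset.mem_univ, if_true] at h1
    have h2 := sub_mem (Submodule.mem_sup_left (T := maxIdealOne K M * maxIdealOne K M) hf)
      (Submodule.mem_sup_right (S := J) h1)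
    simpa using h2
  have hle : maxIdealOne K M ≤ J ⊔ maxIdealOne K M • maxIdealOne K M := by
    intro f hf
    have h1 := Submodule.mem_sup_right (S := J) (sub_taylor_mem
      (fun kl => (1 : Matrix (Fin M) (Fin M) K) kl.1 kl.2) f)
    have hf0 : MvPolynomial.eval (fun kl => (1 : Matrix (Fin M) (Fin M) K) kl.1 kl.2) f = 0 := hf
    have h2 : ∑ ij, MvPolynomial.C (MvPolynomial.eval
        (fun kl => (1 : Matrix (Fin M) (Fin M) K) kl.1 kl.2) (MvPolynomial.pderiv ij f)) *
        (MvPolynomial.X ij - MvPolynomial.C ((1 : Matrix (Fin M) (Fin M) K) ij.1 ij.2)) ∈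
        J ⊔ maxIdealOne K M * maxIdealOne K M :=
      sum_mem fun ij _ => Ideal.mul_mem_left _ _ (hlin ij)
    rw [hf0, map_zero, sub_zero] at h1
    have h3 := add_mem h1 h2
    rwa [sub_add_cancel] at h3
  -- Nakayama: 𝔪 ≤ J + 𝔪² yields r ≡ 1 modulo 𝔪 with r𝔪 ≤ J.
  obtain ⟨r, hr1, hr2⟩ := Submodule.exists_sub_one_mem_and_smul_le_of_fg_of_le_sup
    (IsNoetherian.noetherian (maxIdealOne K M)) le_rfl hle
  refine ⟨r, ?_, fun ij => hr2 ?_⟩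
  · have : MvPolynomial.eval (fun kl => (1 : Matrix (Fin M) (Fin M) K) kl.1 kl.2) (r - 1) = 0 := hr1
    rwa [map_sub, map_one, sub_eq_zero] at this
  · exact Submodule.smul_mem_pointwise_smul _ _ _ (by simp [maxIdealOne, RingHom.mem_ker])

/-- The Zariski closure of an infinite group of matrices has positive dimension. -/
theorem tangentAtOne_vanishing_ne_bot (L : Subgroup (Matrix.SpecialLinearGroup (Fin M) K))
    (hL : (L : Set (Matrix.SpecialLinearGroup (Fin M) K)).Infinite) :
    tangentAtOne (vanishing (Subtype.val '' (L : Set (Matrix.SpecialLinearGroup (Fin M) K)))) ≠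
      ⊥ := by
  intro hbot
  have hJ1 : vanishing (Subtype.val '' (L : Set (Matrix.SpecialLinearGroup (Fin M) K))) ≤
      maxIdealOne K M := fun f hf => mem_vanishing.1 hf 1
    ⟨(1 : Matrix.SpecialLinearGroup (Fin M) K), L.one_mem, rfl⟩
  obtain ⟨r, hr1, hr2⟩ := exists_separating_of_tangentAtOne_eq_bot hJ1 hbot
  have hr : ∀ γ ∈ L, γ ≠ 1 → MvPolynomial.eval (fun ij => γ.val ij.1 ij.2) r = 0 := by
    intro γ hγ hne
    have : ∃ i j, γ.val i j ≠ (1 : Matrix (Fin M) (Fin M) K) i j := by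
      by_contra! h
      exact hne (Subtype.ext (Matrix.ext h))
    obtain ⟨i, j, hij⟩ := this
    have h := mem_vanishing.1 (hr2 (i, j)) γ.val ⟨γ, hγ, rfl⟩
    rw [map_mul, mul_eq_zero] at h
    refine h.resolve_right ?_
    simpa [sub_eq_zero] using hij
  -- The translate of r that equals 1 at γ and vanishes at all other elements of the group.
  let tr : Matrix.SpecialLinearGroup (Fin M) K → MvPolynomial (Fin M × Fin M) K := fun γ =>
    MvPolynomial.bind₁ (fun ij => ∑ k, MvPolynomial.C ((γ⁻¹).val ij.1 k) * MvPolynomial.X (k, ij.2)) r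
  have htr : ∀ γ δ : Matrix.SpecialLinearGroup (Fin M) K,
      MvPolynomial.eval (fun ij => δ.val ij.1 ij.2) (tr γ) =
      MvPolynomial.eval (fun ij => (γ⁻¹ * δ).val ij.1 ij.2) r := by
    intro γ δ
    rw [← MvPolynomial.eval₂_id, ← MvPolynomial.eval₂_id, ← MvPolynomial.coe_eval₂Hom,
      MvPolynomial.eval₂Hom_bind₁]
    simp only [MvPolynomial.coe_eval₂Hom]
    congr 1
    funext ij
    rw [Matrix.SpecialLinearGroup.coe_mul, Matrix.mul_apply]
    simp [MvPolynomial.eval₂_sum]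
  -- By noetherianity finitely many translates generate the ideal of all of them. A γ outside this
  -- finite set is a zero of the generators but not of its own translate.
  obtain ⟨s, hs, hspan⟩ := (Submodule.fg_span_iff_fg_span_finset_subset
    (tr '' (L : Set (Matrix.SpecialLinearGroup (Fin M) K)))).1
    (IsNoetherian.noetherian (Submodule.span (MvPolynomial (Fin M × Fin M) K)
      (tr '' (L : Set (Matrix.SpecialLinearGroup (Fin M) K)))))
  classical
  obtain ⟨T, hT, rfl⟩ := Finset.subset_set_image_iff.1 hs
  obtain ⟨γ, hγ, hγT⟩ := hL.exists_notMem_finset T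
  have hmem : tr γ ∈ Submodule.span (MvPolynomial (Fin M × Fin M) K)
      ((T.image tr : Finset _) : Set (MvPolynomial (Fin M × Fin M) K)) :=
    hspan ▸ Submodule.subset_span ⟨γ, hγ, rfl⟩
  have hle : Submodule.span (MvPolynomial (Fin M × Fin M) K)
      ((T.image tr : Finset _) : Set (MvPolynomial (Fin M × Fin M) K)) ≤
      RingHom.ker (MvPolynomial.eval (fun ij => γ.val ij.1 ij.2)) := by
    rw [Submodule.span_le]
    intro q hq
    obtain ⟨δ, hδ, rfl⟩ := Finset.mem_image.1 (Finset.mem_coe.1 hq)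
    have hne : δ⁻¹ * γ ≠ 1 := by
      rw [Ne, inv_mul_eq_one]
      rintro rfl
      exact hγT hδ
    exact (htr δ γ).trans (hr _ (L.mul_mem (L.inv_mem (hT hδ)) hγ) hne)
  have h1 := hle hmem
  rw [RingHom.mem_ker, htr, inv_mul_cancel] at h1
  exact one_ne_zero (hr1.symm.trans h1)

end InfiniteSubgroup


/-! ### Extension of the base field -/

section Scalars

variable {F K : Type} [Field F] [Field K] {M : ℕ}

theorem LinearGroup.map_mem_tangentAtOne_baseChange (𝒢 : LinearGroup F M) (φ : F →+* K)
    {Z : Matrix (Fin M) (Fin M) F} (hZ : Z ∈ tangentAtOne 𝒢.ideal) :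
    Z.map φ ∈ tangentAtOne (𝒢.baseChange φ).ideal := by
  rw [LinearGroup.mem_tangentAtOne_iff]
  refine (mem_zeros_map φ _).2 ?_
  obtain ⟨a, ha, ha'⟩ := 𝒢.exists_one_add ((TrivSqZeroExt.inlHom K K).comp φ)
    (DualNumber.eps : DualNumber K) DualNumber.eps_mul_eps hZ
  have h : a.val ∈ zeros 𝒢.ideal ((TrivSqZeroExt.inlHom K K).comp φ) := ha
  rw [ha'] at h
  exact h

theorem diffAtOne_map_linear [Algebra F K] (l : K →ₗ[F] F) (f : MvPolynomial (Fin M × Fin M) F)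
    (X : Matrix (Fin M) (Fin M) K) :
    diffAtOne f (X.map l) = l (diffAtOne (MvPolynomial.map (algebraMap F K) f) X) := by
  simp only [diffAtOne, map_sum, Matrix.map_apply]
  refine Finset.sum_congr rfl fun ij _ => ?_
  have h1 : (fun kl : Fin M × Fin M => (1 : Matrix (Fin M) (Fin M) K) kl.1 kl.2) =
      algebraMap F K ∘ fun kl => (1 : Matrix (Fin M) (Fin M) F) kl.1 kl.2 := by
    funext kl
    simp [Matrix.one_apply, apply_ite (algebraMap F K)]
  rw [MvPolynomial.pderiv_map, MvPolynomial.eval_map, h1, ← MvPolynomial.eval₂_comp,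
    mul_comm (X ij.1 ij.2), ← Algebra.smul_def, map_smul, smul_eq_mul, mul_comm]

/-- F-linear functionals on K turn a relation over K into relations over F, and they separate the
points of K. -/
theorem linearIndependent_map (φ : F →+* K) {ι : Type} {b : ι → Matrix (Fin M) (Fin M) F}
    (hb : LinearIndependent F b) : LinearIndependent K fun i => (b i).map φ := by
  let _ := φ.toAlgebra
  rw [linearIndependent_iff'] at hb ⊢
  intro s c hc i hi
  rw [← Module.forall_dual_apply_eq_zero_iff F (c i)]
  intro l
  refine hb s (fun i => l (c i)) ?_ i hi
  ext k j
  have h := congrArg l (congrFun (congrFun hc k) j)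
  simp only [Matrix.sum_apply, Matrix.smul_apply, Matrix.map_apply, smul_eq_mul, map_sum,
    Matrix.zero_apply, map_zero] at h ⊢
  rw [← h]
  refine Finset.sum_congr rfl fun i _ => ?_
  have : c i * φ (b i k j) = b i k j • c i := by
    rw [Algebra.smul_def, mul_comm]
    rfl
  rw [this, map_smul, smul_eq_mul, mul_comm]

/-- The equations have coefficients in F, so after expanding the entries of X in an F-basis of K
each coordinate matrix satisfies them separately. -/
theorem LinearGroup.mem_span_of_mem_tangentAtOne_baseChange (𝒢 : LinearGroup F M) (φ : F →+* K)
    {X : Matrix (Fin M) (Fin M) K} (hX : X ∈ tangentAtOne (𝒢.baseChange φ).ideal) :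
    X ∈ Submodule.span K ((fun Z : Matrix (Fin M) (Fin M) F => Z.map φ) '' (tangentAtOne 𝒢.ideal : Set _)) := by
  classical
  let _ := φ.toAlgebra
  let β := Module.Basis.ofVectorSpace F K
  let s := Finset.univ.biUnion fun kl : Fin M × Fin M => (β.repr (X kl.1 kl.2)).support
  have h1 : X = ∑ i ∈ s, β i • (X.map (β.coord i)).map φ := by
    ext k j
    rw [Matrix.sum_apply]
    conv_lhs => rw [← β.linearCombination_repr (X k j), Finsupp.linearCombination_apply,
      Finsupp.sum]
    refine (Finset.sum_subset (Finset.subset_biUnion_of_mem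
      (fun kl : Fin M × Fin M => (β.repr (X kl.1 kl.2)).support) (Finset.mem_univ (k, j)))
      ?_).trans (Finset.sum_congr rfl fun i _ => ?_)
    · intro i _ hi
      rw [Finsupp.notMem_support_iff.1 hi, zero_smul]
    · rw [Algebra.smul_def, Matrix.smul_apply, smul_eq_mul, mul_comm]
      rfl
  rw [h1]
  refine sum_mem fun i _ => Submodule.smul_mem _ _ (Submodule.subset_span ⟨_, ?_, rfl⟩)
  intro f hf
  rw [diffAtOne_map_linear]
  have := hX _ (Ideal.mem_map_of_mem _ hf)
  rw [RingHom.algebraMap_toAlgebra, this, map_zero]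

theorem LinearGroup.finrank_tangentAtOne (𝒢 : LinearGroup F M) (φ : F →+* K) :
    Module.finrank F (tangentAtOne 𝒢.ideal) =
      Module.finrank K (tangentAtOne (𝒢.baseChange φ).ideal) := by
  let b := Module.finBasis F (tangentAtOne 𝒢.ideal)
  have hb : LinearIndependent F fun i => (b i : Matrix (Fin M) (Fin M) F) :=
    b.linearIndependent.map' (tangentAtOne 𝒢.ideal).subtype (Submodule.ker_subtype _)
  have hli := linearIndependent_map φ hb
  have hspan : Submodule.span K (Set.range fun i => ((b i : Matrix (Fin M) (Fin M) F)).map φ) =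
      tangentAtOne (𝒢.baseChange φ).ideal := by
    refine le_antisymm (Submodule.span_le.2 ?_) ?_
    · rintro _ ⟨i, rfl⟩
      exact 𝒢.map_mem_tangentAtOne_baseChange φ (b i).2
    · intro X hX
      refine Submodule.span_le.2 ?_ (𝒢.mem_span_of_mem_tangentAtOne_baseChange φ hX)
      rintro _ ⟨Z, hZ, rfl⟩
      have h2 : Z = ∑ i, b.repr ⟨Z, hZ⟩ i • (b i : Matrix (Fin M) (Fin M) F) := by
        have h : _ = Z := congrArg Subtype.val (b.sum_repr ⟨Z, hZ⟩)
        refine h.symm.trans ?_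
        rw [Submodule.coe_sum]
        rfl
      have h3 : Z.map φ =
          ∑ i, φ (b.repr ⟨Z, hZ⟩ i) • ((b i : Matrix (Fin M) (Fin M) F)).map φ := by
        conv_lhs => rw [h2]
        ext k j
        simp [Matrix.sum_apply]
      change Z.map φ ∈ _
      rw [h3]
      exact sum_mem fun i _ => Submodule.smul_mem _ _ (Submodule.subset_span ⟨i, rfl⟩)
  rw [← hspan, finrank_span_eq_card hli, Fintype.card_fin]

end Scalars

/-! ### Commutators and conjugates of infinitesimal elements -/

section SquareZero

theorem commutator_one_add_smul {K R : Type} [Field K] [CommRing R] {n : ℕ} (χ : K →+* R) {s t : R}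
    (hs : s * s = 0) (ht : t * t = 0) (X Y : Matrix (Fin n) (Fin n) K) :
    (1 + s • X.map χ) * (1 + t • Y.map χ) * (1 + s • (-X).map χ) * (1 + t • (-Y).map χ) =
      1 + (s * t) • (X * Y - Y * X).map χ := by
  have e1 : (-X).map χ = -(X.map χ) := by ext; simp
  have e2 : (-Y).map χ = -(Y.map χ) := by ext; simp
  have e3 : (X * Y - Y * X).map χ = X.map χ * Y.map χ - Y.map χ * X.map χ := by
    have h1 : (X * Y).map χ = X.map χ * Y.map χ := Matrix.map_mul
    have h2 : (Y * X).map χ = Y.map χ * X.map χ := Matrix.map_mul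
    rw [← h1, ← h2]
    exact Matrix.map_sub χ (map_sub χ) _ _
  have z5 : (s * t) • (X.map χ * Y.map χ - Y.map χ * X.map χ) =
      (s • X.map χ) * (t • Y.map χ) - (t • Y.map χ) * (s • X.map χ) := by
    simp only [Matrix.smul_mul, Matrix.mul_smul, smul_smul, smul_sub, mul_comm t s]
  rw [e1, e2, e3, z5, smul_neg, smul_neg]
  apply commutator_one_add
  · rw [Matrix.smul_mul, Matrix.mul_smul, smul_smul, hs, zero_smul]
  · rw [Matrix.smul_mul, Matrix.mul_smul, smul_smul, ht, zero_smul]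
  · simp only [Matrix.smul_mul, Matrix.mul_smul, smul_smul]
    rw [show s * (t * s) = (s * s) * t by ring, hs, zero_mul, zero_smul]
  · simp only [Matrix.smul_mul, Matrix.mul_smul, smul_smul]
    rw [show t * (s * t) = (t * t) * s by ring, ht, zero_mul, zero_smul]

theorem conj_one_add_smul' {K R : Type} [Field K] [CommRing R] {n : ℕ} (χ : K →+* R) {t : R}
    (A B : Matrix (Fin n) (Fin n) K) (hAB : A * B = 1) (X : Matrix (Fin n) (Fin n) K) :
    A.map χ * (1 + t • X.map χ) * B.map χ = 1 + t • (A * X * B).map χ := by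
  have h1 : A.map χ * B.map χ = 1 := by
    rw [← Matrix.map_mul, hAB, Matrix.map_one _ (map_zero χ) (map_one χ)]
  rw [mul_add, add_mul, mul_one, h1, Matrix.mul_smul, Matrix.smul_mul, Matrix.map_mul,
    Matrix.map_mul]

theorem conj_one_add_smul {K R : Type} [Field K] [CommRing R] {n : ℕ} (χ : K →+* R) {t : R}
    (a : Matrix.SpecialLinearGroup (Fin n) K) (X : Matrix (Fin n) (Fin n) K) :
    a.val.map χ * (1 + t • X.map χ) * (a⁻¹).val.map χ =
      1 + t • (a.val * X * (a⁻¹).val).map χ :=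
  conj_one_add_smul' χ _ _ (by
    rw [← Matrix.SpecialLinearGroup.coe_mul, mul_inv_cancel, Matrix.SpecialLinearGroup.coe_one]) X

theorem LinearGroup.mul_mem_zeros {F R : Type} [Field F] [CommRing R] {M : ℕ}
    (𝒢 : LinearGroup F M) {φ : F →+* R} {A B : Matrix (Fin M) (Fin M) R}
    (hA : A ∈ zeros 𝒢.ideal φ) (hB : B ∈ zeros 𝒢.ideal φ) : A * B ∈ zeros 𝒢.ideal φ := by
  obtain ⟨a, ha, rfl⟩ := 𝒢.exists_val_eq hA
  obtain ⟨b, hb, rfl⟩ := 𝒢.exists_val_eq hB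
  exact 𝒢.mul_mem R φ a b ha hb

end SquareZero

/-! ### The differential of a morphism -/

section Morphism

variable {p : ℕ} [Fact p.Prime] {F : Type} [Field F] {M : ℕ}
  {𝒢 : LinearGroup F M} {σ : F →+* ℚ_[p]} (ρ : MorphismToSL2SL2 𝒢 σ)

namespace MorphismToSL2SL2

/-- The value of a component of a morphism at a matrix. -/
noncomputable def ev {R : Type} [CommRing R] (ψ : ℚ_[p] →+* R) (k : Fin 2)
    (A : Matrix (Fin M) (Fin M) R) : Matrix (Fin 2) (Fin 2) R :=
  (ρ.coord k).map (MvPolynomial.eval₂ ψ (fun ij => A ij.1 ij.2))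

theorem ev_map {R S : Type} [CommRing R] [CommRing S] (ψ : ℚ_[p] →+* R) (θ : R →+* S) (k : Fin 2)
    (A : Matrix (Fin M) (Fin M) R) : (ρ.ev ψ k A).map θ = ρ.ev (θ.comp ψ) k (A.map θ) := by
  ext i j
  simp only [ev, Matrix.map_apply]
  rw [MvPolynomial.hom_eval₂]

theorem ev_det {R : Type} [CommRing R] (ψ : ℚ_[p] →+* R) (k : Fin 2)
    {A : Matrix (Fin M) (Fin M) R} (hA : A ∈ zeros 𝒢.ideal (ψ.comp σ)) :
    (ρ.ev ψ k A).det = 1 := by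
  obtain ⟨a, ha, rfl⟩ := 𝒢.exists_val_eq hA
  exact ρ.det_eq_one R ψ a ha k

theorem ev_mul {R : Type} [CommRing R] (ψ : ℚ_[p] →+* R) (k : Fin 2)
    {A B : Matrix (Fin M) (Fin M) R} (hA : A ∈ zeros 𝒢.ideal (ψ.comp σ))
    (hB : B ∈ zeros 𝒢.ideal (ψ.comp σ)) :
    ρ.ev ψ k (A * B) = ρ.ev ψ k A * ρ.ev ψ k B := by
  obtain ⟨a, ha, rfl⟩ := 𝒢.exists_val_eq hA
  obtain ⟨b, hb, rfl⟩ := 𝒢.exists_val_eq hB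
  exact ρ.map_mul R ψ a ha b hb k

theorem ev_one {R : Type} [CommRing R] (ψ : ℚ_[p] →+* R) (k : Fin 2) : ρ.ev ψ k 1 = 1 := by
  have h1 := 𝒢.one_mem R (ψ.comp σ)
  have h := ρ.ev_mul ψ k h1 h1
  rw [mul_one] at h
  have hu : IsUnit (ρ.ev ψ k 1) := by
    rw [Matrix.isUnit_iff_isUnit_det, ρ.ev_det ψ k h1]
    exact isUnit_one
  exact (hu.mul_left_cancel (by rw [mul_one]; exact h)).symm

/-- The differential of a morphism at the identity. -/
noncomputable def diff {K : Type} [Field K] (ψ : ℚ_[p] →+* K) :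
    Matrix (Fin M) (Fin M) K →ₗ[K] (Fin 2 → Matrix (Fin 2) (Fin 2) K) where
  toFun X := fun k => Matrix.of fun i j => diffAtOne (MvPolynomial.map ψ (ρ.coord k i j)) X
  map_add' X Y := by
    ext k i j
    exact map_add (diffAtOneHom (MvPolynomial.map ψ (ρ.coord k i j))) X Y
  map_smul' c X := by
    ext k i j
    exact map_smul (diffAtOneHom (MvPolynomial.map ψ (ρ.coord k i j))) c X

theorem ev_one_add {K R : Type} [Field K] [CommRing R] (ψ : ℚ_[p] →+* K) (χ : K →+* R) (t : R)
    (ht : t * t = 0) (X : Matrix (Fin M) (Fin M) K) (k : Fin 2) :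
    ρ.ev (χ.comp ψ) k (1 + t • X.map χ) = 1 + t • (ρ.diff ψ X k).map χ := by
  have h1 := ρ.ev_one ψ k
  ext i j
  have h2 : MvPolynomial.eval (fun kl => (1 : Matrix (Fin M) (Fin M) K) kl.1 kl.2)
      (MvPolynomial.map ψ (ρ.coord k i j)) = (1 : Matrix (Fin 2) (Fin 2) K) i j := by
    rw [← h1, MvPolynomial.eval_map]
    rfl
  have h := eval₂_one_add χ t ht X (MvPolynomial.map ψ (ρ.coord k i j))
  rw [h2, MvPolynomial.eval₂_map] at h
  refine h.trans ?_
  have h3 : χ ((1 : Matrix (Fin 2) (Fin 2) K) i j) = (1 : Matrix (Fin 2) (Fin 2) R) i j := by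
    simp [Matrix.one_apply, apply_ite χ]
  rw [h3]
  rfl

theorem one_add_mem_zeros {K R : Type} [Field K] [CommRing R] {φ : F →+* K} (χ : K →+* R) (t : R)
    (ht : t * t = 0) {X : Matrix (Fin M) (Fin M) K}
    (hX : X ∈ tangentAtOne (𝒢.baseChange φ).ideal) :
    1 + t • X.map χ ∈ zeros 𝒢.ideal (χ.comp φ) := by
  obtain ⟨a, ha, ha'⟩ := (𝒢.baseChange φ).exists_one_add χ t ht hX
  rw [← ha']
  exact (mem_zeros_map φ χ).1 ha

section Field

variable {K : Type} [Field K] (ψ : ℚ_[p] →+* K)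

theorem trace_diff {X : Matrix (Fin M) (Fin M) K}
    (hX : X ∈ tangentAtOne (𝒢.baseChange (ψ.comp σ)).ideal) (k : Fin 2) :
    (ρ.diff ψ X k).trace = 0 := by
  have h := ρ.ev_det ((TrivSqZeroExt.inlHom K K).comp ψ) k
    (one_add_mem_zeros (φ := ψ.comp σ) (TrivSqZeroExt.inlHom K K) (DualNumber.eps : DualNumber K)
      DualNumber.eps_mul_eps hX)
  rw [ρ.ev_one_add ψ _ _ DualNumber.eps_mul_eps] at h
  have h2 := congrArg TrivSqZeroExt.snd h
  simpa [Matrix.det_fin_two, Matrix.trace_fin_two, add_comm] using h2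

/-- The group commutator of 1 + sX and 1 + tY is 1 + st[X, Y]. Two independent square-zero
parameters are used because the bracket only appears in the mixed second order term. -/
theorem smul_diff_bracket {R : Type} [CommRing R] (χ : K →+* R) {s t : R} (hs : s * s = 0)
    (ht : t * t = 0) {X Y : Matrix (Fin M) (Fin M) K}
    (hX : X ∈ tangentAtOne (𝒢.baseChange (ψ.comp σ)).ideal)
    (hY : Y ∈ tangentAtOne (𝒢.baseChange (ψ.comp σ)).ideal) (k : Fin 2) :
    (s * t) • (ρ.diff ψ X k * ρ.diff ψ Y k - ρ.diff ψ Y k * ρ.diff ψ X k).map χ =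
      (s * t) • (ρ.diff ψ (X * Y - Y * X) k).map χ := by
  have hst : (s * t) * (s * t) = 0 := by
    rw [show (s * t) * (s * t) = (s * s) * (t * t) by ring, hs, zero_mul]
  have m1 := one_add_mem_zeros (φ := ψ.comp σ) χ s hs hX
  have m2 := one_add_mem_zeros (φ := ψ.comp σ) χ t ht hY
  have m3 := one_add_mem_zeros (φ := ψ.comp σ) χ s hs (neg_mem hX)
  have m4 := one_add_mem_zeros (φ := ψ.comp σ) χ t ht (neg_mem hY)
  have m12 := 𝒢.mul_mem_zeros m1 m2
  have m123 := 𝒢.mul_mem_zeros m12 m3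
  have h := ρ.ev_one_add ψ χ (s * t) hst (X * Y - Y * X) k
  have e1 := ρ.ev_mul (χ.comp ψ) k m123 m4
  have e2 := ρ.ev_mul (χ.comp ψ) k m12 m3
  have e3 := ρ.ev_mul (χ.comp ψ) k m1 m2
  rw [← commutator_one_add_smul χ hs ht, e1, e2, e3, ρ.ev_one_add ψ χ s hs,
    ρ.ev_one_add ψ χ t ht, ρ.ev_one_add ψ χ s hs, ρ.ev_one_add ψ χ t ht, map_neg, map_neg,
    Pi.neg_apply, Pi.neg_apply, commutator_one_add_smul χ hs ht] at h
  exact add_left_cancel h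

/-- Over the dual numbers of the dual numbers the product st is a nonzero coordinate direction, so
its coefficient can be read off. -/
theorem diff_bracket {X Y : Matrix (Fin M) (Fin M) K}
    (hX : X ∈ tangentAtOne (𝒢.baseChange (ψ.comp σ)).ideal)
    (hY : Y ∈ tangentAtOne (𝒢.baseChange (ψ.comp σ)).ideal) (k : Fin 2) :
    ρ.diff ψ (X * Y - Y * X) k =
      ρ.diff ψ X k * ρ.diff ψ Y k - ρ.diff ψ Y k * ρ.diff ψ X k := by
  have h := ρ.smul_diff_bracket ψ (R := DualNumber (DualNumber K))
    ((TrivSqZeroExt.inlHom (DualNumber K) (DualNumber K)).comp (TrivSqZeroExt.inlHom K K))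
    (s := TrivSqZeroExt.inl DualNumber.eps) (t := DualNumber.eps)
    (((TrivSqZeroExt.inl_mul (DualNumber K) _ _).symm.trans
      (congrArg TrivSqZeroExt.inl DualNumber.eps_mul_eps)).trans (TrivSqZeroExt.inl_zero _))
    (DualNumber.eps_mul_eps (R := DualNumber K)) hX hY k
  ext i j
  have h2 := congrArg (fun A => TrivSqZeroExt.snd (TrivSqZeroExt.snd (A i j))) h
  simpa using h2.symm

theorem conj_mem_tangentAtOne {φ : F →+* K} {a : Matrix.SpecialLinearGroup (Fin M) K}
    (ha : a ∈ 𝒢.points φ) {X : Matrix (Fin M) (Fin M) K}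
    (hX : X ∈ tangentAtOne (𝒢.baseChange φ).ideal) :
    a.val * X * (a⁻¹).val ∈ tangentAtOne (𝒢.baseChange φ).ideal := by
  rw [LinearGroup.mem_tangentAtOne_iff]
  refine (mem_zeros_map φ _).2 ?_
  rw [← conj_one_add_smul (TrivSqZeroExt.inlHom K K)]
  exact 𝒢.mul_mem_zeros (𝒢.mul_mem_zeros (map_mem_zeros ha _)
    (one_add_mem_zeros _ _ DualNumber.eps_mul_eps hX))
    (map_mem_zeros (inv_mem ha : a⁻¹ ∈ 𝒢.points φ) _)

theorem smul_diff_conj {R : Type} [CommRing R] (χ : K →+* R) {t : R} (ht : t * t = 0)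
    {a : Matrix.SpecialLinearGroup (Fin M) K}
    (ha : a ∈ 𝒢.points (ψ.comp σ)) {X : Matrix (Fin M) (Fin M) K}
    (hX : X ∈ tangentAtOne (𝒢.baseChange (ψ.comp σ)).ideal) (k : Fin 2) :
    t • (ρ.ev ψ k a.val * ρ.diff ψ X k * ρ.ev ψ k (a⁻¹).val).map χ =
      t • (ρ.diff ψ (a.val * X * (a⁻¹).val) k).map χ := by
  have m1 : a.val.map χ ∈ zeros 𝒢.ideal ((χ.comp ψ).comp σ) := map_mem_zeros ha χ
  have m3 : (a⁻¹).val.map χ ∈ zeros 𝒢.ideal ((χ.comp ψ).comp σ) :=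
    map_mem_zeros (inv_mem ha : a⁻¹ ∈ 𝒢.points _) χ
  have m2 := one_add_mem_zeros (φ := ψ.comp σ) χ t ht hX
  have h := ρ.ev_one_add ψ χ t ht (a.val * X * (a⁻¹).val) k
  have e1 := ρ.ev_mul (χ.comp ψ) k (𝒢.mul_mem_zeros m1 m2) m3
  have e2 := ρ.ev_mul (χ.comp ψ) k m1 m2
  have hinv : ρ.ev ψ k a.val * ρ.ev ψ k (a⁻¹).val = 1 := by
    rw [← ρ.ev_mul ψ k ha (inv_mem ha : a⁻¹ ∈ 𝒢.points _), ← Matrix.SpecialLinearGroup.coe_mul,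
      mul_inv_cancel, Matrix.SpecialLinearGroup.coe_one, ρ.ev_one]
  rw [← conj_one_add_smul χ, e1, e2, ρ.ev_one_add ψ χ t ht, ← ρ.ev_map, ← ρ.ev_map,
    conj_one_add_smul' χ _ _ hinv] at h
  exact add_left_cancel h

theorem diff_conj {a : Matrix.SpecialLinearGroup (Fin M) K}
    (ha : a ∈ 𝒢.points (ψ.comp σ)) {X : Matrix (Fin M) (Fin M) K}
    (hX : X ∈ tangentAtOne (𝒢.baseChange (ψ.comp σ)).ideal) (k : Fin 2) :
    ρ.diff ψ (a.val * X * (a⁻¹).val) k =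
      ρ.ev ψ k a.val * ρ.diff ψ X k * ρ.ev ψ k (a⁻¹).val := by
  have h := ρ.smul_diff_conj ψ (TrivSqZeroExt.inlHom K K) DualNumber.eps_mul_eps ha hX k
  ext i j
  have h2 := congrArg (fun A => TrivSqZeroExt.snd (A i j)) h
  simpa [-Matrix.map_mul] using h2.symm

end Field

end MorphismToSL2SL2

end Morphism


/-! ### Composite base change and the space sl₂ × sl₂ -/

section Scalars

variable {F K : Type} [Field F] [Field K] {M : ℕ}

theorem LinearGroup.ideal_baseChange_baseChange {E : Type} [Field E] (𝒢 : LinearGroup F M)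
    (φ : F →+* E) (ψ : E →+* K) :
    ((𝒢.baseChange φ).baseChange ψ).ideal = (𝒢.baseChange (ψ.comp φ)).ideal := by
  change (𝒢.ideal.map (MvPolynomial.map φ)).map (MvPolynomial.map ψ) =
    𝒢.ideal.map (MvPolynomial.map (ψ.comp φ))
  rw [Ideal.map_map]
  congr 1
  ext <;> simp

theorem diffAtOne_map (φ : F →+* K) (f : MvPolynomial (Fin M × Fin M) F)
    (X : Matrix (Fin M) (Fin M) F) :
    diffAtOne (MvPolynomial.map φ f) (X.map φ) = φ (diffAtOne f X) := by
  simp only [diffAtOne, map_sum, Matrix.map_apply]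
  refine Finset.sum_congr rfl fun ij _ => ?_
  have h1 : (fun kl : Fin M × Fin M => (1 : Matrix (Fin M) (Fin M) K) kl.1 kl.2) =
      φ ∘ fun kl => (1 : Matrix (Fin M) (Fin M) F) kl.1 kl.2 := by
    funext kl
    simp [Matrix.one_apply, apply_ite φ]
  rw [MvPolynomial.pderiv_map, MvPolynomial.eval_map, h1, ← MvPolynomial.eval₂_comp, map_mul]

theorem tangentAtOne_anti {I J : Ideal (MvPolynomial (Fin M × Fin M) K)} (h : I ≤ J) :
    tangentAtOne J ≤ tangentAtOne I := fun _ hX f hf => hX f (h hf)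

/-- Pairs of traceless matrices. -/
def sl2sq (K : Type) [Field K] : Submodule K (Fin 2 → Matrix (Fin 2) (Fin 2) K) where
  carrier := {Y | ∀ k, (Y k).trace = 0}
  zero_mem' k := by simp
  add_mem' hX hY k := by simp [hX k, hY k]
  smul_mem' c X hX k := by simp [hX k]

/-- Coordinates on pairs of traceless matrices. -/
def sl2sqEquiv (K : Type) [Field K] : sl2sq K ≃ₗ[K] (Fin 2 × Fin 3 → K) where
  toFun Y := fun i => ![Y.1 i.1 0 0, Y.1 i.1 0 1, Y.1 i.1 1 0] i.2
  invFun c := ⟨fun k => !![c (k, 0), c (k, 1); c (k, 2), -c (k, 0)], fun k => by simp [Matrix.trace_fin_two]⟩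
  left_inv Y := by
    ext k i j
    have h := Y.2 k
    rw [Matrix.trace_fin_two] at h
    fin_cases i <;> fin_cases j <;> simp
    linear_combination -h
  right_inv c := by
    ext ⟨k, i⟩
    fin_cases i <;> simp
  map_add' X Y := by
    ext ⟨k, i⟩
    fin_cases i <;> simp
  map_smul' c X := by
    ext ⟨k, i⟩
    fin_cases i <;> simp

theorem finrank_sl2sq (K : Type) [Field K] : Module.finrank K (sl2sq K) = 6 := by
  rw [(sl2sqEquiv K).finrank_eq, Module.finrank_fintype_fun_eq_card]
  rfl

end Scalars

/-! ### The differential of an isogeny is bijective -/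

section Isogeny

variable {p : ℕ} [Fact p.Prime] {F : Type} [Field F] {M : ℕ}
  {𝒢 : LinearGroup F M} {σ : F →+* ℚ_[p]} (ρ : MorphismToSL2SL2 𝒢 σ)

namespace MorphismToSL2SL2

/-- The ideal of the kernel of a morphism. -/
noncomputable def kerIdeal : Ideal (MvPolynomial (Fin M × Fin M) ℚ_[p]) :=
  𝒢.ideal.map (MvPolynomial.map σ) ⊔ Ideal.span (Set.range fun kij : Fin 2 × Fin 2 × Fin 2 =>
    ρ.coord kij.1 kij.2.1 kij.2.2 -
      MvPolynomial.C ((1 : Matrix (Fin 2) (Fin 2) ℚ_[p]) kij.2.1 kij.2.2))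

theorem mem_zeros_kerIdeal {R : Type} [CommRing R] {ψ : ℚ_[p] →+* R}
    {A : Matrix (Fin M) (Fin M) R} :
    A ∈ zeros ρ.kerIdeal ψ ↔ A ∈ zeros 𝒢.ideal (ψ.comp σ) ∧ ∀ k, ρ.ev ψ k A = 1 := by
  rw [mem_zeros_iff_le_ker, kerIdeal, sup_le_iff, ← mem_zeros_iff_le_ker, mem_zeros_map,
    Ideal.span_le]
  refine and_congr_right fun _ => ?_
  have key : ∀ k i j, MvPolynomial.eval₂Hom ψ (fun ij => A ij.1 ij.2) (ρ.coord k i j -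
      MvPolynomial.C ((1 : Matrix (Fin 2) (Fin 2) ℚ_[p]) i j)) = 0 ↔
      ρ.ev ψ k A i j = (1 : Matrix (Fin 2) (Fin 2) R) i j := by
    intro k i j
    rw [map_sub, sub_eq_zero, MvPolynomial.eval₂Hom_C]
    have : ψ ((1 : Matrix (Fin 2) (Fin 2) ℚ_[p]) i j) = (1 : Matrix (Fin 2) (Fin 2) R) i j := by
      simp [Matrix.one_apply, apply_ite ψ]
    rw [this]
    rfl
  constructor
  · intro h k
    ext i j
    exact (key k i j).1 (h ⟨(k, i, j), rfl⟩)
  · rintro h _ ⟨⟨k, i, j⟩, rfl⟩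
    exact (key k i j).2 (by rw [h k])

/-- The kernel of a morphism, as an algebraic group. -/
noncomputable def ker : LinearGroup ℚ_[p] M where
  ideal := ρ.kerIdeal
  det_sub_one_mem := Ideal.mem_sup_left (𝒢.baseChange σ).det_sub_one_mem
  one_mem R _ ψ := ρ.mem_zeros_kerIdeal.2 ⟨𝒢.one_mem R _, ρ.ev_one ψ⟩
  mul_mem R _ ψ a b ha hb := by
    rw [mem_zeros_kerIdeal] at ha hb ⊢
    refine ⟨𝒢.mul_mem R _ a b ha.1 hb.1, fun k => ?_⟩
    rw [Matrix.SpecialLinearGroup.coe_mul, ρ.ev_mul ψ k ha.1 hb.1, ha.2, hb.2, mul_one]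
  inv_mem R _ ψ a ha := by
    rw [mem_zeros_kerIdeal] at ha ⊢
    have h := 𝒢.inv_mem R _ a ha.1
    refine ⟨h, fun k => ?_⟩
    have h1 := ρ.ev_mul ψ k h ha.1
    rwa [← Matrix.SpecialLinearGroup.coe_mul, inv_mul_cancel, Matrix.SpecialLinearGroup.coe_one,
      ρ.ev_one, ha.2, mul_one, eq_comm] at h1

/-- A tangent vector killed by the differential is tangent to the scheme-theoretic kernel, which is
a group with finitely many points. -/
theorem eq_zero_of_diff_eq_zero_of_isAlgClosed {K : Type} [Field K] [IsAlgClosed K] [CharZero K]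
    (ψ : ℚ_[p] →+* K) (hfin : Finite (ρ.onPoints ψ).ker) {X : Matrix (Fin M) (Fin M) K}
    (hX : X ∈ tangentAtOne (𝒢.baseChange (ψ.comp σ)).ideal) (h0 : ρ.diff ψ X = 0) : X = 0 := by
  have hfin' : (zeros (ρ.ker.baseChange ψ).ideal (RingHom.id K)).Finite := by
    refine (Set.finite_range fun x : (ρ.onPoints ψ).ker => x.1.1.val).subset fun A hA => ?_
    have hA' := ρ.mem_zeros_kerIdeal.1 ((mem_zeros_map ψ _).1 hA)
    obtain ⟨a, ha, rfl⟩ := 𝒢.exists_val_eq hA'.1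
    refine ⟨⟨⟨a, ha⟩, ?_⟩, rfl⟩
    exact Prod.ext (Subtype.ext (hA'.2 0)) (Subtype.ext (hA'.2 1))
  have hbot := (ρ.ker.baseChange ψ).tangentAtOne_eq_bot_of_finite hfin'
  have hmem : X ∈ tangentAtOne (ρ.ker.baseChange ψ).ideal := by
    rw [LinearGroup.mem_tangentAtOne_iff]
    refine (mem_zeros_map ψ _).2 (ρ.mem_zeros_kerIdeal.2 ⟨?_, fun k => ?_⟩)
    · exact one_add_mem_zeros (φ := ψ.comp σ) (TrivSqZeroExt.inlHom K K) _
        DualNumber.eps_mul_eps hX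
    · have h := ρ.ev_one_add ψ (TrivSqZeroExt.inlHom K K) _ DualNumber.eps_mul_eps X k
      rw [h0] at h
      refine h.trans ?_
      ext i j <;> simp
  rw [hbot] at hmem
  exact hmem

theorem diff_map {K : Type} [Field K] (ψ : ℚ_[p] →+* K) (X : Matrix (Fin M) (Fin M) ℚ_[p])
    (k : Fin 2) :
    ρ.diff ψ (X.map ψ) k = (ρ.diff (RingHom.id ℚ_[p]) X k).map ψ := by
  ext i j
  have h := diffAtOne_map ψ (MvPolynomial.map (RingHom.id ℚ_[p]) (ρ.coord k i j)) X
  rw [MvPolynomial.map_map, RingHom.comp_id] at h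
  exact h

theorem IsIsogeny.eq_zero_of_diff_eq_zero (hρ : ρ.IsIsogeny) {X : Matrix (Fin M) (Fin M) ℚ_[p]}
    (hX : X ∈ tangentAtOne (𝒢.baseChange σ).ideal)
    (h0 : ρ.diff (RingHom.id ℚ_[p]) X = 0) : X = 0 := by
  let ψ := algebraMap ℚ_[p] (AlgebraicClosure ℚ_[p])
  have h1 : X.map ψ ∈ tangentAtOne (𝒢.baseChange (ψ.comp σ)).ideal := by
    rw [← LinearGroup.ideal_baseChange_baseChange]
    exact (𝒢.baseChange σ).map_mem_tangentAtOne_baseChange ψ hX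
  have h2 := ρ.eq_zero_of_diff_eq_zero_of_isAlgClosed ψ hρ.2 h1 (by
    funext k
    rw [diff_map, h0]
    ext i j
    simp)
  ext i j
  exact ψ.injective (by simpa using congrFun (congrFun h2 i) j)

section Surjective

variable {K : Type} [Field K]

theorem one_add_smul_mul_one_add_smul {N : Matrix (Fin 2) (Fin 2) K} (hN : N * N = 0) (s t : K) :
    (1 + s • N) * (1 + t • N) = 1 + (s + t) • N := by
  simp only [add_mul, mul_add, one_mul, mul_one, smul_mul_smul_comm, hN, smul_zero, add_zero,
    add_smul]
  abel

/-- The one-parameter group `t ↦ (1 + t N₀, 1 + t N₁)` for square-zero `N`. -/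
def unipotentPair (N : Fin 2 → Matrix (Fin 2) (Fin 2) K) (hN : ∀ k, N k * N k = 0) :
    Subgroup (SL(2, K) × SL(2, K)) where
  carrier := {a | ∃ t : K, a.1.val = 1 + t • N 0 ∧ a.2.val = 1 + t • N 1}
  one_mem' := ⟨0, by simp⟩
  mul_mem' := by
    rintro a b ⟨s, h0, h1⟩ ⟨t, h0', h1'⟩
    exact ⟨s + t, by rw [Prod.fst_mul, Matrix.SpecialLinearGroup.coe_mul, h0, h0',
      one_add_smul_mul_one_add_smul (hN 0)], by rw [Prod.snd_mul,
      Matrix.SpecialLinearGroup.coe_mul, h1, h1', one_add_smul_mul_one_add_smul (hN 1)]⟩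
  inv_mem' := by
    have key : ∀ (a : SL(2, K)) (t : K) (N : Matrix (Fin 2) (Fin 2) K), N * N = 0 →
        a.val = 1 + t • N → (a⁻¹).val = 1 + (-t) • N := by
      intro a t N hN h
      have h1 : a.val * (1 + (-t) • N) = 1 := by
        rw [h, one_add_smul_mul_one_add_smul hN, add_neg_cancel, zero_smul, add_zero]
      have h2 : (a⁻¹).val * a.val = 1 := by
        rw [← Matrix.SpecialLinearGroup.coe_mul, inv_mul_cancel, Matrix.SpecialLinearGroup.coe_one]
      calc (a⁻¹).val = (a⁻¹).val * (a.val * (1 + (-t) • N)) := by rw [h1, mul_one]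
        _ = _ := by rw [← mul_assoc, h2, one_mul]
    rintro a ⟨t, h0, h1⟩
    exact ⟨-t, key _ _ _ (hN 0) h0, key _ _ _ (hN 1) h1⟩

theorem det_one_add_of_sq_eq_zero {N : Matrix (Fin 2) (Fin 2) K} (hN : N * N = 0) (t : K) :
    (1 + t • N).det = 1 := by
  have htr : N.trace = 0 ∧ N.det = 0 := by
    have hd : N.det = 0 := by
      have h := congrArg Matrix.det hN
      rw [Matrix.det_mul, Matrix.det_zero] at h
      exact mul_self_eq_zero.1 h
    refine ⟨?_, hd⟩
    have h00 := congrFun (congrFun hN 0) 0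
    have h11 := congrFun (congrFun hN 1) 1
    rw [Matrix.det_fin_two] at hd
    simp only [Matrix.mul_apply, Fin.sum_univ_two, Matrix.zero_apply] at h00 h11
    have : (N 0 0 + N 1 1) * (N 0 0 + N 1 1) = 0 := by
      linear_combination h00 + h11 + 2 * hd
    rw [Matrix.trace_fin_two]
    exact mul_self_eq_zero.1 this
  rw [Matrix.trace_fin_two, Matrix.det_fin_two] at htr
  simp only [Matrix.det_fin_two, Matrix.add_apply, Matrix.smul_apply, smul_eq_mul,
    Matrix.one_apply_eq, Matrix.one_apply_ne zero_ne_one, Matrix.one_apply_ne one_ne_zero]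
  linear_combination t * htr.1 + t ^ 2 * htr.2

/-- The preimage of the one-parameter group t ↦ 1 + tN is infinite, so its Zariski closure has a
tangent vector X ≠ 0. The image of X lies on the line of N and is nonzero by injectivity. This gives
surjectivity of the differential without dimension theory. -/
theorem exists_diff_eq_of_sq_eq_zero [IsAlgClosed K] [CharZero K] (ψ : ℚ_[p] →+* K)
    (hsurj : Function.Surjective (ρ.onPoints ψ)) (hfin : Finite (ρ.onPoints ψ).ker)
    {N : Fin 2 → Matrix (Fin 2) (Fin 2) K} (hN : ∀ k, N k * N k = 0) :
    ∃ X ∈ tangentAtOne (𝒢.baseChange (ψ.comp σ)).ideal, ρ.diff ψ X = N := by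
  by_cases hN0 : N = 0
  · exact ⟨0, zero_mem _, by rw [map_zero, hN0]⟩
  obtain ⟨k₀, i₀, j₀, hne⟩ : ∃ k i j, N k i j ≠ 0 := by
    by_contra! h
    exact hN0 (by ext k i j; exact h k i j)
  let U := unipotentPair N hN
  let L : Subgroup (Matrix.SpecialLinearGroup (Fin M) K) :=
    (U.comap (ρ.onPoints ψ)).map (𝒢.points (ψ.comp σ)).subtype
  have hLmem : ∀ a ∈ L, a ∈ 𝒢.points (ψ.comp σ) ∧ ∃ t : K, ∀ k, ρ.ev ψ k a.val = 1 + t • N k := by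
    rintro _ ⟨a, ⟨t, h0, h1⟩, rfl⟩
    exact ⟨a.2, t, Fin.forall_fin_two.2 ⟨h0, h1⟩⟩
  have hL : (L : Set (Matrix.SpecialLinearGroup (Fin M) K)).Infinite := by
    have hex : ∀ t : K, ∃ a ∈ L, ∀ k, ρ.ev ψ k a.val = 1 + t • N k := by
      intro t
      obtain ⟨a, ha⟩ := hsurj (⟨_, det_one_add_of_sq_eq_zero (hN 0) t⟩,
        ⟨_, det_one_add_of_sq_eq_zero (hN 1) t⟩)
      have h0 : ρ.ev ψ 0 a.1.val = 1 + t • N 0 := congrArg (fun x => x.1.val) ha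
      have h1 : ρ.ev ψ 1 a.1.val = 1 + t • N 1 := congrArg (fun x => x.2.val) ha
      exact ⟨a.1, ⟨a, ⟨t, h0, h1⟩, rfl⟩, Fin.forall_fin_two.2 ⟨h0, h1⟩⟩
    choose f hfL hf using hex
    have hinj : Function.Injective f := by
      intro s t hst
      have h1 := hf s k₀
      rw [hst, hf t k₀, add_right_inj] at h1
      have h := congrFun (congrFun h1 i₀) j₀
      simp only [Matrix.smul_apply, smul_eq_mul] at h
      exact (mul_right_cancel₀ hne h).symm
    have : Infinite K := CharZero.infinite K
    exact Set.infinite_of_injective_forall_mem hinj hfL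
  obtain ⟨X, hX, hX0⟩ := (Submodule.ne_bot_iff _).1 (tangentAtOne_vanishing_ne_bot L hL)
  have hXT : X ∈ tangentAtOne (𝒢.baseChange (ψ.comp σ)).ideal := by
    refine tangentAtOne_anti (fun f hf => ?_) hX
    rw [mem_vanishing]
    rintro _ ⟨a, ha, rfl⟩
    have h := (mem_zeros_map (ψ.comp σ) (RingHom.id K)).2 (hLmem a ha).1 f hf
    rwa [MvPolynomial.eval₂_id] at h
  -- The entries of ρ − 1 take the values t N k i j on the group, so they satisfy the linear
  -- relations expressing proportionality to N. Differentiating these relations shows that the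
  -- differential of X is proportional to N.
  have hdiff : ∀ k i j, N k₀ i₀ j₀ * ρ.diff ψ X k i j = N k i j * ρ.diff ψ X k₀ i₀ j₀ := by
    intro k i j
    let q : Fin 2 → Fin 2 → Fin 2 → MvPolynomial (Fin M × Fin M) K := fun k i j =>
      MvPolynomial.map ψ (ρ.coord k i j) -
        MvPolynomial.C ((1 : Matrix (Fin 2) (Fin 2) K) i j)
    have hq : ∀ k i j, diffAtOne (q k i j) X = ρ.diff ψ X k i j := by
      intro k i j
      rw [← diffAtOneHom_apply, map_sub, LinearMap.sub_apply, diffAtOneHom_apply,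
        diffAtOneHom_apply, diffAtOne_C, sub_zero]
      rfl
    have hv : N k₀ i₀ j₀ • q k i j - N k i j • q k₀ i₀ j₀ ∈
        vanishing (Subtype.val '' (L : Set (Matrix.SpecialLinearGroup (Fin M) K))) := by
      rw [mem_vanishing]
      rintro _ ⟨a, ha, rfl⟩
      obtain ⟨-, t, ht⟩ := hLmem a ha
      have hqa : ∀ k i j, MvPolynomial.eval (fun ij => a.val ij.1 ij.2) (q k i j) =
          t * N k i j := by
        intro k i j
        have h := congrFun (congrFun (ht k) i) j
        rw [Matrix.add_apply, Matrix.smul_apply, smul_eq_mul] at h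
        rw [map_sub, MvPolynomial.eval_map, MvPolynomial.eval_C, sub_eq_iff_eq_add, add_comm, ← h]
        rfl
      rw [map_sub, MvPolynomial.smul_eval, MvPolynomial.smul_eval, hqa, hqa]
      ring
    have h := hX _ hv
    rw [← diffAtOneHom_apply, map_sub, map_smul, map_smul, LinearMap.sub_apply,
      LinearMap.smul_apply, LinearMap.smul_apply, diffAtOneHom_apply, diffAtOneHom_apply, hq, hq,
      sub_eq_zero] at h
    exact h
  obtain ⟨c, hc⟩ : ∃ c : K, ρ.diff ψ X = c • N := by
    refine ⟨ρ.diff ψ X k₀ i₀ j₀ / N k₀ i₀ j₀, ?_⟩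
    ext k i j
    rw [Pi.smul_apply, Matrix.smul_apply, smul_eq_mul, div_mul_eq_mul_div, eq_div_iff hne,
      mul_comm, hdiff, mul_comm]
  have hc0 : c ≠ 0 := by
    intro h0
    rw [h0, zero_smul] at hc
    exact hX0 (ρ.eq_zero_of_diff_eq_zero_of_isAlgClosed ψ hfin hXT hc)
  exact ⟨c⁻¹ • X, Submodule.smul_mem _ _ hXT, by
    rw [map_smul, hc, smul_smul, inv_mul_cancel₀ hc0, one_smul]⟩

theorem exists_diff_eq [IsAlgClosed K] [CharZero K] (ψ : ℚ_[p] →+* K)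
    (hsurj : Function.Surjective (ρ.onPoints ψ)) (hfin : Finite (ρ.onPoints ψ).ker)
    {Y : Fin 2 → Matrix (Fin 2) (Fin 2) K} (hY : Y ∈ sl2sq K) :
    ∃ X ∈ tangentAtOne (𝒢.baseChange (ψ.comp σ)).ideal, ρ.diff ψ X = Y := by
  -- Square-zero matrices span sl₂: the matrix (a, b; c, −a) is the sum of (0, b + a; 0, 0), (0, 0;
  -- c − a, 0) and (a, −a; a, −a).
  obtain ⟨X1, h1, e1⟩ := ρ.exists_diff_eq_of_sq_eq_zero ψ hsurj hfin
    (N := fun k => !![0, Y k 0 1 + Y k 0 0; 0, 0]) (fun k => by ext i j; fin_cases i <;> fin_cases j <;> simp)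
  obtain ⟨X2, h2, e2⟩ := ρ.exists_diff_eq_of_sq_eq_zero ψ hsurj hfin
    (N := fun k => !![0, 0; Y k 1 0 - Y k 0 0, 0]) (fun k => by ext i j; fin_cases i <;> fin_cases j <;> simp)
  obtain ⟨X3, h3, e3⟩ := ρ.exists_diff_eq_of_sq_eq_zero ψ hsurj hfin
    (N := fun k => !![Y k 0 0, -Y k 0 0; Y k 0 0, -Y k 0 0])
    (fun k => by ext i j; fin_cases i <;> fin_cases j <;> simp)
  refine ⟨X1 + X2 + X3, add_mem (add_mem h1 h2) h3, ?_⟩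
  rw [map_add, map_add, e1, e2, e3]
  ext k i j
  have h := hY k
  rw [Matrix.trace_fin_two] at h
  fin_cases i <;> fin_cases j <;> simp
  linear_combination -h

end Surjective

theorem IsIsogeny.finrank_tangentAtOne (hρ : ρ.IsIsogeny) :
    Module.finrank F (tangentAtOne 𝒢.ideal) = 6 := by
  let ψ := algebraMap ℚ_[p] (AlgebraicClosure ℚ_[p])
  rw [𝒢.finrank_tangentAtOne (ψ.comp σ), ← finrank_sl2sq (AlgebraicClosure ℚ_[p])]
  let T := tangentAtOne (𝒢.baseChange (ψ.comp σ)).ideal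
  let d : T →ₗ[AlgebraicClosure ℚ_[p]] sl2sq (AlgebraicClosure ℚ_[p]) :=
    ((ρ.diff ψ).comp T.subtype).codRestrict _ fun X k => ρ.trace_diff ψ X.2 k
  refine (LinearEquiv.ofBijective d ⟨?_, ?_⟩).finrank_eq
  · rw [← LinearMap.ker_eq_bot, LinearMap.ker_eq_bot']
    intro X hX
    exact Subtype.ext (ρ.eq_zero_of_diff_eq_zero_of_isAlgClosed ψ hρ.2 X.2
      (congrArg Subtype.val hX))
  · intro Y
    obtain ⟨X, hX, h⟩ := ρ.exists_diff_eq ψ hρ.1 hρ.2 Y.2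
    exact ⟨⟨X, hX⟩, Subtype.ext h⟩

end MorphismToSL2SL2

end Isogeny


/-! ### The Killing form through the p-adic differential -/

section KillingForm

namespace ArithmeticData

variable {p : ℕ} [Fact p.Prime] {F : Type} [Field F] [NumberField F] {M : ℕ}
  (D : ArithmeticData p F M)

/-- The differential of the isogeny on the Lie algebra over `F`. -/
noncomputable def d : D.𝒢.lieAlgebra →ₛₗ[D.σ] (Fin 2 → Matrix (Fin 2) (Fin 2) ℚ_[p]) where
  toFun X := D.ρ.diff (RingHom.id ℚ_[p]) (X.val.map D.σ)
  map_add' X Y := by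
    rw [← map_add]
    congr 1
    ext i j
    simp
  map_smul' c X := by
    rw [← map_smul]
    congr 1
    ext i j
    simp

theorem map_mem_tangentAtOne (X : D.𝒢.lieAlgebra) :
    X.val.map D.σ ∈ tangentAtOne (D.𝒢.baseChange D.σ).ideal :=
  D.𝒢.map_mem_tangentAtOne_baseChange D.σ X.2

theorem d_mem (X : D.𝒢.lieAlgebra) : D.d X ∈ sl2sq ℚ_[p] := fun k =>
  D.ρ.trace_diff (RingHom.id ℚ_[p]) (D.map_mem_tangentAtOne X) k

theorem d_lie (X Y : D.𝒢.lieAlgebra) (k : Fin 2) :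
    D.d ⁅X, Y⁆ k = D.d X k * D.d Y k - D.d Y k * D.d X k := by
  have h := D.ρ.diff_bracket (RingHom.id ℚ_[p]) (D.map_mem_tangentAtOne X)
    (D.map_mem_tangentAtOne Y) k
  refine Eq.trans ?_ h
  refine congrFun (congrArg (D.ρ.diff (RingHom.id ℚ_[p])) ?_) k
  have h1 : (⁅X, Y⁆ : D.𝒢.lieAlgebra).val = X.val * Y.val - Y.val * X.val := rfl
  rw [h1, ← Matrix.map_mul, ← Matrix.map_mul]
  exact Matrix.map_sub D.σ (map_sub D.σ) _ _

theorem finrank_lieAlgebra : Module.finrank F D.𝒢.lieAlgebra = 6 :=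
  MorphismToSL2SL2.IsIsogeny.finrank_tangentAtOne D.ρ D.isIsogeny

/-- A basis of the Lie algebra. -/
noncomputable def basis : Module.Basis (Fin 6) F D.𝒢.lieAlgebra :=
  Module.finBasisOfFinrankEq F _ D.finrank_lieAlgebra

theorem linearIndependent_d {ι : Type} [Finite ι] {e : ι → D.𝒢.lieAlgebra}
    (he : LinearIndependent F e) : LinearIndependent ℚ_[p] fun i => D.d (e i) := by
  have := Fintype.ofFinite ι
  have hb : LinearIndependent F fun i => (e i).val :=
    he.map' D.𝒢.lieAlgebra.toSubmodule.subtype (Submodule.ker_subtype _)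
  have h2 := linearIndependent_map D.σ hb
  rw [Fintype.linearIndependent_iff] at h2 ⊢
  intro c hc
  refine h2 c (D.isIsogeny.eq_zero_of_diff_eq_zero D.ρ (sum_mem fun i _ =>
    Submodule.smul_mem _ _ (D.map_mem_tangentAtOne (e i))) ?_)
  rw [map_sum, ← hc]
  exact Finset.sum_congr rfl fun i _ => map_smul _ _ _

/-- The basis of `sl₂ × sl₂` over `ℚ_p` coming from a basis of the Lie algebra over `F`. -/
noncomputable def padicBasis : Module.Basis (Fin 6) ℚ_[p] (sl2sq ℚ_[p]) :=
  basisOfLinearIndependentOfCardEqFinrank (b := fun i => ⟨D.d (D.basis i), D.d_mem _⟩)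
    (LinearIndependent.of_comp (sl2sq ℚ_[p]).subtype
      (D.linearIndependent_d D.basis.linearIndependent))
    (by rw [finrank_sl2sq, Fintype.card_fin])

theorem coe_padicBasis (i : Fin 6) : (D.padicBasis i).1 = D.d (D.basis i) := by
  rw [padicBasis, coe_basisOfLinearIndependentOfCardEqFinrank]

theorem padicBasis_repr (X : D.𝒢.lieAlgebra) (i : Fin 6) :
    D.padicBasis.repr ⟨D.d X, D.d_mem X⟩ i = D.σ (D.basis.repr X i) := by
  have h : (⟨D.d X, D.d_mem X⟩ : sl2sq ℚ_[p]) =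
      ∑ i, D.σ (D.basis.repr X i) • D.padicBasis i := by
    refine Subtype.ext ?_
    rw [Submodule.coe_sum]
    change D.d X = _
    conv_lhs => rw [← D.basis.sum_repr X]
    rw [map_sum]
    refine Finset.sum_congr rfl fun i _ => ?_
    rw [map_smulₛₗ, Submodule.coe_smul, coe_padicBasis]
  rw [h, map_sum, Finsupp.finsetSum_apply, Finset.sum_eq_single i]
  · simp
  · intro j _ hj
    simp [hj]
  · simp

end ArithmeticData

/-- The bracket on pairs of traceless matrices, as a linear endomorphism. -/
def adPair {K : Type} [Field K] (A : Fin 2 → Matrix (Fin 2) (Fin 2) K) :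
    sl2sq K →ₗ[K] sl2sq K where
  toFun Y := ⟨fun k => A k * Y.1 k - Y.1 k * A k, fun k => by
    rw [Matrix.trace_sub, Matrix.trace_mul_comm, sub_self]⟩
  map_add' Y Z := by
    ext1
    funext k
    simp only [Submodule.coe_add, Pi.add_apply, mul_add, add_mul]
    abel
  map_smul' c Y := by
    ext1
    funext k
    simp [smul_sub]

/-- The Killing form of `sl₂ × sl₂`. -/
theorem trace_adPair_comp {K : Type} [Field K] {A B : Fin 2 → Matrix (Fin 2) (Fin 2) K}
    (hA : A ∈ sl2sq K) (hB : B ∈ sl2sq K) :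
    LinearMap.trace K (sl2sq K) (adPair A ∘ₗ adPair B) = 4 * ∑ k, (A k * B k).trace := by
  have h0A := hA 0
  have h1A := hA 1
  have h0B := hB 0
  have h1B := hB 1
  rw [Matrix.trace_fin_two, add_comm, ← eq_neg_iff_add_eq_zero] at h0A h1A h0B h1B
  rw [LinearMap.trace_eq_matrix_trace K (Module.Basis.ofEquivFun (sl2sqEquiv K)), Matrix.trace,
    Fintype.sum_prod_type]
  simp only [Matrix.diag_apply, LinearMap.toMatrix_apply, Module.Basis.coe_ofEquivFun,
    Module.Basis.ofEquivFun_repr_apply, Fin.sum_univ_two, Fin.sum_univ_three, LinearMap.comp_apply]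
  simp [sl2sqEquiv, adPair, Matrix.trace_fin_two, Matrix.mul_apply, Fin.sum_univ_two,
    Matrix.vecMul, dotProduct, h0A, h1A, h0B, h1B]
  ring

namespace ArithmeticData

variable {p : ℕ} [Fact p.Prime] {F : Type} [Field F] [NumberField F] {M : ℕ}
  (D : ArithmeticData p F M)

/-- The differential carries an F-basis to a ℚ_p-basis of sl₂ × sl₂ and respects brackets. Hence the
matrices of ad correspond under σ, and so do the traces of their products. -/
theorem σ_killingForm (X Y : D.𝒢.lieAlgebra) :
    D.σ (killingForm F D.𝒢.lieAlgebra X Y) = 4 * ∑ k, (D.d X k * D.d Y k).trace := by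
  rw [← trace_adPair_comp (D.d_mem X) (D.d_mem Y), killingForm_apply_apply,
    LinearMap.trace_eq_matrix_trace F D.basis, LinearMap.trace_eq_matrix_trace ℚ_[p] D.padicBasis,
    Matrix.trace, Matrix.trace, map_sum]
  refine Finset.sum_congr rfl fun i _ => ?_
  rw [Matrix.diag_apply, Matrix.diag_apply, LinearMap.toMatrix_apply, LinearMap.toMatrix_apply,
    ← padicBasis_repr]
  congr 2
  refine Subtype.ext ?_
  funext k
  simp only [LinearMap.comp_apply, LieAlgebra.ad_apply, d_lie, adPair, LinearMap.coe_mk,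
    AddHom.coe_mk, coe_padicBasis]

end ArithmeticData

end KillingForm


/-! ### The Killing form at the archimedean places -/

section Definiteness

theorem exists_mulVec_eq_of_isRoot_charpoly {n : ℕ} {B : Matrix (Fin n) (Fin n) ℂ} {μ : ℂ}
    (h : B.charpoly.IsRoot μ) : ∃ v ≠ 0, B.mulVec v = μ • v := by
  have h1 : (Matrix.scalar (Fin n) μ - B).det = 0 := by
    rw [← Matrix.eval_charpoly]
    exact h
  obtain ⟨v, hv, hv2⟩ := Matrix.exists_mulVec_eq_zero_iff.2 h1
  refine ⟨v, hv, ?_⟩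
  rw [Matrix.sub_mulVec, sub_eq_zero] at hv2
  rw [← hv2]
  ext i
  simp [Matrix.mulVec, dotProduct, Matrix.diagonal_apply]

/-- If all eigenvalues of a complex matrix are purely imaginary, the trace of its square is a
nonpositive real number. -/
theorem trace_mul_self_re_nonpos {n : ℕ} {A : Matrix (Fin n) (Fin n) ℂ}
    (hA : ∀ (l : ℂ) (v : Fin n → ℂ), v ≠ 0 → A.mulVec v = l • v → l.re = 0) :
    (A * A).trace.re ≤ 0 := by
  have hre : (A * A).trace.re = ((A * A).charpoly.roots.map Complex.reAddGroupHom).sum := by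
    rw [Matrix.trace_eq_sum_roots_charpoly, ← map_multiset_sum]
    rfl
  rw [hre]
  refine (Multiset.sum_le_card_nsmul _ 0 fun x hx => ?_).trans_eq (nsmul_zero _)
  obtain ⟨μ, hμ, rfl⟩ := Multiset.mem_map.1 hx
  obtain ⟨v, hv, hv2⟩ := exists_mulVec_eq_of_isRoot_charpoly (Polynomial.isRoot_of_mem_roots hμ)
  -- If A²v = l²v, then either Av = −lv, or Av + lv is an eigenvector of A for l. In both cases l is
  -- imaginary and l² ≤ 0.
  obtain ⟨l, rfl⟩ := IsAlgClosed.exists_pow_nat_eq μ (n := 2) (by norm_num)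
  have hl : l.re = 0 := by
    by_cases hw : A.mulVec v + l • v = 0
    · have h := hA (-l) v hv (by rw [neg_smul]; exact eq_neg_of_add_eq_zero_left hw)
      simpa using h
    · refine hA l _ hw ?_
      rw [Matrix.mulVec_add, Matrix.mulVec_mulVec, hv2, Matrix.mulVec_smul, smul_add, smul_smul,
        ← pow_two, add_comm]
  change (l ^ 2).re ≤ 0
  rw [pow_two, Complex.mul_re, hl]
  nlinarith [mul_self_nonneg l.im]

theorem re_eq_zero_of_bounded {c : ℝ} {l : ℂ} (h : ∀ t : ℝ, ‖Complex.exp (t * l)‖ ≤ c) :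
    l.re = 0 := by
  by_contra hne
  have hc : 0 < c := lt_of_lt_of_le (by simp) (h 0)
  -- At this time the exponential has norm e^(c+1) > c.
  have h1 := h ((c + 1) / l.re)
  rw [Complex.norm_exp] at h1
  have h2 : (((c + 1) / l.re : ℝ) * l).re = c + 1 := by
    rw [Complex.re_ofReal_mul]
    field_simp
  rw [h2] at h1
  linarith [Real.add_one_le_exp (c + 1)]

-- If ad X has eigenvector Y with eigenvalue l, then e^(−tl) exp(tX) Y exp(−tX) has derivative zero
-- in t.
open scoped Matrix.Norms.Operator in
theorem exp_conj_eq {n : ℕ} {X Y : Matrix (Fin n) (Fin n) ℂ} {l : ℂ} (h : X * Y - Y * X = l • Y)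
    (t : ℝ) : NormedSpace.exp (t • X) * Y * NormedSpace.exp (t • (-X)) =
      Complex.exp (t * l) • Y := by
  have hd : ∀ t : ℝ, HasDerivAt (fun t : ℝ => Complex.exp (-(t * l)) •
      (NormedSpace.exp (t • X) * Y * NormedSpace.exp (t • (-X)))) 0 t := by
    intro t
    have h1 := hasDerivAt_exp_smul_const (𝕂 := ℝ) X t
    have h2 := hasDerivAt_exp_smul_const' (𝕂 := ℝ) (-X) t
    have h3 : HasDerivAt (fun t : ℝ => NormedSpace.exp (t • X) * Y * NormedSpace.exp (t • (-X)))
        (NormedSpace.exp (t • X) * X * Y * NormedSpace.exp (t • (-X)) +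
        NormedSpace.exp (t • X) * Y * (-X * NormedSpace.exp (t • (-X)))) t :=
      (h1.mul_const Y).mul h2
    have h4 : HasDerivAt (fun t : ℝ => Complex.exp (-(t * l)))
        (Complex.exp (-(t * l)) * (-l)) t := by
      have h5 : HasDerivAt (fun t : ℝ => -((t : ℂ) * l)) (-l) t := by
        simpa using! (((hasDerivAt_id (t : ℂ)).comp_ofReal).mul_const l).neg
      exact h5.cexp
    refine (h4.smul h3).congr_deriv ?_
    have h6 : NormedSpace.exp (t • X) * X * Y * NormedSpace.exp (t • (-X)) +
        NormedSpace.exp (t • X) * Y * (-X * NormedSpace.exp (t • (-X))) =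
        NormedSpace.exp (t • X) * (X * Y - Y * X) * NormedSpace.exp (t • (-X)) := by
      noncomm_ring
    rw [h6, h]
    simp only [Matrix.mul_smul, Matrix.smul_mul, smul_smul]
    rw [← add_smul]
    simp
  have hconst := is_const_of_deriv_eq_zero (fun t => (hd t).differentiableAt)
    (fun t => (hd t).deriv) t 0
  simp only [Complex.ofReal_zero, zero_mul, neg_zero, Complex.exp_zero, zero_smul,
    NormedSpace.exp_zero, one_mul, mul_one, one_smul] at hconst
  rw [show Complex.exp (t * l) • Y = Complex.exp (t * l) • _ from congrArg _ hconst.symm,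
    smul_smul, ← Complex.exp_add, add_neg_cancel, Complex.exp_zero, one_smul]

open scoped Matrix.Norms.Operator in
theorem exp_map_ofReal {n : ℕ} (X : Matrix (Fin n) (Fin n) ℝ) :
    (NormedSpace.exp X).map Complex.ofRealHom = NormedSpace.exp (X.map Complex.ofRealHom) := by
  refine NormedSpace.map_exp (RingHom.mapMatrix (m := Fin n) Complex.ofRealHom) ?_ X
  exact Continuous.matrix_map continuous_id Complex.continuous_ofReal

namespace ArithmeticData

variable {p : ℕ} [Fact p.Prime] {F : Type} [Field F] [NumberField F] {M : ℕ}
  (D : ArithmeticData p F M)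

theorem exists_bound_exp (τ : F →+* ℝ) : ∃ c : ℝ, ∀ X : D.𝒢.lieAlgebra, ∀ t : ℝ, ∀ i j,
    |NormedSpace.exp (t • X.val.map τ) i j| ≤ c := by
  have hb : ∀ i j : Fin M, ∃ c : ℝ, ∀ a ∈ D.𝒢.points τ, |a.val i j| ≤ c := fun i j =>
    (D.compact_arch τ).exists_bound_of_continuousOn (f := fun a => a.val i j)
      (Continuous.continuousOn (continuous_subtype_val.matrix_elem i j))
  choose c hc using hb
  refine ⟨∑ i, ∑ j, |c i j|, fun X t i j => ?_⟩
  have h := (D.𝒢.baseChange τ).exp_mem (D.𝒢.map_mem_tangentAtOne_baseChange τ X.2) t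
  obtain ⟨a, ha, ha'⟩ := D.𝒢.exists_val_eq ((mem_zeros_map τ _).1 h)
  rw [← ha']
  calc |a.val i j| ≤ |c i j| := (hc i j a ha).trans (le_abs_self _)
    _ ≤ ∑ j, |c i j| := Finset.single_le_sum (f := fun j => |c i j|) (fun _ _ => abs_nonneg _)
        (Finset.mem_univ j)
    _ ≤ _ := Finset.single_le_sum (f := fun i => ∑ j, |c i j|)
        (fun _ _ => Finset.sum_nonneg fun _ _ => abs_nonneg _) (Finset.mem_univ i)

/-- The elements exp(tX) stay in a compact group, so conjugation by them keeps Y bounded. On an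
eigenvector this conjugation is multiplication by e^(tl), bounded for all real t only if l is
imaginary. -/
theorem re_eigenvalue_eq_zero (τ : F →+* ℝ) (X : D.𝒢.lieAlgebra) {Y : Matrix (Fin M) (Fin M) ℂ}
    (hY : Y ≠ 0) {l : ℂ} (h : X.val.map (Complex.ofRealHom.comp τ) * Y -
      Y * X.val.map (Complex.ofRealHom.comp τ) = l • Y) : l.re = 0 := by
  obtain ⟨c, hc⟩ := D.exists_bound_exp τ
  obtain ⟨i, j, hij⟩ : ∃ i j, Y i j ≠ 0 := by
    by_contra! h0
    exact hY (Matrix.ext h0)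
  have hexp : ∀ (t : ℝ) (k m : Fin M),
      ‖NormedSpace.exp (t • X.val.map (Complex.ofRealHom.comp τ)) k m‖ ≤ c := by
    intro t k m
    have h1 : t • X.val.map (Complex.ofRealHom.comp τ) =
        (t • X.val.map τ).map Complex.ofRealHom := by
      ext; simp
    rw [h1, ← exp_map_ofReal, Matrix.map_apply]
    simpa using hc X t k m
  refine re_eq_zero_of_bounded (c := (∑ m, (∑ k, c * ‖Y k m‖) * c) / ‖Y i j‖) fun t => ?_
  rw [le_div_iff₀ (norm_pos_iff.2 hij), ← norm_mul]
  have h2 := congrFun (congrFun (exp_conj_eq h t) i) j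
  rw [Matrix.smul_apply, smul_eq_mul] at h2
  rw [← h2, Matrix.mul_apply]
  have hneg : t • -X.val.map (Complex.ofRealHom.comp τ) =
      (-t) • X.val.map (Complex.ofRealHom.comp τ) := by simp
  have hc0 : 0 ≤ c := (norm_nonneg _).trans (hexp 0 i i)
  refine (norm_sum_le _ _).trans (Finset.sum_le_sum fun m _ => ?_)
  rw [norm_mul, hneg]
  refine mul_le_mul ?_ (hexp _ _ _) (norm_nonneg _)
    (Finset.sum_nonneg fun _ _ => mul_nonneg hc0 (norm_nonneg _))
  rw [Matrix.mul_apply]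
  refine (norm_sum_le _ _).trans (Finset.sum_le_sum fun k _ => ?_)
  rw [norm_mul]
  exact mul_le_mul_of_nonneg_right (hexp _ _ _) (norm_nonneg _)

/-- The Killing form is negative semidefinite at the archimedean places. -/
theorem killingForm_self_nonpos (τ : F →+* ℝ) (X : D.𝒢.lieAlgebra) :
    τ (killingForm F D.𝒢.lieAlgebra X X) ≤ 0 := by
  let φ : F →+* ℂ := Complex.ofRealHom.comp τ
  let A := LinearMap.toMatrix D.basis D.basis (LieAlgebra.ad F D.𝒢.lieAlgebra X)
  have h1 : killingForm F D.𝒢.lieAlgebra X X = (A * A).trace := by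
    rw [killingForm_apply_apply, LinearMap.trace_eq_matrix_trace F D.basis,
      LinearMap.toMatrix_comp D.basis D.basis D.basis]
  have h2 : (τ (killingForm F D.𝒢.lieAlgebra X X)) = ((A.map φ) * (A.map φ)).trace.re := by
    rw [← Matrix.map_mul, h1]
    have : ((A * A).map φ).trace = φ (A * A).trace := by
      simp only [Matrix.trace, Matrix.diag_apply, map_sum, Matrix.map_apply]
    rw [this]
    simp [φ]
  rw [h2]
  refine trace_mul_self_re_nonpos fun l v hv hvl => ?_
  have hb : LinearIndependent F fun i => (D.basis i).val :=
    D.basis.linearIndependent.map' D.𝒢.lieAlgebra.toSubmodule.subtype (Submodule.ker_subtype _)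
  have hli := linearIndependent_map φ hb
  -- An eigenvector of the coordinate matrix of ad X becomes a complex matrix Y with [X, Y] = lY.
  refine D.re_eigenvalue_eq_zero τ X (Y := ∑ i, v i • (D.basis i).val.map φ) ?_ ?_
  · intro h0
    exact hv (funext (Fintype.linearIndependent_iff.1 hli v h0))
  · have hbr : ∀ j, X.val.map φ * (D.basis j).val.map φ - (D.basis j).val.map φ * X.val.map φ =
        ∑ i, φ (A i j) • (D.basis i).val.map φ := by
      intro j
      have e1 : X.val * (D.basis j).val - (D.basis j).val * X.val =
          ∑ i, A i j • (D.basis i).val := by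
        have e2 : (⁅X, D.basis j⁆ : D.𝒢.lieAlgebra) = ∑ i, A i j • D.basis i := by
          conv_lhs => rw [← D.basis.sum_repr ⁅X, D.basis j⁆]
          refine Finset.sum_congr rfl fun i _ => ?_
          change _ = LinearMap.toMatrix D.basis D.basis (LieAlgebra.ad F D.𝒢.lieAlgebra X) i j • _
          rw [LinearMap.toMatrix_apply, LieAlgebra.ad_apply]
        have e3 := congrArg (fun Z => D.𝒢.lieAlgebra.toSubmodule.subtype Z) e2
        simp only [map_sum, map_smul] at e3
        exact e3
      rw [← Matrix.map_mul, ← Matrix.map_mul, ← Matrix.map_sub φ (map_sub φ), e1]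
      ext k m
      simp [Matrix.sum_apply]
    rw [Finset.mul_sum, Finset.sum_mul, ← Finset.sum_sub_distrib]
    have e4 : ∀ j, X.val.map φ * (v j • (D.basis j).val.map φ) -
        (v j • (D.basis j).val.map φ) * X.val.map φ =
        ∑ i, (v j * φ (A i j)) • (D.basis i).val.map φ := by
      intro j
      rw [Matrix.mul_smul, Matrix.smul_mul, ← smul_sub, hbr, Finset.smul_sum]
      simp only [smul_smul]
    refine (Finset.sum_congr rfl fun j _ => e4 j).trans ?_
    rw [Finset.sum_comm, Finset.smul_sum]
    refine Finset.sum_congr rfl fun i _ => ?_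
    rw [← Finset.sum_smul, smul_smul]
    congr 1
    have := congrFun hvl i
    rw [Pi.smul_apply, smul_eq_mul] at this
    rw [← this, Matrix.mulVec, dotProduct]
    exact Finset.sum_congr rfl fun j _ => by rw [Matrix.map_apply, mul_comm]

end ArithmeticData

end Definiteness


/-! ### Unimodularity and topology of G and H -/

section Unimodular

/-- A Haar measure on a group without nontrivial characters is right invariant. -/
theorem isMulRightInvariant_of_forall_monoidHom_eq_one {L : Type*} [Group L] [TopologicalSpace L]
    [IsTopologicalGroup L] [LocallyCompactSpace L] [MeasurableSpace L] [BorelSpace L]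
    (μ : Measure L) [μ.IsHaarMeasure] [μ.InnerRegular]
    (h : ∀ f : L →* NNReal, ∀ x, f x = 1) : μ.IsMulRightInvariant where
  map_mul_right_eq_self g := by
    rw [Measure.map_right_mul_eq_modularCharacterFun_smul μ g]
    have h1 : Measure.modularCharacterFun g = 1 := h Measure.modularCharacter g
    rw [h1, one_smul]

/-- The group SL₂(ℚ_p) is perfect. Applied to the modular character, this makes G and H unimodular.
-/
theorem monoidHom_SL2_eq_one {p : ℕ} [Fact p.Prime] {A : Type*} [CommMonoid A]
    (f : SL(2, ℚ_[p]) →* A) (x : SL(2, ℚ_[p])) : f x = 1 := by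
  have h : commutator SL(2, ℚ_[p]) = ⊤ :=
    Matrix.SL2.commutator_eq_top (a := 2) (by norm_num) (by norm_num)
  have h1 : commutator SL(2, ℚ_[p]) ≤ f.ker := by
    rw [commutator_def, Subgroup.commutator_le]
    intro a _ b _
    rw [MonoidHom.mem_ker, commutatorElement_def, map_mul, map_mul, map_mul,
      mul_right_comm (f a), ← map_mul, mul_inv_cancel, map_one, one_mul, ← map_mul,
      mul_inv_cancel, map_one]
  rw [h] at h1
  exact h1 (Subgroup.mem_top x)

variable {p : ℕ} [Fact p.Prime]

instance : LocallyCompactSpace SL(2, ℚ_[p]) :=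
  have : LocallyCompactSpace (Matrix (Fin 2) (Fin 2) ℚ_[p]) :=
    inferInstanceAs (LocallyCompactSpace (Fin 2 → Fin 2 → ℚ_[p]))
  (Matrix.SpecialLinearGroup.isClosedEmbedding_val (n := Fin 2) (R := ℚ_[p])).locallyCompactSpace

instance : SecondCountableTopology SL(2, ℚ_[p]) := by
  have h1 : SecondCountableTopology ℚ_[p] := secondCountable_of_proper
  have h2 : SecondCountableTopology (Matrix (Fin 2) (Fin 2) ℚ_[p]) :=
    inferInstanceAs (SecondCountableTopology (Fin 2 → Fin 2 → ℚ_[p]))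
  exact (Matrix.SpecialLinearGroup.isClosedEmbedding_val (n := Fin 2)
    (R := ℚ_[p])).isInducing.secondCountableTopology

theorem mem_H {x : G p} : x ∈ H p ↔ x.1 = x.2 := by
  constructor
  · rintro ⟨h, rfl⟩
    rfl
  · intro h
    exact ⟨x.1, Prod.ext rfl h⟩

theorem isClosed_H : IsClosed (H p : Set (G p)) := by
  have h : (H p : Set (G p)) = {x | x.1 = x.2} := Set.ext fun x => mem_H
  rw [h]
  exact isClosed_eq continuous_fst continuous_snd

instance : SecondCountableTopology (H p) :=
  isClosed_H.isClosedEmbedding_subtypeVal.isInducing.secondCountableTopology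

instance : LocallyCompactSpace (H p) := isClosed_H.isClosedEmbedding_subtypeVal.locallyCompactSpace

/-- The element `(h, h)` of `H`. -/
noncomputable def diag : SL(2, ℚ_[p]) →* H p :=
  ((MonoidHom.id SL(2, ℚ_[p])).prod (MonoidHom.id SL(2, ℚ_[p]))).rangeRestrict

theorem diag_surjective : Function.Surjective (diag (p := p)) := MonoidHom.rangeRestrict_surjective _

theorem isMulRightInvariant_G [MeasurableSpace (G p)] [BorelSpace (G p)] (μ : Measure (G p))
    [μ.IsHaarMeasure] : μ.IsMulRightInvariant :=
  isMulRightInvariant_of_forall_monoidHom_eq_one μ fun f x => by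
    have h1 := monoidHom_SL2_eq_one (f.comp (MonoidHom.inl _ _)) x.1
    have h2 := monoidHom_SL2_eq_one (f.comp (MonoidHom.inr _ _)) x.2
    have h3 : x = MonoidHom.inl _ _ x.1 * MonoidHom.inr _ _ x.2 := by
      ext1 <;> simp
    rw [h3, map_mul]
    exact (congrArg₂ _ h1 h2).trans (one_mul 1)

theorem isMulRightInvariant_H [MeasurableSpace (G p)] [BorelSpace (G p)] (μ : Measure (H p))
    [μ.IsHaarMeasure] : μ.IsMulRightInvariant :=
  isMulRightInvariant_of_forall_monoidHom_eq_one μ fun f x => by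
    obtain ⟨h, rfl⟩ := diag_surjective x
    exact monoidHom_SL2_eq_one (f.comp diag) h

end Unimodular

/-! ### Finiteness of double cosets for a lattice -/

section Lattices

open Pointwise

variable {L : Type*} [Group L] [TopologicalSpace L] [IsTopologicalGroup L]

/-- A conjugate of a discrete subgroup meets a torsion free compact group trivially. -/
theorem eq_one_of_conj_mem [T2Space L] {U Γ : Subgroup L} [DiscreteTopology Γ]
    (hU : IsCompact (U : Set L)) (htf : ∀ u ∈ U, IsOfFinOrder u → u = 1) {x γ : L} (hγ : γ ∈ Γ)
    (h : x * γ * x⁻¹ ∈ U) : γ = 1 := by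
  -- A closed discrete set meets a compact set in a finite set. This one contains all powers of γ,
  -- so γ has finite order.
  have hfin : ((Γ : Set L) ∩ (fun y => x * y * x⁻¹) ⁻¹' U).Finite := by
    have hcl : IsClosed (Γ : Set L) := Subgroup.isClosed_of_discrete
    have hc : IsCompact ((fun y => x * y * x⁻¹) ⁻¹' (U : Set L)) := by
      have h1 : (fun y => x * y * x⁻¹) ⁻¹' (U : Set L) = (fun y => x⁻¹ * y * x) '' U := by
        ext y
        constructor
        · intro hy
          exact ⟨_, hy, by group⟩
        · rintro ⟨z, hz, rfl⟩
          simpa [mul_assoc] using hz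
      rw [h1]
      exact hU.image (by fun_prop)
    have h2 : IsCompact ((Γ : Set L) ∩ (fun y => x * y * x⁻¹) ⁻¹' U) := hc.inter_left hcl
    refine h2.finite ?_
    exact (isDiscrete_iff_discreteTopology.mpr inferInstance : IsDiscrete (Γ : Set L)).mono
      Set.inter_subset_left
  have hfo : IsOfFinOrder γ := by
    by_contra hno
    refine Set.infinite_of_injective_forall_mem (f := fun n : ℕ => γ ^ n)
      (injective_pow_iff_not_isOfFinOrder.mpr hno) (fun n => ?_) hfin
    refine ⟨Γ.pow_mem hγ n, ?_⟩
    change x * γ ^ n * x⁻¹ ∈ U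
    rw [← conj_pow]
    exact U.pow_mem h n
  have h3 := htf _ h (by
    rw [isOfFinOrder_iff_pow_eq_one] at hfo ⊢
    obtain ⟨n, hn, h4⟩ := hfo
    exact ⟨n, hn, by rw [conj_pow, h4]; group⟩)
  rw [mul_inv_eq_one] at h3
  exact mul_eq_left.mp h3

/-- Double cosets of an open subgroup, meeting all conjugates of a lattice trivially, are
finite in number. -/
theorem exists_finite_double_cosets [MeasurableSpace L] [BorelSpace L] (μ : Measure L)
    [μ.IsHaarMeasure] [μ.IsMulRightInvariant] {U Γ : Subgroup L}
    (hU : IsOpen (U : Set L)) [Countable Γ]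
    (htriv : ∀ x : L, ∀ γ ∈ Γ, x * γ * x⁻¹ ∈ U → γ = 1) (hlat : IsLattice μ Γ) :
    ∃ R : Finset L, ∀ x : L, ∃ u ∈ U, ∃ r ∈ R, ∃ γ ∈ Γ, x = u * r * γ := by
  classical
  obtain ⟨-, hfd, hcov⟩ := hlat
  obtain ⟨𝓕, h𝓕, hlt⟩ : ∃ 𝓕, IsFundamentalDomain Γ.op 𝓕 μ ∧ μ 𝓕 < ⊤ := by
    refine ⟨_, hfd.ExistsIsFundamentalDomain.choose_spec, ?_⟩
    rwa [covolume, dif_pos hfd] at hcov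
  -- The translates U r γ, for inequivalent r and all γ, are pairwise disjoint: distinct γ are
  -- separated by `htriv`. So each r accounts for volume μ(U) inside a fundamental domain.
  have hcard : ∀ R : Finset L, (∀ r ∈ R, ∀ r' ∈ R, (∃ u ∈ U, ∃ γ ∈ Γ, r' = u * r * γ) → r = r') →
      R.card * μ U ≤ μ 𝓕 := by
    intro R hR
    let f : R × Γ.op → Set L := fun x => x.2 • ((fun y => y * x.1.1) '' (U : Set L))
    have hopen : ∀ x, IsOpen (f x) := fun x => by
      have h1 : IsOpen ((fun y => y * x.1.1) '' (U : Set L)) := isOpenMap_mul_right _ _ hU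
      exact (isOpenMap_mul_right x.2.1.unop) _ h1
    have hdisj : Pairwise (Function.onFun Disjoint f) := by
      intro x y hxy
      refine Set.disjoint_left.mpr ?_
      rintro _ ⟨_, ⟨u, hu, rfl⟩, rfl⟩ ⟨_, ⟨v, hv, rfl⟩, h2⟩
      apply hxy
      have h3 : v * y.1.1 * y.2.1.unop = u * x.1.1 * x.2.1.unop := h2
      have hx2 : x.2.1.unop ∈ Γ := x.2.2
      have hy2 : y.2.1.unop ∈ Γ := y.2.2
      have h4 : x.1 = y.1 := Subtype.ext (hR _ x.1.2 _ y.1.2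
        ⟨v⁻¹ * u, U.mul_mem (U.inv_mem hv) hu, x.2.1.unop * (y.2.1.unop)⁻¹,
          Γ.mul_mem hx2 (Γ.inv_mem hy2), by
          rw [eq_comm, ← mul_assoc, mul_inv_eq_iff_eq_mul, mul_assoc v⁻¹, mul_assoc v⁻¹, ← h3]
          group⟩)
      have h5 := htriv x.1.1 (x.2.1.unop * (y.2.1.unop)⁻¹) (Γ.mul_mem hx2 (Γ.inv_mem hy2)) (by
        have : x.1.1 * (x.2.1.unop * (y.2.1.unop)⁻¹) * x.1.1⁻¹ = u⁻¹ * v := by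
          rw [← h4] at h3
          rw [← mul_assoc, mul_inv_eq_iff_eq_mul, mul_inv_eq_iff_eq_mul, mul_assoc u⁻¹,
            mul_assoc u⁻¹, h3]
          group
        rw [this]
        exact U.mul_mem (U.inv_mem hu) hv)
      rw [mul_inv_eq_one] at h5
      exact Prod.ext h4 (Subtype.ext (MulOpposite.unop_injective h5))
    calc (R.card : ENNReal) * μ U = ∑ r : R, μ U := by simp
      _ = ∑ r : R, ∑' γ : Γ.op, (μ.restrict 𝓕) (f (r, γ)) := by
        refine Finset.sum_congr rfl fun r _ => ?_
        have h1 : μ U = μ ((fun y => y * r.1) '' (U : Set L)) := by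
          rw [Set.image_mul_right, measure_preimage_mul_right]
        rw [h1, h𝓕.measure_eq_tsum]
        exact tsum_congr fun γ => (Measure.restrict_apply (hopen (r, γ)).measurableSet).symm
      _ = ∑' x : R × Γ.op, (μ.restrict 𝓕) (f x) := by
        rw [ENNReal.tsum_prod (f := fun r γ => (μ.restrict 𝓕) (f (r, γ))), tsum_fintype]
      _ = (μ.restrict 𝓕) (⋃ x, f x) := by
        have : Countable Γ.op := Γ.equivOp.symm.injective.countable
        exact (measure_iUnion hdisj fun x => (hopen x).measurableSet).symm
      _ ≤ μ 𝓕 := (measure_mono (Set.subset_univ _)).trans_eq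
        (Measure.restrict_apply_univ _)
  have hpos : 0 < μ U := hU.measure_pos μ ⟨1, U.one_mem⟩
  obtain ⟨n, hn⟩ : ∃ n : ℕ, μ 𝓕 < n * μ U := ENNReal.exists_nat_mul_gt hpos.ne' hlt.ne
  -- Minimizing n − |R|, where inequivalent sets have fewer than n elements, produces a maximal
  -- inequivalent set, which represents every double coset.
  have hex : ∃ m, ∃ R : Finset L,
      (∀ r ∈ R, ∀ r' ∈ R, (∃ u ∈ U, ∃ γ ∈ Γ, r' = u * r * γ) → r = r') ∧ n - R.card = m :=
    ⟨_, ∅, by simp, rfl⟩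
  obtain ⟨R, hR, hRm⟩ := Nat.find_spec hex
  refine ⟨R, fun x => ?_⟩
  by_contra hx
  push Not at hx
  have hxR : x ∉ R := fun h => hx 1 U.one_mem x h 1 Γ.one_mem (by simp)
  have hlt' : R.card < n := by
    by_contra hge
    refine absurd (hcard R hR) (not_le.mpr (hn.trans_le ?_))
    gcongr
    exact not_lt.mp hge
  refine Nat.find_min hex (m := n - (insert x R).card) ?_ ⟨insert x R, ?_, rfl⟩
  · rw [← hRm, Finset.card_insert_of_notMem hxR]
    omega
  · intro r hr r' hr' hrr
    obtain ⟨u, hu, γ, hγ, h⟩ := hrr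
    rcases Finset.mem_insert.mp hr with rfl | hr1 <;> rcases Finset.mem_insert.mp hr' with rfl | hr2
    · rfl
    · exact absurd (show r = u⁻¹ * r' * γ⁻¹ by rw [h]; group)
        (hx _ (U.inv_mem hu) _ hr2 _ (Γ.inv_mem hγ))
    · exact absurd h (hx _ hu _ hr1 _ hγ)
    · exact hR _ hr1 _ hr2 ⟨u, hu, γ, hγ, h⟩

end Lattices

/-! ### The principal congruence subgroup is torsion free -/

section CongruenceSubgroup

variable {p : ℕ} [Fact p.Prime]

theorem norm_mul_apply_le {X Y : Matrix (Fin 2) (Fin 2) ℚ_[p]} {r s : ℝ}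
    (hX : ∀ i j, ‖X i j‖ ≤ r) (hY : ∀ i j, ‖Y i j‖ ≤ s) (i j : Fin 2) :
    ‖(X * Y) i j‖ ≤ r * s := by
  have hr : 0 ≤ r := (norm_nonneg _).trans (hX 0 0)
  rw [Matrix.mul_apply, Fin.sum_univ_two]
  refine (Padic.nonarchimedean _ _).trans (max_le ?_ ?_)
  all_goals
    rw [norm_mul]
    exact mul_le_mul (hX _ _) (hY _ _) (norm_nonneg _) hr

theorem norm_add_apply_le {X Y : Matrix (Fin 2) (Fin 2) ℚ_[p]} {r : ℝ}
    (hX : ∀ i j, ‖X i j‖ ≤ r) (hY : ∀ i j, ‖Y i j‖ ≤ r) (i j : Fin 2) :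
    ‖(X + Y) i j‖ ≤ r :=
  (Padic.nonarchimedean _ _).trans (max_le (hX i j) (hY i j))

theorem inv_prime_pos : 0 < (p : ℝ)⁻¹ :=
  inv_pos.mpr (Nat.cast_pos.mpr (Fact.out : p.Prime).pos)

theorem inv_prime_lt_one : (p : ℝ)⁻¹ < 1 :=
  inv_lt_one_of_one_lt₀ (Nat.one_lt_cast.mpr (Fact.out : p.Prime).one_lt)

variable (p) in
/-- The principal congruence subgroup of `SL₂(ℤ_p)`. -/
def principal : Subgroup SL(2, ℚ_[p]) where
  carrier := {a | ∀ i j, ‖(a.val - 1) i j‖ ≤ (p : ℝ)⁻¹}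
  one_mem' i j := by
    rw [Matrix.SpecialLinearGroup.coe_one, sub_self, Matrix.zero_apply, norm_zero]
    exact inv_prime_pos.le
  mul_mem' {a b} ha hb i j := by
    have h : (a * b).val - 1 = (a.val - 1) * (b.val - 1) + ((a.val - 1) + (b.val - 1)) := by
      rw [Matrix.SpecialLinearGroup.coe_mul]
      noncomm_ring
    rw [h]
    refine norm_add_apply_le (fun i j => (norm_mul_apply_le ha hb i j).trans ?_)
      (norm_add_apply_le ha hb) i j
    exact mul_le_of_le_one_left inv_prime_pos.le inv_prime_lt_one.le
  inv_mem' {a} ha i j := by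
    have h00 := ha 0 0
    have h01 := ha 0 1
    have h10 := ha 1 0
    have h11 := ha 1 1
    simp only [Matrix.sub_apply, Matrix.one_apply_eq, ne_eq, zero_ne_one, one_ne_zero,
      not_false_eq_true, Matrix.one_apply_ne, sub_zero] at h00 h01 h10 h11
    rw [Matrix.SpecialLinearGroup.coe_inv, Matrix.adjugate_fin_two]
    fin_cases i <;> fin_cases j <;> simpa

theorem mem_principal {a : SL(2, ℚ_[p])} :
    a ∈ principal p ↔ ∀ i j, ‖(a.val - 1) i j‖ ≤ (p : ℝ)⁻¹ := Iff.rfl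

theorem coe_principal : (principal p : Set SL(2, ℚ_[p])) =
    (fun a : SL(2, ℚ_[p]) => (a : Matrix (Fin 2) (Fin 2) ℚ_[p])) ⁻¹'
    (Set.univ.pi fun i => Set.univ.pi fun j =>
      Metric.closedBall ((1 : Matrix (Fin 2) (Fin 2) ℚ_[p]) i j) (p : ℝ)⁻¹) := by
  ext a
  exact ⟨fun h i _ j _ => mem_closedBall_iff_norm.mpr (h i j),
    fun h i j => mem_closedBall_iff_norm.mp (h i trivial j trivial)⟩

theorem isOpen_principal : IsOpen (principal p : Set SL(2, ℚ_[p])) := by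
  rw [coe_principal]
  refine IsOpen.preimage (Matrix.SpecialLinearGroup.isClosedEmbedding_val (n := Fin 2)
    (R := ℚ_[p])).continuous ?_
  refine isOpen_set_pi Set.finite_univ fun i _ => isOpen_set_pi Set.finite_univ fun j _ => ?_
  exact IsUltrametricDist.isOpen_closedBall _ inv_prime_pos.ne'

theorem isCompact_principal : IsCompact (principal p : Set SL(2, ℚ_[p])) := by
  rw [coe_principal]
  refine (Matrix.SpecialLinearGroup.isClosedEmbedding_val (n := Fin 2)
    (R := ℚ_[p])).isCompact_preimage ?_
  exact isCompact_univ_pi fun i => isCompact_univ_pi fun j => isCompact_closedBall _ _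

/-- The binomial expansion up to second order; the third order remainder is controlled by the
ultrametric inequality, uniformly in n. -/
theorem exists_one_add_pow_eq {Y : Matrix (Fin 2) (Fin 2) ℚ_[p]} {r : ℝ}
    (hY : ∀ i j, ‖Y i j‖ ≤ r) (hr : r ≤ 1) (n : ℕ) :
    ∃ E : Matrix (Fin 2) (Fin 2) ℚ_[p], (∀ i j, ‖E i j‖ ≤ r ^ 3) ∧
      (1 + Y) ^ n = 1 + (n : ℚ_[p]) • Y + (n.choose 2 : ℚ_[p]) • (Y * Y) + E := by
  have hr0 : 0 ≤ r := (norm_nonneg _).trans (hY 0 0)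
  induction n with
  | zero => exact ⟨0, fun i j => by simpa using pow_nonneg hr0 3, by simp⟩
  | succ n ih =>
    obtain ⟨E, hE, h⟩ := ih
    refine ⟨E + (E * Y + (n.choose 2 : ℚ_[p]) • (Y * Y * Y)), ?_, ?_⟩
    · refine norm_add_apply_le hE (norm_add_apply_le ?_ ?_)
      · exact fun i j => (norm_mul_apply_le hE hY i j).trans
          (mul_le_of_le_one_right (pow_nonneg hr0 3) hr)
      · intro i j
        rw [Matrix.smul_apply, smul_eq_mul, norm_mul]
        have h1 : ‖(n.choose 2 : ℚ_[p])‖ ≤ 1 := Padic.norm_int_le_one (n.choose 2)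
        have h2 := norm_mul_apply_le (norm_mul_apply_le hY hY) hY i j
        calc _ ≤ 1 * (r * r * r) := mul_le_mul h1 h2 (norm_nonneg _) zero_le_one
          _ = r ^ 3 := by ring
    · rw [pow_succ, h, Nat.choose_succ_succ' n 1, Nat.choose_one_right]
      push_cast
      simp only [add_mul, mul_add, mul_one, one_mul, add_smul, one_smul, Matrix.smul_mul]
      abel

/-- In (1 + Y)^q = 1 the linear term qY strictly dominates the others at an entry of Y of maximal
norm r > 0. -/
theorem eq_one_of_mem_principal_of_pow_eq_one (hp : 3 < p) {a : SL(2, ℚ_[p])}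
    (ha : a ∈ principal p) {q : ℕ} (hq : q.Prime) (h : a ^ q = 1) : a = 1 := by
  by_contra hne
  set Y := a.val - 1 with hYdef
  obtain ⟨ij, hij⟩ := Finite.exists_max fun ij : Fin 2 × Fin 2 => ‖Y ij.1 ij.2‖
  set r := ‖Y ij.1 ij.2‖ with hr
  have hY : ∀ i j, ‖Y i j‖ ≤ r := fun i j => hij (i, j)
  have hrp : r ≤ (p : ℝ)⁻¹ := ha _ _
  have hr0 : 0 < r := by
    rcases (norm_nonneg (Y ij.1 ij.2)).eq_or_lt with h0 | h0
    · refine absurd (Subtype.ext ?_) hne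
      rw [Matrix.SpecialLinearGroup.coe_one, ← sub_eq_zero]
      ext i j
      exact norm_le_zero_iff.mp ((hY i j).trans_eq h0.symm)
    · exact h0
  have hr1 : r < 1 := hrp.trans_lt inv_prime_lt_one
  obtain ⟨E, hE, h1⟩ := exists_one_add_pow_eq hY hr1.le q
  have h2 : (1 + Y) ^ q = 1 := by
    rw [hYdef, add_sub_cancel, ← Matrix.SpecialLinearGroup.coe_pow, h,
      Matrix.SpecialLinearGroup.coe_one]
  rw [h2] at h1
  have h3 : (q : ℚ_[p]) * Y ij.1 ij.2 =
      -((q.choose 2 : ℚ_[p]) * (Y * Y) ij.1 ij.2 + E ij.1 ij.2) := by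
    have h4 := congrFun (congrFun h1 ij.1) ij.2
    simp only [Matrix.add_apply, Matrix.smul_apply, smul_eq_mul] at h4
    linear_combination -h4
  have h5 : ‖(q : ℚ_[p])‖ * r ≤ max (‖(q.choose 2 : ℚ_[p])‖ * (r * r)) (r ^ 3) := by
    rw [hr, ← norm_mul, h3, norm_neg]
    refine (Padic.nonarchimedean _ _).trans (max_le_max ?_ (hE _ _))
    rw [norm_mul]
    exact mul_le_mul_of_nonneg_left (norm_mul_apply_le hY hY _ _) (norm_nonneg _)
  have hchoose : ‖(q.choose 2 : ℚ_[p])‖ ≤ 1 := Padic.norm_int_le_one (q.choose 2)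
  by_cases hqp : q = p
  · subst hqp
    have h6 : ‖(q.choose 2 : ℚ_[q])‖ ≤ (q : ℝ)⁻¹ := by
      -- Here q = p > 2 is needed. Then the quadratic term has norm at most r²/p and the remainder
      -- at most r³, both smaller than r/p since r ≤ 1/p.
      have h7 : q ∣ q.choose 2 := hq.dvd_choose_self two_ne_zero (by omega)
      obtain ⟨m, hm⟩ := h7
      rw [hm, Nat.cast_mul, norm_mul, Padic.norm_p]
      exact mul_le_of_le_one_right inv_prime_pos.le (Padic.norm_int_le_one m)
    rw [Padic.norm_p] at h5
    rcases le_max_iff.mp h5 with h8 | h8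
    · have h9 := h8.trans (mul_le_mul_of_nonneg_right h6 (by positivity))
      have h10 := le_of_mul_le_mul_left h9 inv_prime_pos
      nlinarith
    · have h9 : r * (q : ℝ)⁻¹ ≤ r * (r * r) := by linarith [show r * (r * r) = r ^ 3 by ring]
      have h10 := le_of_mul_le_mul_left h9 hr0
      nlinarith
  · have h6 : ‖(q : ℚ_[p])‖ = 1 := by
      have h7 := (Nat.coprime_primes (Fact.out : p.Prime) hq).mpr (Ne.symm hqp)
      exact Padic.norm_natCast_eq_one_iff.mpr h7
    rw [h6, one_mul] at h5
    rcases le_max_iff.mp h5 with h8 | h8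
    · have h9 := h8.trans (mul_le_of_le_one_left (by positivity) hchoose)
      nlinarith
    · nlinarith [mul_pos hr0 hr0]

theorem eq_one_of_mem_principal (hp : 3 < p) {a : SL(2, ℚ_[p])} (ha : a ∈ principal p)
    (h : IsOfFinOrder a) : a = 1 := by
  by_contra hne
  have h1 : orderOf a ≠ 1 := fun h => hne (orderOf_eq_one_iff.mp h)
  obtain ⟨q, hq, m, hm⟩ := Nat.exists_prime_and_dvd h1
  have h2 : a ^ m = 1 := eq_one_of_mem_principal_of_pow_eq_one hp ((principal p).pow_mem ha m) hq
    (by rw [← pow_mul, mul_comm, ← hm, pow_orderOf_eq_one])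
  have h3 : orderOf a ∣ m := orderOf_dvd_of_pow_eq_one h2
  have h4 : 0 < m := by
    rcases Nat.eq_zero_or_pos m with h0 | h0
    · rw [h0, mul_zero] at hm
      exact absurd h.orderOf_pos (by omega)
    · exact h0
  have h5 := Nat.le_of_dvd h4 h3
  rw [hm] at h5
  nlinarith [hq.two_le]

variable (p) in
/-- The product of two copies of the principal congruence subgroup. -/
noncomputable def principalSq : Subgroup (G p) := (principal p).prod (principal p)

theorem isOpen_principalSq : IsOpen (principalSq p : Set (G p)) := by
  refine (congrArg _ (Subgroup.coe_prod (principal p) (principal p))).mpr ?_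
  exact isOpen_principal.prod isOpen_principal

theorem isCompact_principalSq : IsCompact (principalSq p : Set (G p)) := by
  refine (congrArg _ (Subgroup.coe_prod (principal p) (principal p))).mpr ?_
  exact isCompact_principal.prod isCompact_principal

theorem eq_one_of_mem_principalSq (hp : 3 < p) (u : G p) (hu : u ∈ principalSq p)
    (h : IsOfFinOrder u) : u = 1 := by
  obtain ⟨n, hn, h1⟩ := isOfFinOrder_iff_pow_eq_one.mp h
  have h2 : u.1 = 1 := eq_one_of_mem_principal hp hu.1
    (isOfFinOrder_iff_pow_eq_one.mpr ⟨n, hn, congrArg Prod.fst h1⟩)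
  have h3 : u.2 = 1 := eq_one_of_mem_principal hp hu.2
    (isOfFinOrder_iff_pow_eq_one.mpr ⟨n, hn, congrArg Prod.snd h1⟩)
  exact Prod.ext h2 h3

theorem principalSq_le_K : principalSq p ≤ K p := by
  have h1 : principal p ≤
      (Matrix.SpecialLinearGroup.map (n := Fin 2) (PadicInt.Coe.ringHom (p := p))).range := by
    intro a ha
    have hint : ∀ i j, ‖a.val i j‖ ≤ 1 := fun i j => by
      have h2 : a.val i j = (a.val - 1) i j + (1 : Matrix (Fin 2) (Fin 2) ℚ_[p]) i j := by simp
      rw [h2]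
      refine (Padic.nonarchimedean _ _).trans
        (max_le ((ha i j).trans inv_prime_lt_one.le) ?_)
      rw [Matrix.one_apply]
      split_ifs <;> simp
    have hmap : (Matrix.of fun i j => (⟨a.val i j, hint i j⟩ : ℤ_[p])).map
        (PadicInt.Coe.ringHom (p := p)) = a.val := by
      ext i j
      rfl
    refine ⟨⟨Matrix.of fun i j => ⟨a.val i j, hint i j⟩, ?_⟩, ?_⟩
    · have h3 := a.2
      refine Subtype.ext (Eq.trans ?_ h3)
      refine (RingHom.map_det (PadicInt.Coe.ringHom (p := p))
        (Matrix.of fun i j => (⟨a.val i j, hint i j⟩ : ℤ_[p]))).trans ?_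
      exact congrArg (fun A : Matrix (Fin 2) (Fin 2) ℚ_[p] => A.det) hmap
    · exact Subtype.ext hmap
  exact fun u hu => ⟨h1 hu.1, h1 hu.2⟩

end CongruenceSubgroup

/-! ### Compact orbits and covolumes -/

section ClosedOrbits

/-- If an orbit is compact then finitely many points represent all orbits of an open subgroup. -/
theorem exists_finite_of_isCompact_orbit {L X : Type*} [Group L] [TopologicalSpace L]
    [IsTopologicalGroup L] [LocallyCompactSpace L] [SigmaCompactSpace L] [TopologicalSpace X]
    [T2Space X] [MulAction L X] [ContinuousSMul L X] {x : X}
    (hx : IsCompact (MulAction.orbit L x)) {U : Subgroup L} (hU : IsOpen (U : Set L)) :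
    ∃ S : Finset L, ∀ h : L, ∃ u ∈ U, ∃ s ∈ S, ∃ t ∈ MulAction.stabilizer L x, h = u * s * t := by
  have hc : CompactSpace (MulAction.orbit L x) := isCompact_iff_compactSpace.mp hx
  have hs : ContinuousSMul L (MulAction.orbit L x) :=
    ⟨Continuous.subtype_mk (continuous_fst.smul (continuous_subtype_val.comp continuous_snd)) _⟩
  let x₀ : MulAction.orbit L x := ⟨x, MulAction.mem_orbit_self x⟩
  -- A compact Hausdorff orbit is a Baire space, so the orbit map of a σ-compact group is open and
  -- images of the cosets U s form an open cover.
  have hopen := isOpenMap_smul_of_sigmaCompact (G := L) x₀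
  obtain ⟨S, hS⟩ := isCompact_univ.elim_finite_subcover
    (fun s : L => (fun l : L => l • x₀) '' ((fun u => u * s) '' (U : Set L)))
    (fun s => hopen _ (isOpenMap_mul_right s _ hU)) (fun y _ => by
      obtain ⟨_, l, rfl⟩ := y
      exact Set.mem_iUnion.mpr ⟨l, _, ⟨1, U.one_mem, rfl⟩, Subtype.ext (by simp [x₀])⟩)
  refine ⟨S, fun h => ?_⟩
  obtain ⟨s, hs, _, ⟨u, hu, rfl⟩, hus⟩ : ∃ s ∈ S,
      h • x₀ ∈ (fun l : L => l • x₀) '' ((fun u => u * s) '' (U : Set L)) := by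
    simpa using hS (Set.mem_univ (h • x₀))
  refine ⟨u, hu, s, hs, (u * s)⁻¹ * h, ?_, by group⟩
  rw [MulAction.mem_stabilizer_iff, mul_smul, inv_smul_eq_iff]
  exact (congrArg Subtype.val hus).symm

theorem exists_irredundant_double_cosets {L : Type*} [Group L] {U Δ : Subgroup L}
    (h : ∃ S : Finset L, ∀ h : L, ∃ u ∈ U, ∃ s ∈ S, ∃ t ∈ Δ, h = u * s * t) :
    ∃ S : Finset L, (∀ h : L, ∃ u ∈ U, ∃ s ∈ S, ∃ t ∈ Δ, h = u * s * t) ∧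
      ∀ s ∈ S, ∀ s' ∈ S, ∀ u ∈ U, ∀ t ∈ Δ, s' = u * s * t → s = s' := by
  classical
  obtain ⟨S, hS, hmin⟩ := WellFounded.has_min (measure Finset.card).wf
    {S : Finset L | ∀ h : L, ∃ u ∈ U, ∃ s ∈ S, ∃ t ∈ Δ, h = u * s * t} h
  refine ⟨S, hS, fun s hs s' hs' u hu t ht hss => ?_⟩
  by_contra hne
  refine hmin (S.erase s') (fun h => ?_) (Finset.card_lt_card (Finset.erase_ssubset hs'))
  obtain ⟨v, hv, s'', hs'', t', ht', hh⟩ := hS h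
  by_cases h1 : s'' = s'
  · refine ⟨v * u, U.mul_mem hv hu, s, Finset.mem_erase.mpr ⟨hne, hs⟩, t * t',
      Δ.mul_mem ht ht', ?_⟩
    rw [hh, h1, hss]
    group
  · exact ⟨v, hv, s'', Finset.mem_erase.mpr ⟨h1, hs''⟩, t', ht', hh⟩

/-- A discrete subgroup with finitely many double cosets modulo a compact open subgroup meeting
all its conjugates trivially is a lattice; its covolume is proportional to the number of
double cosets. -/
theorem isLattice_of_double_cosets {L : Type*} [Group L] [TopologicalSpace L]
    [IsTopologicalGroup L] [SecondCountableTopology L] [MeasurableSpace L] [BorelSpace L]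
    (μ : Measure L) [μ.IsHaarMeasure] [μ.IsMulRightInvariant] {U Δ : Subgroup L}
    (hU : IsOpen (U : Set L)) (hfin : μ U < ⊤)
    (htriv : ∀ x : L, ∀ δ ∈ Δ, x * δ * x⁻¹ ∈ U → δ = 1) {S : Finset L}
    (hS : ∀ h : L, ∃ u ∈ U, ∃ s ∈ S, ∃ t ∈ Δ, h = u * s * t)
    (hS' : ∀ s ∈ S, ∀ s' ∈ S, ∀ u ∈ U, ∀ t ∈ Δ, s' = u * s * t → s = s') :
    IsLattice μ Δ ∧ covolume Δ.op L μ = S.card * μ U := by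
  have hdisc : DiscreteTopology Δ := by
    refine discreteTopology_of_isOpen_singleton_one ?_
    have h1 : ({1} : Set Δ) = Subtype.val ⁻¹' (U : Set L) := by
      ext δ
      constructor
      · rintro rfl
        exact U.one_mem
      · intro h
        exact Subtype.ext (htriv 1 δ.1 δ.2 (by simpa using h))
    rw [h1]
    exact hU.preimage continuous_subtype_val
  have hcount : Countable Δ := countable_of_Lindelof_of_discrete
  have hcount' : Countable Δ.op := Δ.equivOp.symm.injective.countable
  -- For irredundant S the union of the cosets U s is a fundamental domain for right multiplication
  -- by Δ: irredundancy fixes s, and `htriv` fixes the translating element.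
  let 𝓕 : Set L := ⋃ s ∈ S, (fun u => u * s) '' (U : Set L)
  have hopen : ∀ s : L, IsOpen ((fun u => u * s) '' (U : Set L)) := fun s =>
    isOpenMap_mul_right s _ hU
  have hmeas : MeasurableSet 𝓕 := (isOpen_biUnion fun s _ => hopen s).measurableSet
  have hmem : ∀ x, x ∈ 𝓕 ↔ ∃ s ∈ S, ∃ u ∈ U, u * s = x := fun x => by
    simp only [𝓕, Set.mem_iUnion, Set.mem_image, SetLike.mem_coe, exists_prop]
  have h𝓕 : IsFundamentalDomain Δ.op 𝓕 μ := by
    refine IsFundamentalDomain.mk' hmeas.nullMeasurableSet fun x => ?_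
    obtain ⟨u, hu, s, hs, t, ht, rfl⟩ := hS x
    refine ⟨⟨MulOpposite.op t⁻¹, Δ.inv_mem ht⟩, (hmem _).mpr ⟨s, hs, u, hu, ?_⟩, ?_⟩
    · change u * s = u * s * t * t⁻¹
      group
    · rintro ⟨⟨t'⟩, ht'⟩ h1
      obtain ⟨s', hs', u', hu', h2⟩ := (hmem _).mp h1
      have ht'' : t' ∈ Δ := ht'
      have h3 : u' * s' = u * s * t * t' := h2
      obtain rfl : s = s' := hS' s hs s' hs' (u'⁻¹ * u) (U.mul_mem (U.inv_mem hu') hu) (t * t')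
        (Δ.mul_mem ht ht'') (by
          calc s' = u'⁻¹ * (u' * s') := by group
            _ = _ := by rw [h3]; group)
      have h4 := htriv s (t * t') (Δ.mul_mem ht ht'') (by
        have h5 : s * (t * t') * s⁻¹ = u⁻¹ * u' := by
          calc s * (t * t') * s⁻¹ = u⁻¹ * (u * s * t * t') * s⁻¹ := by group
            _ = u⁻¹ * u' := by rw [← h3]; group
        rw [h5]
        exact U.mul_mem (U.inv_mem hu) hu')
      refine Subtype.ext (congrArg MulOpposite.op ?_)
      exact eq_inv_of_mul_eq_one_right h4
  have hvol : μ 𝓕 = S.card * μ U := by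
    rw [measure_biUnion_finset]
    · rw [Finset.sum_congr rfl fun s _ => (?_ : _ = μ U), Finset.sum_const, nsmul_eq_mul]
      rw [Set.image_mul_right, measure_preimage_mul_right]
    · intro s hs s' hs' hne
      refine Set.disjoint_left.mpr ?_
      rintro _ ⟨u, hu, rfl⟩ ⟨u', hu', h1⟩
      refine hne (hS' s hs s' hs' (u'⁻¹ * u) (U.mul_mem (U.inv_mem hu') hu) 1 Δ.one_mem ?_)
      have h2 : u' * s' = u * s := h1
      rw [mul_one, mul_assoc, ← h2]
      group
    · exact fun s _ => (hopen s).measurableSet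
  have hcov : covolume Δ.op L μ = S.card * μ U := by
    rw [h𝓕.covolume_eq_volume, hvol]
  refine ⟨⟨hdisc, h𝓕.hasFundamentalDomain, ?_⟩, hcov⟩
  rw [hcov]
  exact ENNReal.mul_lt_top (ENNReal.natCast_lt_top _) hfin

end ClosedOrbits

/-! ### Closed orbits are periodic -/

section PeriodicOrbits

variable {p : ℕ} [Fact p.Prime]

variable (p) in
/-- The principal congruence subgroup of `H`. -/
noncomputable def principalH : Subgroup (H p) := (principalSq p).subgroupOf (H p)

theorem mem_stab {Γ : Subgroup (G p)} {g : G p} {h : H p} :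
    h ∈ stab Γ g ↔ g⁻¹ * h.1 * g ∈ Γ := by
  rw [stab, MulAction.mem_stabilizer_iff]
  have h1 : h • (g : G p ⧸ Γ) = ((h.1 * g : G p) : G p ⧸ Γ) := rfl
  rw [h1, eq_comm, QuotientGroup.eq, mul_assoc]

theorem eq_one_of_conj_mem_principalSq (hp : 3 < p) {Γ : Subgroup (G p)} [DiscreteTopology Γ]
    {x γ : G p} (hγ : γ ∈ Γ) (h : x * γ * x⁻¹ ∈ principalSq p) : γ = 1 :=
  eq_one_of_conj_mem isCompact_principalSq (eq_one_of_mem_principalSq hp) hγ h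

theorem eq_one_of_mem_stab (hp : 3 < p) {Γ : Subgroup (G p)} [DiscreteTopology Γ] {g x : G p}
    {h : H p} (hh : h ∈ stab Γ g) (hx : x * h.1 * x⁻¹ ∈ principalSq p) : h = 1 := by
  have h1 := eq_one_of_conj_mem_principalSq hp (x := x * g) (mem_stab.mp hh) (by
    have h2 : x * g * (g⁻¹ * h.1 * g) * (x * g)⁻¹ = x * h.1 * x⁻¹ := by group
    rwa [h2])
  refine Subtype.ext ?_
  calc h.1 = g * (g⁻¹ * h.1 * g) * g⁻¹ := by group
    _ = 1 := by rw [h1]; group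

/-- A lattice in `G` has finitely many double cosets modulo the principal congruence subgroup. -/
theorem exists_finite_double_cosets_G [MeasurableSpace (G p)] [BorelSpace (G p)] (hp : 3 < p)
    (μG : Measure (G p)) [μG.IsHaarMeasure] {Γ : Subgroup (G p)} (hlat : IsLattice μG Γ) :
    ∃ R : Finset (G p), ∀ x : G p, ∃ u ∈ principalSq p, ∃ r ∈ R, ∃ γ ∈ Γ, x = u * r * γ := by
  have := hlat.1
  have : Countable Γ := countable_of_Lindelof_of_discrete
  have := isMulRightInvariant_G μG
  exact exists_finite_double_cosets μG isOpen_principalSq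
    (fun x γ hγ h => eq_one_of_conj_mem_principalSq hp hγ h) hlat

theorem compactSpace_quotient {Γ : Subgroup (G p)} {R : Finset (G p)}
    (hR : ∀ x : G p, ∃ u ∈ principalSq p, ∃ r ∈ R, ∃ γ ∈ Γ, x = u * r * γ) :
    CompactSpace (G p ⧸ Γ) := by
  refine ⟨?_⟩
  have h1 : (Set.univ : Set (G p ⧸ Γ)) =
      ⋃ r ∈ R, (fun u : G p => ((u * r : G p) : G p ⧸ Γ)) '' principalSq p := by
    refine (Set.eq_univ_of_forall fun x => ?_).symm
    obtain ⟨x, rfl⟩ := QuotientGroup.mk_surjective x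
    obtain ⟨u, hu, r, hr, γ, hγ, rfl⟩ := hR x
    refine Set.mem_iUnion₂.mpr ⟨r, hr, u, hu, ?_⟩
    exact (QuotientGroup.mk_mul_of_mem _ hγ).symm
  rw [h1]
  refine R.isCompact_biUnion fun r _ => isCompact_principalSq.image ?_
  exact QuotientGroup.continuous_mk.comp (continuous_mul_const r)

/-- A closed orbit is periodic, and its volume is bounded by the number of double cosets of
`H` modulo the stabilizer and the principal congruence subgroup. -/
theorem isLattice_stab [MeasurableSpace (G p)] [BorelSpace (G p)] (hp : 3 < p)
    (μH : Measure (H p)) [μH.IsHaarMeasure] (hμH : μH ((K p).subgroupOf (H p)) = 1)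
    {Γ : Subgroup (G p)} [DiscreteTopology Γ] {R : Finset (G p)}
    (hR : ∀ x : G p, ∃ u ∈ principalSq p, ∃ r ∈ R, ∃ γ ∈ Γ, x = u * r * γ)
    {g : G p} (hcl : IsClosed (orbit Γ g)) :
    IsLattice μH (stab Γ g) ∧ ∃ S : Finset (H p),
      (∀ h : H p, ∃ u ∈ principalH p, ∃ s ∈ S, ∃ t ∈ stab Γ g, h = u * s * t) ∧
      (∀ s ∈ S, ∀ s' ∈ S, ∀ u ∈ principalH p, ∀ t ∈ stab Γ g, s' = u * s * t → s = s') ∧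
      vol μH Γ g ≤ S.card := by
  have := isMulRightInvariant_H μH
  have := compactSpace_quotient hR
  have hΓcl : IsClosed (Γ : Set (G p)) := Subgroup.isClosed_of_discrete
  have : ContinuousSMul (H p) (G p ⧸ Γ) :=
    ⟨(continuous_subtype_val.comp continuous_fst).smul continuous_snd⟩
  have hopen : IsOpen (principalH p : Set (H p)) :=
    isOpen_principalSq.preimage continuous_subtype_val
  -- The normalization of μ_H on K ∩ H enters only here; it makes each double coset contribute at
  -- most 1 to the volume.
  have hle : μH (principalH p) ≤ 1 := by
    rw [← hμH]
    exact measure_mono fun h hh => principalSq_le_K hh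
  obtain ⟨S, hS, hS'⟩ := exists_irredundant_double_cosets
    (exists_finite_of_isCompact_orbit (L := H p) (x := (g : G p ⧸ Γ)) hcl.isCompact hopen)
  obtain ⟨h1, h2⟩ := isLattice_of_double_cosets μH hopen (hle.trans_lt ENNReal.one_lt_top)
    (fun x δ hδ h => eq_one_of_mem_stab hp (x := x.1) hδ h) hS hS'
  refine ⟨h1, S, hS, hS', ?_⟩
  rw [vol, h2]
  exact mul_le_of_le_one_right' hle

end PeriodicOrbits

/-! ### The adjoint action on matrices -/

section Conjugation

/-- Conjugation of matrices by an element of the special linear group. -/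
def Ad {n R : Type} [Fintype n] [DecidableEq n] [CommRing R]
    (a : Matrix.SpecialLinearGroup n R) : Matrix n n R →ₐ[R] Matrix n n R :=
  AlgHom.ofLinearMap
    { toFun := fun X => a.val * X * (a⁻¹).val
      map_add' := fun X Y => by rw [mul_add, add_mul]
      map_smul' := fun c X => by
        rw [Matrix.mul_smul, Matrix.smul_mul]
        rfl }
    (by
      change a.val * 1 * (a⁻¹).val = 1
      rw [mul_one, ← Matrix.SpecialLinearGroup.coe_mul, mul_inv_cancel,
        Matrix.SpecialLinearGroup.coe_one])
    (fun X Y => by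
      change a.val * (X * Y) * (a⁻¹).val = a.val * X * (a⁻¹).val * (a.val * Y * (a⁻¹).val)
      have h : (a⁻¹).val * a.val = 1 := by
        rw [← Matrix.SpecialLinearGroup.coe_mul, inv_mul_cancel,
          Matrix.SpecialLinearGroup.coe_one]
      simp only [Matrix.mul_assoc]
      rw [← Matrix.mul_assoc (a⁻¹).val a.val, h, Matrix.one_mul])

section

variable {n R : Type} [Fintype n] [DecidableEq n] [CommRing R]
  (a b : Matrix.SpecialLinearGroup n R) (X Y : Matrix n n R)

theorem Ad_apply : Ad a X = a.val * X * (a⁻¹).val := rfl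

theorem Ad_mul : Ad (a * b) X = Ad a (Ad b X) := by
  simp only [Ad_apply, mul_inv_rev, Matrix.SpecialLinearGroup.coe_mul, Matrix.mul_assoc]

theorem Ad_one : Ad (1 : Matrix.SpecialLinearGroup n R) X = X := by
  simp only [Ad_apply, inv_one, Matrix.SpecialLinearGroup.coe_one, Matrix.mul_one, Matrix.one_mul]

theorem Ad_inv_Ad : Ad a⁻¹ (Ad a X) = X := by
  rw [← Ad_mul, inv_mul_cancel, Ad_one]

theorem Ad_Ad_inv : Ad a (Ad a⁻¹ X) = X := by
  rw [← Ad_mul, mul_inv_cancel, Ad_one]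

theorem Ad_injective : Function.Injective (Ad a) :=
  Function.LeftInverse.injective (Ad_inv_Ad a)

theorem trace_Ad : (Ad a X).trace = X.trace := by
  rw [Ad_apply, Matrix.trace_mul_comm, ← Matrix.mul_assoc, ← Matrix.SpecialLinearGroup.coe_mul,
    inv_mul_cancel, Matrix.SpecialLinearGroup.coe_one, Matrix.one_mul]

theorem det_Ad : (Ad a X).det = X.det := by
  rw [Ad_apply, Matrix.det_mul, Matrix.det_mul, a.2, (a⁻¹).2, one_mul, mul_one]

theorem Ad_coe : Ad a b.val = (a * b * a⁻¹).val := rfl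

end

end Conjugation

/-! ### Cocompact subgroups without unipotents act irreducibly on sl₂ -/

section Irreducibility

variable {K : Type} [Field K]

/-- In sl₂ the centralizer of a nonzero element is the line it spans: commuting means that the
coordinate vectors have vanishing cross product. -/
theorem exists_smul_eq_of_commute (X Y : Matrix (Fin 2) (Fin 2) K)
    (hX : X.trace = 0) (hY : Y.trace = 0) (hX0 : X ≠ 0) (h : X * Y - Y * X = 0) (h2 : (2 : K) ≠ 0) :
    ∃ c : K, Y = c • X := by
  rw [Matrix.trace_fin_two, add_comm, ← eq_neg_iff_add_eq_zero] at hX hY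
  have h00 := congrFun (congrFun h 0) 0
  have h01 := congrFun (congrFun h 0) 1
  have h10 := congrFun (congrFun h 1) 0
  simp only [Matrix.sub_apply, Matrix.mul_apply, Fin.sum_univ_two, Matrix.zero_apply, hX, hY]
    at h00 h01 h10
  have e01 : X 0 0 * Y 0 1 = X 0 1 * Y 0 0 :=
    mul_left_cancel₀ h2 (by linear_combination h01)
  have e10 : X 0 0 * Y 1 0 = X 1 0 * Y 0 0 :=
    mul_left_cancel₀ h2 (by linear_combination -h10)
  have key : ∀ c : K, Y 0 0 = c * X 0 0 → Y 0 1 = c * X 0 1 → Y 1 0 = c * X 1 0 → Y = c • X := by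
    intro c h1 h2 h3
    ext i j
    fin_cases i <;> fin_cases j
    · exact h1
    · exact h2
    · exact h3
    · change Y 1 1 = c * X 1 1
      rw [hX, hY, h1, mul_neg]
  by_cases ha : X 0 0 = 0
  · by_cases hb : X 0 1 = 0
    · have hc : X 1 0 ≠ 0 := fun hc => hX0 (by
        ext i j
        fin_cases i <;> fin_cases j <;> simp [ha, hb, hc, hX])
      refine ⟨Y 1 0 / X 1 0, key _ ?_ ?_ ?_⟩ <;> field_simp
      · linear_combination -e10
      · linear_combination -h00
    · refine ⟨Y 0 1 / X 0 1, key _ ?_ ?_ ?_⟩ <;> field_simp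
      · linear_combination -e01
      · linear_combination h00
  · refine ⟨Y 0 0 / X 0 0, key _ ?_ ?_ ?_⟩ <;> field_simp
    · linear_combination e01
    · linear_combination e10

/-- The traceless part of c commutes with X, hence equals βX. Adding a nilpotent multiple of X to a
scalar does not change the determinant, so 1 = (tr c / 2)². -/
theorem trace_sq_of_commute_nilpotent {X c : Matrix (Fin 2) (Fin 2) K} (hX : X.trace = 0)
    (hdet : X.det = 0) (hX0 : X ≠ 0) (hc : c.det = 1) (h : c * X = X * c) (h2 : (2 : K) ≠ 0) :
    c.trace ^ 2 = 4 := by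
  have hZ : (c - (c.trace / 2) • (1 : Matrix (Fin 2) (Fin 2) K)).trace = 0 := by
    rw [Matrix.trace_sub, Matrix.trace_smul, Matrix.trace_one]
    simp [h2]
  obtain ⟨β, hβ⟩ := exists_smul_eq_of_commute X _ hX hZ hX0 (by
    rw [mul_sub, sub_mul, h]
    simp) h2
  have hc' : c = (c.trace / 2) • (1 : Matrix (Fin 2) (Fin 2) K) + β • X := by
    rw [← hβ, add_sub_cancel]
  have h3 : c.det = (c.trace / 2) ^ 2 := by
    conv_lhs => rw [hc']
    rw [Matrix.det_fin_two] at hdet ⊢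
    rw [Matrix.trace_fin_two] at hX
    simp only [Matrix.add_apply, Matrix.smul_apply, smul_eq_mul, Matrix.one_apply_eq, ne_eq,
      zero_ne_one, one_ne_zero, not_false_eq_true, Matrix.one_apply_ne]
    linear_combination (c.trace / 2) * β * hX + β ^ 2 * hdet
  rw [hc] at h3
  field_simp at h3
  linear_combination -h3

/-- Upper triangular unipotent matrices. -/
def upper (t : K) : SL(2, K) := ⟨!![1, t; 0, 1], by simp [Matrix.det_fin_two]⟩

/-- Lower triangular unipotent matrices. -/
def lower (t : K) : SL(2, K) := ⟨!![1, 0; t, 1], by simp [Matrix.det_fin_two]⟩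

theorem Ad_upper (t : K) (X : Matrix (Fin 2) (Fin 2) K) :
    Ad (upper t) X = !![X 0 0 + t * X 1 0, X 0 1 + t * X 1 1 - t * (X 0 0 + t * X 1 0);
      X 1 0, X 1 1 - t * X 1 0] := by
  rw [Ad_apply, Matrix.SpecialLinearGroup.coe_inv, Matrix.adjugate_fin_two]
  ext i j
  fin_cases i <;> fin_cases j <;>
    simp [upper, Matrix.mul_apply, Fin.sum_univ_two, Matrix.vecMul, dotProduct] <;> ring

theorem Ad_lower (t : K) (X : Matrix (Fin 2) (Fin 2) K) :
    Ad (lower t) X = !![X 0 0 - t * X 0 1, X 0 1;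
      X 1 0 + t * X 0 0 - t * (X 1 1 + t * X 0 1), X 1 1 + t * X 0 1] := by
  rw [Ad_apply, Matrix.SpecialLinearGroup.coe_inv, Matrix.adjugate_fin_two]
  ext i j
  fin_cases i <;> fin_cases j <;>
    simp [lower, Matrix.mul_apply, Fin.sum_univ_two, Matrix.vecMul, dotProduct] <;> ring

variable {p : ℕ} [Fact p.Prime]

theorem eq_zero_of_forall_norm_mul_le {x : ℚ_[p]} {r : ℝ} (h : ∀ t, ‖t * x‖ ≤ r) : x = 0 := by
  by_contra hx
  obtain ⟨t, ht⟩ := NormedField.exists_lt_norm ℚ_[p] (r / ‖x‖)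
  have h1 := h t
  rw [norm_mul] at h1
  rw [div_lt_iff₀ (norm_pos_iff.mpr hx)] at ht
  linarith

/-- A traceless matrix with bounded conjugacy class vanishes. -/
theorem eq_zero_of_bounded_conj {X : Matrix (Fin 2) (Fin 2) ℚ_[p]} (hX : X.trace = 0) {r : ℝ}
    (h : ∀ a : SL(2, ℚ_[p]), ∀ i j, ‖Ad a X i j‖ ≤ r) : X = 0 := by
  have hr : ∀ x y : ℚ_[p], ‖x‖ ≤ r → ‖y‖ ≤ r → ‖x - y‖ ≤ r := fun x y hx hy => by
    rw [sub_eq_add_neg]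
    exact (Padic.nonarchimedean _ _).trans (max_le hx (by rwa [norm_neg]))
  have h0 : ∀ i j, ‖X i j‖ ≤ r := by simpa only [Ad_one] using h 1
  -- The conjugates by unipotent matrices involve t X 1 0 with t arbitrary, and all of them are
  -- bounded.
  have h10 : X 1 0 = 0 := eq_zero_of_forall_norm_mul_le (r := r) fun t => by
    have h1 : t * X 1 0 = Ad (upper t) X 0 0 - X 0 0 := by simp [Ad_upper]
    rw [h1]
    exact hr _ _ (h _ _ _) (h0 _ _)
  have h01 : X 0 1 = 0 := eq_zero_of_forall_norm_mul_le (r := r) fun t => by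
    have h1 : t * X 0 1 = X 0 0 - Ad (lower t) X 0 0 := by simp [Ad_lower]
    rw [h1]
    exact hr _ _ (h0 _ _) (h _ _ _)
  rw [Matrix.trace_fin_two, add_comm, ← eq_neg_iff_add_eq_zero] at hX
  have h00 : X 0 0 = 0 := by
    have h3 : 2 * X 0 0 = 0 := eq_zero_of_forall_norm_mul_le (r := r) fun t => by
      have h1 : t * (2 * X 0 0) = X 0 1 - Ad (upper t) X 0 1 := by
        simp [Ad_upper, h10, hX]
        ring
      rw [h1]
      exact hr _ _ (h0 _ _) (h _ _ _)
    simpa using h3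
  ext i j
  fin_cases i <;> fin_cases j <;> simp [h00, h01, h10, hX]

/-- A subgroup of `SL₂(ℚ_p)` that is cocompact (in the sense of bounded representatives) and
contains no unipotent elements. -/
structure IsCocompactSemisimple (Δ : Subgroup SL(2, ℚ_[p])) (r : ℝ) : Prop where
  exists_bounded : ∀ h : SL(2, ℚ_[p]), ∃ c : SL(2, ℚ_[p]), ∃ δ ∈ Δ, h = c * δ ∧
    (∀ i j, ‖c.val i j‖ ≤ r) ∧ ∀ i j, ‖(c⁻¹).val i j‖ ≤ r
  eq_one : ∀ δ ∈ Δ, (δ.val - 1) * (δ.val - 1) = 0 → δ = 1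

namespace IsCocompactSemisimple

variable {Δ : Subgroup SL(2, ℚ_[p])} {r : ℝ}


/-- With Δ finite the bounded representatives would bound all of SL₂(ℚ_p), but unipotent matrices
are unbounded. -/
theorem infinite (hΔ : IsCocompactSemisimple Δ r) : (Δ : Set SL(2, ℚ_[p])).Infinite := by
  intro hfin
  obtain ⟨s, hs⟩ : ∃ s : ℝ, ∀ δ ∈ Δ, ∀ i j, ‖δ.val i j‖ ≤ s := by
    obtain ⟨s, hs⟩ := (hfin.image fun δ => ∑ i, ∑ j, ‖δ.val i j‖).bddAbove
    refine ⟨s, fun δ hδ i j => le_trans ?_ (hs ⟨δ, hδ, rfl⟩)⟩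
    exact (Finset.single_le_sum (f := fun j => ‖δ.val i j‖) (fun _ _ => norm_nonneg _)
      (Finset.mem_univ j)).trans (Finset.single_le_sum (f := fun i => ∑ j, ‖δ.val i j‖)
      (fun _ _ => Finset.sum_nonneg fun _ _ => norm_nonneg _) (Finset.mem_univ i))
  refine one_ne_zero (α := ℚ_[p]) (eq_zero_of_forall_norm_mul_le (r := r * s) fun t => ?_)
  obtain ⟨c, δ, hδ, h, hc, -⟩ := hΔ.exists_bounded (upper t)
  have h1 := norm_mul_apply_le hc (hs δ hδ) 0 1
  rw [← Matrix.SpecialLinearGroup.coe_mul, ← h] at h1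
  simpa [upper] using h1

/-- Modulo bounded elements every conjugation comes from Δ, so an X fixed up to sign by Δ has a
bounded conjugacy class. -/
theorem eq_zero_of_conj_eq_or_neg (hΔ : IsCocompactSemisimple Δ r)
    {X : Matrix (Fin 2) (Fin 2) ℚ_[p]} (hX : X.trace = 0)
    (h : ∀ δ ∈ Δ, Ad δ X = X ∨ Ad δ X = -X) : X = 0 := by
  have hb : ∀ i j, ‖X i j‖ ≤ ∑ i, ∑ j, ‖X i j‖ := fun i j =>
    (Finset.single_le_sum (f := fun j => ‖X i j‖) (fun _ _ => norm_nonneg _)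
      (Finset.mem_univ j)).trans (Finset.single_le_sum (f := fun i => ∑ j, ‖X i j‖)
      (fun _ _ => Finset.sum_nonneg fun _ _ => norm_nonneg _) (Finset.mem_univ i))
  refine eq_zero_of_bounded_conj hX (r := r * (∑ i, ∑ j, ‖X i j‖) * r) fun a => ?_
  obtain ⟨c, δ, hδ, rfl, hc, hc'⟩ := hΔ.exists_bounded a
  have h1 : ∀ i j, ‖Ad c X i j‖ ≤ r * (∑ i, ∑ j, ‖X i j‖) * r :=
    norm_mul_apply_le (norm_mul_apply_le hc hb) hc'
  intro i j
  rw [Ad_mul]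
  rcases h δ hδ with h2 | h2
  · rw [h2]
    exact h1 i j
  · rw [h2, map_neg, Matrix.neg_apply, norm_neg]
    exact h1 i j

/-- Let Δ preserve the line of X. If det X ≠ 0, the multipliers are ±1 because the determinant is
invariant. If X is nilpotent, commutators of elements of Δ fix X, hence have trace ±2; their squares
are unipotent, so trivial, and Δ is commutative up to sign. Then the elements of Δ are scalar and
fix X. Either way X = 0 by `eq_zero_of_conj_eq_or_neg`. -/
theorem not_line (hΔ : IsCocompactSemisimple Δ r)
    {X : Matrix (Fin 2) (Fin 2) ℚ_[p]} (hX : X.trace = 0) (hX0 : X ≠ 0)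
    (h : ∀ δ ∈ Δ, ∃ c : ℚ_[p], Ad δ X = c • X) : False := by
  by_cases hdet : X.det = 0
  · have hcomm : ∀ δ ∈ Δ, ∀ ε ∈ Δ, Ad (δ * ε * δ⁻¹ * ε⁻¹) X = X := by
      intro δ hδ ε hε
      obtain ⟨c, hc⟩ := h δ hδ
      obtain ⟨d, hd⟩ := h ε hε
      obtain ⟨c', hc'⟩ := h δ⁻¹ (Δ.inv_mem hδ)
      obtain ⟨d', hd'⟩ := h ε⁻¹ (Δ.inv_mem hε)
      have h1 : (c' * c) • X = X := by
        have := Ad_inv_Ad δ X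
        rwa [hc, map_smul, hc', smul_smul, mul_comm] at this
      have h2 : (d' * d) • X = X := by
        have := Ad_inv_Ad ε X
        rwa [hd, map_smul, hd', smul_smul, mul_comm] at this
      simp only [Ad_mul, hd', hc', hd, hc, map_smul]
      calc d' • c' • d • c • X = (d' * d) • (c' * c) • X := by
            simp only [smul_smul]
            congr 1
            ring
        _ = X := by rw [h1, h2]
    have hpm : ∀ δ ∈ Δ, ∀ ε ∈ Δ, (δ * ε * δ⁻¹).val = ε.val ∨ (δ * ε * δ⁻¹).val = -ε.val := by
      intro δ hδ ε hε
      set c := δ * ε * δ⁻¹ * ε⁻¹ with hcdef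
      have hcΔ : c ∈ Δ := Δ.mul_mem (Δ.mul_mem (Δ.mul_mem hδ hε) (Δ.inv_mem hδ)) (Δ.inv_mem hε)
      have h1 : c.val * X = X * c.val := by
        have h2 := hcomm δ hδ ε hε
        rw [Ad_apply] at h2
        nth_rw 2 [← h2]
        rw [Matrix.mul_assoc _ _ c.val, ← Matrix.SpecialLinearGroup.coe_mul, inv_mul_cancel,
          Matrix.SpecialLinearGroup.coe_one, Matrix.mul_one]
      have h2 := trace_sq_of_commute_nilpotent hX hdet hX0 c.2 h1 two_ne_zero
      have hCH : c.val * c.val = c.val.trace • c.val - 1 := by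
        have h3 := c.2
        rw [Matrix.det_fin_two] at h3
        ext i j
        fin_cases i <;> fin_cases j <;>
          simp [Matrix.mul_apply, Fin.sum_univ_two, Matrix.trace_fin_two] <;>
          first | linear_combination -h3 | ring
      have h4 : c * c = 1 := by
        -- By Cayley–Hamilton c² − 1 = (tr c)c − 2, whose square vanishes as (tr c)² = 4.
        refine hΔ.eq_one _ (Δ.mul_mem hcΔ hcΔ) ?_
        have h5 : (c * c).val - 1 = c.val.trace • c.val - (2 : ℚ_[p]) • 1 := by
          rw [Matrix.SpecialLinearGroup.coe_mul, hCH, two_smul]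
          abel
        rw [h5, sub_mul, mul_sub, mul_sub]
        simp only [Matrix.smul_mul, Matrix.mul_smul, Matrix.mul_one, Matrix.one_mul, hCH, smul_sub,
          smul_smul]
        have h6 : c.val.trace * c.val.trace = 4 := by rw [← sq, h2]
        rw [← mul_assoc, h6]
        module
      have h7 : c.val = 1 ∨ c.val = -1 := by
        have h8 : c.val.trace • c.val = (2 : ℚ_[p]) • 1 := by
          have h9 : c.val * c.val = 1 := by
            rw [← Matrix.SpecialLinearGroup.coe_mul, h4, Matrix.SpecialLinearGroup.coe_one]
          rw [hCH, sub_eq_iff_eq_add] at h9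
          rw [h9, two_smul]
        have h10 : (c.val.trace - 2) * (c.val.trace + 2) = 0 := by linear_combination h2
        rcases mul_eq_zero.mp h10 with h11 | h11
        · left
          rw [sub_eq_zero.mp h11] at h8
          exact smul_right_injective _ (two_ne_zero (α := ℚ_[p])) h8
        · right
          rw [eq_neg_of_add_eq_zero_left h11, neg_smul, ← smul_neg] at h8
          rw [← neg_eq_iff_eq_neg]
          exact smul_right_injective _ (two_ne_zero (α := ℚ_[p])) h8
      have h12 : δ * ε * δ⁻¹ = c * ε := by
        rw [hcdef]
        group
      rw [h12, Matrix.SpecialLinearGroup.coe_mul]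
      rcases h7 with h7 | h7
      · left
        rw [h7, Matrix.one_mul]
      · right
        rw [h7, Matrix.neg_mul, Matrix.one_mul]
    -- The traceless part of ε is preserved up to sign by Δ. When the sign is −1 the trace of ε
    -- vanishes, so ε is its own traceless part.
    have hscalar : ∀ ε ∈ Δ, ε.val = (ε.val.trace / 2) • (1 : Matrix (Fin 2) (Fin 2) ℚ_[p]) := by
      intro ε hε
      rw [← sub_eq_zero]
      refine hΔ.eq_zero_of_conj_eq_or_neg ?_ fun δ hδ => ?_
      · rw [Matrix.trace_sub, Matrix.trace_smul, Matrix.trace_one]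
        simp
      · rw [map_sub, map_smul, map_one, Ad_coe]
        rcases hpm δ hδ ε hε with h1 | h1
        · left
          rw [h1]
        · right
          have h2 : ε.val.trace = 0 := by
            have h3 := trace_Ad δ ε.val
            rw [Ad_coe, h1, Matrix.trace_neg] at h3
            exact self_eq_neg.mp h3.symm
          rw [h1, h2]
          simp
    refine hX0 (hΔ.eq_zero_of_conj_eq_or_neg hX fun δ hδ => Or.inl ?_)
    rw [Ad_apply, hscalar δ hδ, Matrix.smul_mul, Matrix.one_mul, ← Matrix.mul_one X,
      ← Matrix.mul_smul, Matrix.mul_assoc, ← hscalar δ hδ, ← Matrix.SpecialLinearGroup.coe_mul,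
      mul_inv_cancel, Matrix.SpecialLinearGroup.coe_one]
  · refine hX0 (hΔ.eq_zero_of_conj_eq_or_neg hX fun δ hδ => ?_)
    obtain ⟨c, hc⟩ := h δ hδ
    have h1 := det_Ad δ X
    rw [hc, Matrix.det_smul, Fintype.card_fin] at h1
    have h2 : (c - 1) * (c + 1) = 0 :=
      mul_right_cancel₀ hdet (by linear_combination h1)
    rw [hc]
    rcases mul_eq_zero.mp h2 with h3 | h3
    · left
      rw [sub_eq_zero.mp h3, one_smul]
    · right
      rw [eq_neg_of_add_eq_zero_left h3, neg_smul, one_smul]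

/-- An invariant subspace of `sl₂` is zero or everything. -/
theorem three_le_finrank (hΔ : IsCocompactSemisimple Δ r)
    {W : Submodule ℚ_[p] (Matrix (Fin 2) (Fin 2) ℚ_[p])} (hW : W ≠ ⊥)
    (htr : ∀ X ∈ W, X.trace = 0) (hinv : ∀ δ ∈ Δ, ∀ X ∈ W, Ad δ X ∈ W) :
    3 ≤ Module.finrank ℚ_[p] W := by
  by_contra hlt
  have hpos : 0 < Module.finrank ℚ_[p] W := Module.finrank_pos_iff.mpr
    (Submodule.nontrivial_iff_ne_bot.mpr hW)
  obtain h1 | h2 : Module.finrank ℚ_[p] W = 1 ∨ Module.finrank ℚ_[p] W = 2 := by omega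
  · obtain ⟨X, hX0, hX⟩ := finrank_eq_one_iff'.mp h1
    refine hΔ.not_line (htr X.1 X.2) (fun h => hX0 (Subtype.ext h)) fun δ hδ => ?_
    obtain ⟨c, hc⟩ := hX ⟨_, hinv δ hδ X.1 X.2⟩
    exact ⟨c, (congrArg Subtype.val hc).symm⟩
  · let b := Module.finBasisOfFinrankEq ℚ_[p] W h2
    have hb : LinearIndependent ℚ_[p] fun i => (b i).1 :=
      b.linearIndependent.map' W.subtype (Submodule.ker_subtype W)
    have hrepr : ∀ X ∈ W, ∃ s t : ℚ_[p], X = s • (b 0).1 + t • (b 1).1 := fun X hX => by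
      have h3 := congrArg Subtype.val (b.sum_repr ⟨X, hX⟩)
      rw [Fin.sum_univ_two] at h3
      exact ⟨_, _, h3.symm⟩
    have hX0 : (b 0).1 ≠ 0 := hb.ne_zero 0
    -- An invariant plane gives an invariant line, spanned by the bracket of a basis: Ad δ
    -- multiplies that bracket by the determinant of its action on the plane.
    refine hΔ.not_line (X := (b 0).1 * (b 1).1 - (b 1).1 * (b 0).1) ?_ ?_ fun δ hδ => ?_
    · rw [Matrix.trace_sub, Matrix.trace_mul_comm, sub_self]
    · intro h
      obtain ⟨c, hc⟩ := exists_smul_eq_of_commute _ _ (htr _ (b 0).2) (htr _ (b 1).2) hX0 h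
        two_ne_zero
      have h3 := (Fintype.linearIndependent_iff.mp hb) ![c, -1] (by
        rw [Fin.sum_univ_two]
        simp [hc]) 1
      simp at h3
    · obtain ⟨s, t, h3⟩ := hrepr _ (hinv δ hδ _ (b 0).2)
      obtain ⟨s', t', h4⟩ := hrepr _ (hinv δ hδ _ (b 1).2)
      refine ⟨s * t' - t * s', ?_⟩
      rw [map_sub, map_mul, map_mul, h3, h4]
      simp only [add_mul, mul_add, Matrix.smul_mul, Matrix.mul_smul]
      module

end IsCocompactSemisimple

end Irreducibility

/-! ### Equations over an extension field and Zariski closure over F -/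

section Descent

variable {F K : Type} [Field F] [Field K] {M : ℕ}

/-- Applying a linear functional to the coefficients of a polynomial. -/
theorem exists_apply_linear [Algebra F K] (l : K →ₗ[F] F) (f : MvPolynomial (Fin M × Fin M) K) :
    ∃ f' : MvPolynomial (Fin M × Fin M) F,
      (∀ A : Matrix (Fin M) (Fin M) F, MvPolynomial.eval (fun ij => A ij.1 ij.2) f' =
        l (MvPolynomial.eval (fun ij => A.map (algebraMap F K) ij.1 ij.2) f)) ∧
      ∀ X : Matrix (Fin M) (Fin M) F,
        diffAtOne f' X = l (diffAtOne f (X.map (algebraMap F K))) := by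
  have hl : ∀ (a : K) (x : F), l (a * algebraMap F K x) = l a * x := fun a x => by
    rw [mul_comm, ← Algebra.smul_def, map_smul, smul_eq_mul, mul_comm]
  induction f using MvPolynomial.induction_on' with
  | monomial u a =>
    have hm : MvPolynomial.monomial u a =
        MvPolynomial.C a * MvPolynomial.map (algebraMap F K) (MvPolynomial.monomial u 1) := by
      rw [MvPolynomial.map_monomial, map_one, MvPolynomial.C_mul_monomial, mul_one]
    have hev : ∀ A : Matrix (Fin M) (Fin M) F,
        MvPolynomial.eval (fun ij => A.map (algebraMap F K) ij.1 ij.2)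
          (MvPolynomial.map (algebraMap F K) (MvPolynomial.monomial u (1 : F))) =
        algebraMap F K (MvPolynomial.eval (fun ij => A ij.1 ij.2)
          (MvPolynomial.monomial u (1 : F))) := fun A => by
      rw [MvPolynomial.eval_map]
      exact (MvPolynomial.eval₂_comp (algebraMap F K)
        (fun ij : Fin M × Fin M => A ij.1 ij.2) _).symm
    refine ⟨MvPolynomial.C (l a) * MvPolynomial.monomial u 1, fun A => ?_, fun X => ?_⟩
    · rw [hm, map_mul, map_mul, MvPolynomial.eval_C, MvPolynomial.eval_C, hev, hl]
    · rw [hm, diffAtOne_mul, diffAtOne_mul, diffAtOne_C, diffAtOne_C, mul_zero, mul_zero, add_zero,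
        add_zero, MvPolynomial.eval_C, MvPolynomial.eval_C, diffAtOne_map, hl]
  | add f g hf hg =>
    obtain ⟨f', h1, h2⟩ := hf
    obtain ⟨g', h3, h4⟩ := hg
    exact ⟨f' + g', fun A => by rw [map_add, map_add, map_add, h1, h3],
      fun X => by rw [diffAtOne_add, diffAtOne_add, map_add, h2, h4]⟩

/-- A polynomial over an extension field vanishing on a set of matrices over `F` has vanishing
differential on the tangent space of the Zariski closure over `F`. -/
theorem diffAtOne_eq_zero_of_vanishes (φ : F →+* K) {S : Set (Matrix (Fin M) (Fin M) F)}
    {f : MvPolynomial (Fin M × Fin M) K}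
    (hf : ∀ A ∈ S, MvPolynomial.eval (fun ij => A.map φ ij.1 ij.2) f = 0)
    {X : Matrix (Fin M) (Fin M) F} (hX : X ∈ tangentAtOne (vanishing S)) :
    diffAtOne f (X.map φ) = 0 := by
  let _ := φ.toAlgebra
  -- An F-linear functional applied to the coefficients of f gives a polynomial over F that still
  -- vanishes on S, because the points of S have coordinates in F.
  rw [← Module.forall_dual_apply_eq_zero_iff F]
  intro l
  obtain ⟨f', h1, h2⟩ := exists_apply_linear l f
  have h3 := hX f' (mem_vanishing.2 fun A hA => by
    rw [h1]
    exact (congrArg l (hf A hA)).trans (map_zero l))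
  rw [h2] at h3
  exact h3

/-- The tangent space of the Zariski closure of a group is stable under conjugation. -/
theorem Ad_mem_tangentAtOne_vanishing {L : Subgroup (Matrix.SpecialLinearGroup (Fin M) F)}
    {a : Matrix.SpecialLinearGroup (Fin M) F} (ha : a ∈ L) {X : Matrix (Fin M) (Fin M) F}
    (hX : X ∈ tangentAtOne (vanishing
      (Subtype.val '' (L : Set (Matrix.SpecialLinearGroup (Fin M) F))))) :
    Ad a X ∈ tangentAtOne (vanishing
      (Subtype.val '' (L : Set (Matrix.SpecialLinearGroup (Fin M) F)))) := by
  intro f hf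
  let c : Fin M × Fin M → MvPolynomial (Fin M × Fin M) F := fun ij =>
    (a.val.map MvPolynomial.C * Matrix.mvPolynomialX (Fin M) (Fin M) F *
      (a⁻¹).val.map MvPolynomial.C :
        Matrix (Fin M) (Fin M) (MvPolynomial (Fin M × Fin M) F)) ij.1 ij.2
  have hc : ∀ {R : Type} [CommRing R] (φ : F →+* R) (A : Matrix (Fin M) (Fin M) R),
      MvPolynomial.eval₂ φ (fun ij => A ij.1 ij.2) (MvPolynomial.bind₁ c f) =
        MvPolynomial.eval₂ φ (fun ij => (a.val.map φ * A * (a⁻¹).val.map φ) ij.1 ij.2) f := by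
    intro R _ φ A
    rw [← MvPolynomial.coe_eval₂Hom, ← MvPolynomial.coe_eval₂Hom, MvPolynomial.eval₂Hom_bind₁]
    congr 2
    funext ij
    rw [MvPolynomial.coe_eval₂Hom]
    simp only [c, Matrix.mul_apply, Matrix.map_apply, Matrix.mvPolynomialX_apply,
      MvPolynomial.eval₂_sum, MvPolynomial.eval₂_mul, MvPolynomial.eval₂_C, MvPolynomial.eval₂_X]
  have h1 : MvPolynomial.bind₁ c f ∈ vanishing
      (Subtype.val '' (L : Set (Matrix.SpecialLinearGroup (Fin M) F))) := by
    rw [mem_vanishing] at hf ⊢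
    rintro _ ⟨(b : Matrix.SpecialLinearGroup (Fin M) F), hb, rfl⟩
    have h2 := hc (RingHom.id F) b.val
    rw [MvPolynomial.eval₂_id] at h2
    rw [h2]
    have h3 := hf (a * b * a⁻¹).val ⟨_, L.mul_mem (L.mul_mem ha hb) (L.inv_mem ha), rfl⟩
    rw [← h3, MvPolynomial.eval₂_id]
    rfl
  have h2 := eval₂_one_add (TrivSqZeroExt.inlHom F F) (DualNumber.eps : DualNumber F)
    DualNumber.eps_mul_eps X (MvPolynomial.bind₁ c f)
  rw [hc, hX _ h1, conj_one_add_smul, eval₂_one_add _ _ DualNumber.eps_mul_eps] at h2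
  have h3 := congrArg TrivSqZeroExt.snd h2
  simpa [Ad_apply, -Matrix.SpecialLinearGroup.coe_inv] using h3

end Descent

/-! ### The Lie algebra of the Zariski closure lies in a conjugate of the diagonal -/

section DiagonalSubalgebra

variable {p : ℕ} [Fact p.Prime]

/-- The two components of an element of `G`. -/
def proj (k : Fin 2) : G p → SL(2, ℚ_[p]) := fun g => ![g.1, g.2] k

theorem proj_mul (k : Fin 2) (g h : G p) : proj k (g * h) = proj k g * proj k h := by
  fin_cases k <;> rfl

theorem proj_inv (k : Fin 2) (g : G p) : proj k g⁻¹ = (proj k g)⁻¹ := by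
  fin_cases k <;> rfl

namespace ArithmeticData

variable {F : Type} [Field F] [NumberField F] {M : ℕ} (D : ArithmeticData p F M)

theorem val_proj_toG (γ : D.𝒢.points (RingHom.id F)) (k : Fin 2) :
    (proj k (D.toG γ)).val = D.ρ.ev (RingHom.id ℚ_[p]) k (γ.1.val.map D.σ) := by
  fin_cases k <;> rfl

/-- The adjoint action on the Lie algebra. -/
noncomputable def adjoint (γ : D.𝒢.points (RingHom.id F)) : D.𝒢.lieAlgebra →ₗ[F] D.𝒢.lieAlgebra :=
  (Ad γ.1).toLinearMap.restrict (p := D.𝒢.lieAlgebra.toSubmodule)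
    (q := D.𝒢.lieAlgebra.toSubmodule) fun X hX => by
      have h1 : (D.𝒢.baseChange (RingHom.id F)).ideal = D.𝒢.ideal := by
        change Ideal.map (MvPolynomial.map (RingHom.id F)) D.𝒢.ideal = _
        rw [show MvPolynomial.map (RingHom.id F) = RingHom.id (MvPolynomial (Fin M × Fin M) F) from
          RingHom.ext MvPolynomial.map_id, Ideal.map_id]
      have h2 := MorphismToSL2SL2.conj_mem_tangentAtOne (𝒢 := D.𝒢) (φ := RingHom.id F) γ.2
        (X := X) (by rw [h1]; exact hX)
      rw [h1] at h2
      exact h2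

theorem val_adjoint (γ : D.𝒢.points (RingHom.id F)) (X : D.𝒢.lieAlgebra) :
    (D.adjoint γ X).val = Ad γ.1 X.val := rfl

theorem d_adjoint (γ : D.𝒢.points (RingHom.id F)) (X : D.𝒢.lieAlgebra) (k : Fin 2) :
    D.d (D.adjoint γ X) k = Ad (proj k (D.toG γ)) (D.d X k) := by
  have hmem : Matrix.SpecialLinearGroup.map D.σ γ.1 ∈
      D.𝒢.points ((RingHom.id ℚ_[p]).comp D.σ) := map_mem_zeros γ.2 D.σ
  have h := D.ρ.diff_conj (RingHom.id ℚ_[p]) hmem (D.map_mem_tangentAtOne X) k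
  have h1 : (D.adjoint γ X).val.map D.σ = (Matrix.SpecialLinearGroup.map D.σ γ.1).val *
      X.val.map D.σ * (Matrix.SpecialLinearGroup.map D.σ γ.1)⁻¹.val := by
    rw [← map_inv]
    change (γ.1.val * X.val * (γ.1⁻¹).val).map D.σ = _
    rw [Matrix.map_mul, Matrix.map_mul]
    rfl
  change D.ρ.diff (RingHom.id ℚ_[p]) ((D.adjoint γ X).val.map D.σ) k = _
  rw [h1]
  refine h.trans ?_
  rw [Ad_apply, ← proj_inv, ← map_inv D.toG, D.val_proj_toG, D.val_proj_toG, ← map_inv]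
  rfl

theorem d_eq_zero {X : D.𝒢.lieAlgebra} (h : D.d X = 0) : X = 0 := by
  by_contra hne
  have h1 : LinearIndependent F fun _ : Unit => X := LinearIndependent.of_subsingleton () hne
  exact (D.linearIndependent_d h1).ne_zero () h

/-- The group `{γ ∈ Γ_S : ρ(γ) ∈ g⁻¹ H g}`. -/
noncomputable def ΛGroup (g : G p) : Subgroup (D.𝒢.points (RingHom.id F)) :=
  D.ΓS ⊓ ((H p).comap (MulAut.conj g).toMonoidHom).comap D.toG

theorem closureIdeal_eq (g : G p) : D.closureIdeal g = vanishing (Subtype.val ''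
    ((D.ΛGroup g).map (D.𝒢.points (RingHom.id F)).subtype :
      Set (Matrix.SpecialLinearGroup (Fin M) F))) := by
  rw [closureIdeal, vanishing]
  congr 1
  ext x
  constructor
  · rintro ⟨γ, hγ, rfl⟩
    exact ⟨_, ⟨γ.1, ⟨γ, hγ, rfl⟩, rfl⟩, rfl⟩
  · rintro ⟨_, ⟨_, ⟨γ, hγ, rfl⟩, rfl⟩, rfl⟩
    exact ⟨γ, hγ, rfl⟩

theorem ideal_le_closureIdeal (g : G p) : D.𝒢.ideal ≤ D.closureIdeal g := by
  intro f hf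
  rw [closureIdeal_eq, mem_vanishing]
  rintro _ ⟨_, ⟨γ, -, rfl⟩, rfl⟩
  exact γ.2 f hf

theorem adjoint_mem_𝔩 {g : G p} {γ : D.𝒢.points (RingHom.id F)} (hγ : γ ∈ D.Λ g)
    {X : D.𝒢.lieAlgebra} (hX : X ∈ D.𝔩 g) : D.adjoint γ X ∈ D.𝔩 g := by
  have h1 : X.val ∈ tangentAtOne (D.closureIdeal g) := hX
  change (D.adjoint γ X).val ∈ tangentAtOne (D.closureIdeal g)
  rw [closureIdeal_eq] at h1 ⊢
  exact Ad_mem_tangentAtOne_vanishing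
    (L := (D.ΛGroup g).map (D.𝒢.points (RingHom.id F)).subtype) ⟨γ, hγ, rfl⟩ h1

theorem 𝔩_ne_bot {g : G p} (h : (D.Λ g).Infinite) : D.𝔩 g ≠ ⊥ := by
  have h1 : ((D.ΛGroup g).map (D.𝒢.points (RingHom.id F)).subtype :
      Set (Matrix.SpecialLinearGroup (Fin M) F)).Infinite :=
    h.image Subtype.val_injective.injOn
  have h2 := tangentAtOne_vanishing_ne_bot _ h1
  rw [← closureIdeal_eq] at h2
  obtain ⟨X, hX, hX0⟩ := Submodule.exists_mem_ne_zero_of_ne_bot h2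
  refine (Submodule.ne_bot_iff _).mpr
    ⟨⟨X, tangentAtOne_anti (D.ideal_le_closureIdeal g) hX⟩, hX, fun h => hX0 ?_⟩
  exact congrArg Subtype.val h

/-- The condition gρ(γ)g⁻¹ ∈ H is polynomial in γ with coefficients in ℚ_p. By descent it can be
differentiated along the Zariski closure, although that closure is taken over F. -/
theorem Ad_d_eq {g : G p} {X : D.𝒢.lieAlgebra} (hX : X ∈ D.𝔩 g) :
    Ad (proj 0 g) (D.d X 0) = Ad (proj 1 g) (D.d X 1) := by
  let c : Fin 2 → Matrix (Fin 2) (Fin 2) (MvPolynomial (Fin M × Fin M) ℚ_[p]) := fun k =>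
    (proj k g).val.map MvPolynomial.C * D.ρ.coord k * ((proj k g)⁻¹).val.map MvPolynomial.C
  have hev : ∀ k i j, ∀ γ : D.𝒢.points (RingHom.id F),
      MvPolynomial.eval (fun ij => γ.1.val.map D.σ ij.1 ij.2) (c k i j) =
        (proj k (g * D.toG γ * g⁻¹)).val i j := by
    intro k i j γ
    rw [proj_mul, proj_mul, Matrix.SpecialLinearGroup.coe_mul, Matrix.SpecialLinearGroup.coe_mul,
      proj_inv, D.val_proj_toG]
    simp only [c, Matrix.mul_apply, Matrix.map_apply, map_sum, map_mul, MvPolynomial.eval_C]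
    rfl
  have hd : ∀ k i j, diffAtOne (c k i j) (X.val.map D.σ) = Ad (proj k g) (D.d X k) i j := by
    intro k i j
    have h1 : ∀ (q : MvPolynomial (Fin M × Fin M) ℚ_[p]) (u v : ℚ_[p]),
        diffAtOne (MvPolynomial.C u * q * MvPolynomial.C v) (X.val.map D.σ) =
          u * diffAtOne q (X.val.map D.σ) * v := by
      intro q u v
      simp only [diffAtOne_mul, diffAtOne_C, MvPolynomial.eval_C, mul_zero, zero_add, add_zero]
      ring
    have h2 : ∀ l m : Fin 2, diffAtOne (D.ρ.coord k l m) (X.val.map D.σ) = D.d X k l m := by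
      intro l m
      change _ = diffAtOne (MvPolynomial.map (RingHom.id ℚ_[p]) (D.ρ.coord k l m)) _
      rw [MvPolynomial.map_id]
    rw [Ad_apply]
    simp only [c, Matrix.mul_apply, Matrix.map_apply, Fin.sum_univ_two, add_mul, diffAtOne_add,
      h1, h2]
  have hX' : X.val ∈ tangentAtOne (D.closureIdeal g) := hX
  rw [closureIdeal_eq] at hX'
  ext i j
  rw [← sub_eq_zero, ← hd, ← hd]
  have h1 : ∀ q r : MvPolynomial (Fin M × Fin M) ℚ_[p], diffAtOne (q - r) (X.val.map D.σ) =
      diffAtOne q (X.val.map D.σ) - diffAtOne r (X.val.map D.σ) := by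
    intro q r
    rw [eq_sub_iff_add_eq, ← diffAtOne_add, sub_add_cancel]
  rw [← h1]
  refine diffAtOne_eq_zero_of_vanishes D.σ ?_ hX'
  rintro _ ⟨_, ⟨γ, hγ, rfl⟩, rfl⟩
  rw [map_sub]
  have h2 := mem_H.mp hγ.2
  have h3 : proj 0 (g * D.toG γ * g⁻¹) = proj 1 (g * D.toG γ * g⁻¹) := h2
  refine sub_eq_zero.mpr ?_
  refine (hev 0 i j γ).trans (Eq.trans ?_ (hev 1 i j γ).symm)
  rw [h3]

end ArithmeticData

end DiagonalSubalgebra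

/-! ### The Lie algebra of the Zariski closure has dimension three -/

section DimensionThree

variable {p : ℕ} [Fact p.Prime]

/-- Diagonal matrices of determinant one. -/
noncomputable def torus (t : ℚ_[p]) (ht : t ≠ 0) : SL(2, ℚ_[p]) :=
  ⟨!![t, 0; 0, t⁻¹], by simp [Matrix.det_fin_two, ht]⟩

theorem Ad_torus (t : ℚ_[p]) (ht : t ≠ 0) (X : Matrix (Fin 2) (Fin 2) ℚ_[p]) :
    Ad (torus t ht) X = !![X 0 0, t * t * X 0 1; t⁻¹ * t⁻¹ * X 1 0, X 1 1] := by
  rw [Ad_apply, Matrix.SpecialLinearGroup.coe_inv, Matrix.adjugate_fin_two]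
  ext i j
  fin_cases i <;> fin_cases j <;>
    simp [torus, Matrix.mul_apply, Fin.sum_univ_two, Matrix.vecMul, dotProduct] <;> field_simp

theorem exists_norm_mul_self_mul_le (x : ℚ_[p]) :
    ∃ t : ℚ_[p], t ≠ 0 ∧ ‖t * t * x‖ ≤ (p : ℝ)⁻¹ := by
  obtain ⟨n, hn⟩ := pow_unbounded_of_one_lt (‖x‖ * p)
    (Nat.one_lt_cast.mpr (Fact.out : p.Prime).one_lt)
  have hp0 : (0 : ℝ) < p := Nat.cast_pos.mpr (Fact.out : p.Prime).pos
  have hp1 : (1 : ℝ) ≤ p := Nat.one_le_cast.mpr (Fact.out : p.Prime).one_le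
  refine ⟨(p : ℚ_[p]) ^ n, pow_ne_zero _ (Nat.cast_ne_zero.mpr (Fact.out : p.Prime).ne_zero), ?_⟩
  rw [norm_mul, norm_mul, norm_pow, Padic.norm_p, inv_pow]
  have h1 : (1 : ℝ) ≤ (p : ℝ) ^ n := one_le_pow₀ hp1
  have h2 : ((p : ℝ) ^ n)⁻¹ * ((p : ℝ) ^ n)⁻¹ * ‖x‖ ≤ ((p : ℝ) ^ n)⁻¹ * ‖x‖ :=
    mul_le_mul_of_nonneg_right (mul_le_of_le_one_left (by positivity) (inv_le_one_of_one_le₀ h1))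
      (norm_nonneg x)
  refine h2.trans ?_
  rw [inv_mul_le_iff₀ (by positivity), ← div_eq_mul_inv, le_div_iff₀ hp0]
  exact hn.le

/-- A nilpotent matrix has arbitrarily small conjugates. -/
theorem exists_Ad_small {N : Matrix (Fin 2) (Fin 2) ℚ_[p]} (htr : N.trace = 0) (hdet : N.det = 0) :
    ∃ x : SL(2, ℚ_[p]), ∀ i j, ‖Ad x N i j‖ ≤ (p : ℝ)⁻¹ := by
  rw [Matrix.trace_fin_two, add_comm, ← eq_neg_iff_add_eq_zero] at htr
  rw [Matrix.det_fin_two, htr] at hdet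
  have hp0 : 0 ≤ (p : ℝ)⁻¹ := inv_prime_pos.le
  by_cases hc : N 1 0 = 0
  · have ha : N 0 0 = 0 := by
      rw [hc] at hdet
      have h1 : N 0 0 * N 0 0 = 0 := by linear_combination -hdet
      exact mul_self_eq_zero.mp h1
    obtain ⟨t, ht, h⟩ := exists_norm_mul_self_mul_le (N 0 1)
    refine ⟨torus t ht, fun i j => ?_⟩
    rw [Ad_torus]
    fin_cases i <;> fin_cases j
    · simp [ha]
    · exact h
    · simp [hc]
    · simp [htr, ha]
  · obtain ⟨t, ht, h⟩ := exists_norm_mul_self_mul_le (N 1 0)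
    -- The unipotent factor moves N to a matrix with only the lower left entry nonzero, and the
    -- torus multiplies that entry by t².
    refine ⟨torus t⁻¹ (inv_ne_zero ht) * upper (-(N 0 0 / N 1 0)), fun i j => ?_⟩
    rw [Ad_mul, Ad_torus, Ad_upper]
    fin_cases i <;> fin_cases j
    · simp [hc]
    · have h1 : N 0 1 + -(N 0 0 / N 1 0) * N 1 1 -
          -(N 0 0 / N 1 0) * (N 0 0 + -(N 0 0 / N 1 0) * N 1 0) = 0 := by
        rw [htr]
        field_simp
        linear_combination -hdet
      change ‖t⁻¹ * t⁻¹ * (N 0 1 + -(N 0 0 / N 1 0) * N 1 1 -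
          -(N 0 0 / N 1 0) * (N 0 0 + -(N 0 0 / N 1 0) * N 1 0))‖ ≤ (p : ℝ)⁻¹
      rw [h1, mul_zero, norm_zero]
      exact hp0
    · simpa using h
    · simp [htr, hc]

/-- The subgroup of `SL₂(ℚ_p)` stabilizing a point of `G / Γ` under the diagonal action. -/
noncomputable def stabSL (Γ : Subgroup (G p)) (g : G p) : Subgroup SL(2, ℚ_[p]) :=
  (stab Γ g).comap diag

/-- Double coset representatives times integral matrices give the bounded representatives. A
unipotent element has a conjugate in the principal congruence subgroup, which meets conjugates of Γ
trivially, so it is 1. -/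
theorem exists_isCocompactSemisimple (hp : 3 < p) {Γ : Subgroup (G p)} [DiscreteTopology Γ]
    {g : G p} {S : Finset (H p)}
    (hS : ∀ h : H p, ∃ u ∈ principalH p, ∃ s ∈ S, ∃ t ∈ stab Γ g, h = u * s * t) :
    ∃ r, IsCocompactSemisimple (stabSL Γ g) r := by
  obtain ⟨r, hr⟩ : ∃ r : ℝ, ∀ s ∈ S, (∀ i j, ‖s.1.1.val i j‖ ≤ r) ∧
      ∀ i j, ‖(s.1.1⁻¹).val i j‖ ≤ r := by
    have h1 : ∀ s ∈ S, ∀ i j, 0 ≤ ‖s.1.1.val i j‖ + ‖(s.1.1⁻¹).val i j‖ := fun s _ i j =>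
      add_nonneg (norm_nonneg _) (norm_nonneg _)
    have h2 : ∀ s ∈ S, ∀ i j, ‖s.1.1.val i j‖ + ‖(s.1.1⁻¹).val i j‖ ≤
        ∑ s ∈ S, ∑ i, ∑ j, (‖s.1.1.val i j‖ + ‖(s.1.1⁻¹).val i j‖) := fun s hs i j =>
      ((Finset.single_le_sum (f := fun j => ‖s.1.1.val i j‖ + ‖(s.1.1⁻¹).val i j‖)
        (fun j _ => h1 s hs i j) (Finset.mem_univ j)).trans
        (Finset.single_le_sum (f := fun i => ∑ j, (‖s.1.1.val i j‖ + ‖(s.1.1⁻¹).val i j‖))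
        (fun i _ => Finset.sum_nonneg fun j _ => h1 s hs i j) (Finset.mem_univ i))).trans
        (Finset.single_le_sum
          (f := fun s : H p => ∑ i, ∑ j, (‖s.1.1.val i j‖ + ‖(s.1.1⁻¹).val i j‖))
        (fun s hs => Finset.sum_nonneg fun i _ => Finset.sum_nonneg fun j _ => h1 s hs i j) hs)
    exact ⟨_, fun s hs =>
      ⟨fun i j => (le_add_of_nonneg_right (norm_nonneg _)).trans (h2 s hs i j),
        fun i j => (le_add_of_nonneg_left (norm_nonneg _)).trans (h2 s hs i j)⟩⟩
  have hint : ∀ u ∈ principal p, ∀ i j, ‖u.val i j‖ ≤ 1 := fun u hu i j => by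
    have h2 : u.val = (u.val - 1) + 1 := by rw [sub_add_cancel]
    rw [h2]
    refine norm_add_apply_le (fun i j => (hu i j).trans inv_prime_lt_one.le) (fun i j => ?_) i j
    rw [Matrix.one_apply]
    split_ifs <;> simp
  refine ⟨r, fun h => ?_, fun δ hδ hN => ?_⟩
  · obtain ⟨u, hu, s, hs, t, ht, h1⟩ := hS (diag h)
    obtain ⟨δ, rfl⟩ := diag_surjective t
    refine ⟨u.1.1 * s.1.1, δ, ht, congrArg (fun x => x.1.1) h1, fun i j => ?_, fun i j => ?_⟩
    · rw [Matrix.SpecialLinearGroup.coe_mul]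
      exact (norm_mul_apply_le (hint _ hu.1) (hr s hs).1 i j).trans_eq (one_mul r)
    · rw [mul_inv_rev, Matrix.SpecialLinearGroup.coe_mul]
      exact (norm_mul_apply_le (hr s hs).2 (hint _ ((principal p).inv_mem hu.1)) i j).trans_eq
        (mul_one r)
  · have hdet : (δ.val - 1).det = 0 := by
      have h1 := congrArg Matrix.det hN
      rw [Matrix.det_mul] at h1
      exact mul_self_eq_zero.mp (h1.trans Matrix.det_zero)
    have htr : (δ.val - 1).trace = 0 := by
      have h1 : (δ.val - 1).trace * (δ.val - 1).trace = 0 := by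
        have h00 := congrFun (congrFun hN 0) 0
        have h11 := congrFun (congrFun hN 1) 1
        rw [Matrix.det_fin_two] at hdet
        simp only [Matrix.mul_apply, Fin.sum_univ_two, Matrix.zero_apply] at h00 h11
        rw [Matrix.trace_fin_two]
        linear_combination h00 + h11 + 2 * hdet
      exact mul_self_eq_zero.mp h1
    obtain ⟨x, hx⟩ := exists_Ad_small htr hdet
    have h1 : x * δ * x⁻¹ ∈ principal p := by
      have h2 : (x * δ * x⁻¹).val - 1 = Ad x (δ.val - 1) := by
        rw [map_sub, map_one, Ad_coe]
      rw [mem_principal, h2]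
      exact hx
    have h2 := eq_one_of_mem_stab hp (x := (x, x)) hδ ⟨h1, h1⟩
    exact congrArg (fun y : H p => y.1.1) h2

namespace ArithmeticData

variable {F : Type} [Field F] [NumberField F] {M : ℕ} (D : ArithmeticData p F M)

theorem exists_mem_Λ {Γ : Subgroup (G p)} (hΓ : Γ ≤ D.arithmeticGroup) {g : G p}
    {δ : SL(2, ℚ_[p])} (hδ : δ ∈ stabSL Γ g) :
    ∃ γ ∈ D.Λ g, g * D.toG γ * g⁻¹ = (δ, δ) := by
  obtain ⟨γ, hγ, h⟩ := hΓ (mem_stab.mp hδ)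
  have h1 : g * D.toG γ * g⁻¹ = (δ, δ) := by
    rw [h]
    change g * (g⁻¹ * (δ, δ) * g) * g⁻¹ = (δ, δ)
    group
  refine ⟨γ, ⟨hγ, ?_⟩, h1⟩
  rw [h1]
  exact mem_H.mpr rfl

variable {g : G p}

/-- On 𝔩 the first component determines the second, and the differential is injective. Questions
about 𝔩 thus reduce to one copy of sl₂. -/
theorem d_zero_eq_zero {X : D.𝒢.lieAlgebra} (hX : X ∈ D.𝔩 g) (h : D.d X 0 = 0) : X = 0 := by
  have h1 := D.Ad_d_eq hX
  rw [h, map_zero] at h1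
  have h2 : D.d X 1 = 0 := Ad_injective (proj 1 g) (by rw [← h1, map_zero])
  refine D.d_eq_zero (funext fun k => ?_)
  fin_cases k
  · exact h
  · exact h2

theorem linearIndependent_d_zero {ι : Type} [Finite ι] {e : ι → D.𝒢.lieAlgebra}
    (he : LinearIndependent F e) (hmem : ∀ i, e i ∈ D.𝔩 g) :
    LinearIndependent ℚ_[p] fun i => D.d (e i) 0 := by
  have := Fintype.ofFinite ι
  have h1 := D.linearIndependent_d he
  rw [Fintype.linearIndependent_iff] at h1 ⊢
  intro c hc
  refine h1 c (funext fun k => ?_)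
  have h2 : Ad (proj 0 g) (∑ i, c i • D.d (e i) 0) = Ad (proj 1 g) (∑ i, c i • D.d (e i) 1) := by
    rw [map_sum, map_sum]
    refine Finset.sum_congr rfl fun i _ => ?_
    rw [map_smul, map_smul, D.Ad_d_eq (hmem i)]
  rw [hc, map_zero] at h2
  have h3 : ∑ i, c i • D.d (e i) 1 = 0 := Ad_injective (proj 1 g) (by rw [← h2, map_zero])
  rw [Finset.sum_apply]
  fin_cases k
  · exact hc
  · exact h3

end ArithmeticData

/-- Traceless matrices. -/
def sl2 (K : Type) [Field K] : Submodule K (Matrix (Fin 2) (Fin 2) K) :=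
  LinearMap.ker (Matrix.traceLinearMap (Fin 2) K K)

theorem finrank_sl2 (K : Type) [Field K] : Module.finrank K (sl2 K) = 3 := by
  have h1 := LinearMap.finrank_range_add_finrank_ker (Matrix.traceLinearMap (Fin 2) K K)
  have h2 : LinearMap.range (Matrix.traceLinearMap (Fin 2) K K) = ⊤ :=
    LinearMap.range_eq_top.mpr fun c => ⟨!![c, 0; 0, 0], by simp [Matrix.trace_fin_two]⟩
  rw [h2, finrank_top, Module.finrank_self, Module.finrank_matrix, Fintype.card_fin,
    Module.finrank_self] at h1
  change Module.finrank K (LinearMap.ker (Matrix.traceLinearMap (Fin 2) K K)) = 3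
  omega

namespace ArithmeticData

variable {F : Type} [Field F] [NumberField F] {M : ℕ} (D : ArithmeticData p F M)

/-- The Lie algebra of the Zariski closure of `Λ` has dimension three. -/
theorem finrank_𝔩 {Γ : Subgroup (G p)} (hΓ : Γ ≤ D.arithmeticGroup) {g : G p} {r : ℝ}
    (hΔ : IsCocompactSemisimple (stabSL Γ g) r) : Module.finrank F (D.𝔩 g) = 3 := by
  let e := Module.finBasis F (D.𝔩 g)
  have he : LinearIndependent F fun i => (e i : D.𝒢.lieAlgebra) :=
    e.linearIndependent.map' (D.𝔩 g).subtype (Submodule.ker_subtype _)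
  have hd := D.linearIndependent_d_zero he fun i => (e i).2
  refine le_antisymm ?_ ?_
  · have h1 : LinearIndependent ℚ_[p] fun i =>
        (⟨D.d (e i) 0, D.d_mem (e i) 0⟩ : sl2 ℚ_[p]) :=
      LinearIndependent.of_comp (sl2 ℚ_[p]).subtype hd
    have h2 := h1.fintype_card_le_finrank
    rwa [finrank_sl2, Fintype.card_fin] at h2
  · let W : Submodule ℚ_[p] (Matrix (Fin 2) (Fin 2) ℚ_[p]) :=
      Submodule.span ℚ_[p] ((fun X => Ad (proj 0 g) (D.d X 0)) '' (D.𝔩 g : Set D.𝒢.lieAlgebra))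
    have hΛ : (D.Λ g).Infinite := by
      intro hfin
      refine hΔ.infinite ((hfin.image fun γ => (g * D.toG γ * g⁻¹).1).subset fun δ hδ => ?_)
      obtain ⟨γ, hγ, h⟩ := D.exists_mem_Λ hΓ hδ
      exact ⟨γ, hγ, congrArg Prod.fst h⟩
    have hW : W ≠ ⊥ := by
      obtain ⟨X, hX, hX0⟩ := Submodule.exists_mem_ne_zero_of_ne_bot (D.𝔩_ne_bot hΛ)
      refine (Submodule.ne_bot_iff _).mpr ⟨_, Submodule.subset_span ⟨X, hX, rfl⟩, fun h => hX0 ?_⟩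
      exact D.d_zero_eq_zero hX (Ad_injective (proj 0 g) (h.trans (map_zero _).symm))
    have htr : ∀ X ∈ W, X.trace = 0 := by
      have h1 : W ≤ sl2 ℚ_[p] := by
        rw [Submodule.span_le]
        rintro _ ⟨X, -, rfl⟩
        exact (trace_Ad _ _).trans (D.d_mem X 0)
      exact h1
    have hinv : ∀ δ ∈ stabSL Γ g, ∀ X ∈ W, Ad δ X ∈ W := by
      intro δ hδ
      obtain ⟨γ, hγ, h⟩ := D.exists_mem_Λ hΓ hδ
      have h1 : W ≤ W.comap (Ad δ).toLinearMap := by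
        rw [Submodule.span_le]
        rintro _ ⟨X, hX, rfl⟩
        refine Submodule.subset_span ⟨D.adjoint γ X, D.adjoint_mem_𝔩 hγ hX, ?_⟩
        change Ad (proj 0 g) (D.d (D.adjoint γ X) 0) = Ad δ (Ad (proj 0 g) (D.d X 0))
        rw [D.d_adjoint, ← Ad_mul, ← Ad_mul]
        congr 2
        have h2 : proj 0 (g * D.toG γ * g⁻¹) = δ := congrArg Prod.fst h
        rw [← h2, proj_mul, proj_mul, proj_inv]
        group
      exact h1
    refine (hΔ.three_le_finrank hW htr hinv).trans ?_
    have hle : W ≤ Submodule.span ℚ_[p] (Set.range fun i => Ad (proj 0 g) (D.d (e i) 0)) := by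
      rw [Submodule.span_le]
      rintro _ ⟨X, hX, rfl⟩
      have h1 : ∑ i, e.repr ⟨X, hX⟩ i • (e i : D.𝒢.lieAlgebra) = X := by
        have h2 := congrArg Subtype.val (e.sum_repr ⟨X, hX⟩)
        rwa [Submodule.coe_sum] at h2
      change Ad (proj 0 g) (D.d X 0) ∈ _
      rw [← h1, map_sum, Finset.sum_apply, map_sum]
      refine sum_mem fun i _ => ?_
      rw [map_smulₛₗ, Pi.smul_apply, map_smul]
      exact Submodule.smul_mem _ _ (Submodule.subset_span ⟨i, rfl⟩)
    refine (Submodule.finrank_mono hle).trans ((finrank_range_le_card _).trans ?_)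
    rw [Fintype.card_fin]

end ArithmeticData

end DimensionThree

/-! ### The product formula and counting elements of bounded size -/

section Heights

open IsDedekindDomain

variable {p : ℕ} [Fact p.Prime] {F : Type} [Field F] [NumberField F] {M : ℕ}

namespace ArithmeticData

variable (D : ArithmeticData p F M)

theorem norm_σ_le_one (x : 𝓞 F) : ‖D.σ x‖ ≤ 1 := by
  have h1 : IsIntegral ℤ (D.σ (x : F)) := (RingOfIntegers.isIntegral_coe x).map (D.σ.toIntAlgHom)
  have h2 : IsIntegral ℤ_[p] (D.σ (x : F)) := h1.tower_top
  obtain ⟨y, hy⟩ := IsIntegrallyClosed.isIntegral_iff.mp h2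
  rw [← hy]
  exact y.2

theorem norm_σ_eq_one {x : 𝓞 F} (hx : x ∉ D.v₀.asIdeal) : ‖D.σ x‖ = 1 :=
  le_antisymm (D.norm_σ_le_one x) (not_lt.mp fun h => hx ((D.mem_v₀_iff x).mpr h))

/-- Reduction modulo p of σ has kernel v₀, and any ring homomorphism to ℤ/p is surjective, so the
residue field of v₀ has p elements. -/
theorem absNorm_v₀ : Ideal.absNorm D.v₀.asIdeal = p := by
  let s : 𝓞 F →+* ℤ_[p] := (D.σ.comp (algebraMap (𝓞 F) F)).codRestrict (PadicInt.subring p)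
    fun x => D.norm_σ_le_one x
  have hker : RingHom.ker ((PadicInt.toZMod (p := p)).comp s) = D.v₀.asIdeal := by
    ext x
    rw [RingHom.mem_ker, RingHom.comp_apply, ← RingHom.mem_ker, PadicInt.ker_toZMod,
      IsLocalRing.mem_maximalIdeal, PadicInt.mem_nonunits, D.mem_v₀_iff]
    rfl
  have hsurj : Function.Surjective ((PadicInt.toZMod (p := p)).comp s) :=
    ZMod.ringHom_surjective _
  rw [Ideal.absNorm_apply, Submodule.cardQuot_apply, ← hker]
  exact (Nat.card_congr (RingHom.quotientKerEquivOfSurjective hsurj).toEquiv).trans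
    (Nat.card_zmod p)

theorem norm_σ_eq_one_of_valuation_eq_one {x : F} (hx : D.v₀.valuation F x = 1) :
    ‖D.σ x‖ = 1 := by
  obtain ⟨n, d, h⟩ := HeightOneSpectrum.exists_primeCompl_mul_eq_of_integer D.v₀ x hx.le
  have hd : (d : 𝓞 F) ∉ D.v₀.asIdeal := d.2
  have hn : n ∉ D.v₀.asIdeal := by
    rw [← HeightOneSpectrum.valuation_eq_one_iff_notMem (K := F)] at hd ⊢
    rw [← h, map_mul, hx, hd, one_mul]
  have h1 := congrArg (fun y => ‖D.σ y‖) h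
  simp only [map_mul, norm_mul] at h1
  have h2 := D.norm_σ_eq_one hd
  have h3 := D.norm_σ_eq_one hn
  rw [RingOfIntegers.coe_eq_algebraMap] at h2 h3
  rwa [h2, h3, mul_one] at h1

/-- Units at v₀ have norm 1 under σ, so both absolute values are determined by a uniformizer π. It
remains to see that ‖σπ‖ = 1/p. -/
theorem adicAbv_v₀ (x : F) :
    NumberField.HeightOneSpectrum.adicAbv F D.v₀ x = ‖D.σ x‖ := by
  by_cases hx : x = 0
  · rw [hx, map_zero, map_zero, norm_zero]
  have hp0 : (0 : ℝ) < p := Nat.cast_pos.mpr (Fact.out : p.Prime).pos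
  have hp1 : (p : ℝ) ≠ 1 := (Nat.one_lt_cast.mpr (Fact.out : p.Prime).one_lt).ne'
  obtain ⟨π, hπ⟩ := D.v₀.valuation_exists_uniformizer F
  have hπ0 : π ≠ 0 := fun h => by
    rw [h, map_zero] at hπ
    exact WithZero.exp_ne_zero hπ.symm
  have key : ∀ y : F, y ≠ 0 → ∃ n : ℤ, D.v₀.valuation F y = WithZero.exp n ∧
      ‖D.σ y‖ = ‖D.σ π‖ ^ (-n) := by
    intro y hy
    have hv : D.v₀.valuation F y ≠ 0 := (Valuation.ne_zero_iff _).mpr hy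
    obtain ⟨n, hn⟩ : ∃ n : ℤ, D.v₀.valuation F y = WithZero.exp n :=
      ⟨WithZero.log (D.v₀.valuation F y), (WithZero.exp_log hv).symm⟩
    refine ⟨n, hn, ?_⟩
    have h1 : ‖D.σ (y * π ^ n)‖ = 1 := D.norm_σ_eq_one_of_valuation_eq_one (by
      rw [map_mul, map_zpow₀, hn, hπ, ← WithZero.exp_zsmul, ← WithZero.exp_add]
      simp)
    rw [map_mul, norm_mul, map_zpow₀, norm_zpow] at h1
    rw [zpow_neg]
    exact eq_inv_of_mul_eq_one_left h1
  have hσπ : ‖D.σ π‖ = (p : ℝ)⁻¹ := by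
    obtain ⟨n, hn, h1⟩ := key (p : F) (Nat.cast_ne_zero.mpr (Fact.out : p.Prime).ne_zero)
    rw [map_natCast, Padic.norm_p, Padic.norm_eq_zpow_neg_valuation ((map_ne_zero D.σ).mpr hπ0),
      ← zpow_mul, ← zpow_neg_one] at h1
    have h2 := zpow_right_injective₀ hp0 hp1 h1
    have h3 : n ≤ 0 := by
      have h4 : D.v₀.valuation F (algebraMap (𝓞 F) F (p : 𝓞 F)) ≤ 1 := D.v₀.valuation_le_one _
      rw [map_natCast, hn, ← WithZero.exp_zero, WithZero.exp_le_exp] at h4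
      exact h4
    -- The valuation of p at v₀ times the valuation of σπ is 1, so both are 1: the norm of σπ is a
    -- power of p, and p is a power of π up to a unit.
    have h5 : (-(D.σ π).valuation) = -1 := by
      rcases Int.eq_one_or_neg_one_of_mul_eq_neg_one h2.symm with h | h
      · rw [h] at h2
        omega
      · exact h
    rw [Padic.norm_eq_zpow_neg_valuation ((map_ne_zero D.σ).mpr hπ0), h5, zpow_neg_one]
  obtain ⟨n, hn, h1⟩ := key x hx
  rw [h1, hσπ, NumberField.HeightOneSpectrum.adicAbv_def, hn]
  rw [WithZeroMulInt.toNNReal_neg_apply _ WithZero.exp_ne_zero, inv_zpow', neg_neg]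
  simp only [D.absNorm_v₀, NNReal.coe_zpow, NNReal.coe_natCast]
  rfl

-- In the product formula the places outside S contribute factors at most 1 to a nonzero S-integer.
-- Real places have multiplicity one, so the height is exactly the product over S.
open scoped Classical in
theorem one_le_height {x : F} (hx : x ∈ D.integers) (hx0 : x ≠ 0) : 1 ≤ D.height x := by
  have hreal := D.totallyReal
  have h1 := prod_abs_eq_one hx0
  have h2 : ∏ w : InfinitePlace F, w x ^ w.mult = ∏ w : InfinitePlace F, w x :=
    Finset.prod_congr rfl fun w _ => by
      rw [InfinitePlace.mult_isReal ⟨w, IsTotallyReal.isReal w⟩, pow_one]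
  rw [h2, ← mul_finprod_cond_ne (FinitePlace.mk D.v₀) (FinitePlace.hasFiniteMulSupport hx0),
    ← mul_assoc] at h1
  have h3 : FinitePlace.mk D.v₀ x = ‖D.σ x‖ := by
    rw [FinitePlace.mk_apply, FinitePlace.norm_embedding, D.adicAbv_v₀]
  rw [h3] at h1
  change D.height x * _ = 1 at h1
  have h4 : ∀ w : FinitePlace F, ∏ᶠ (_ : w ≠ FinitePlace.mk D.v₀), w x ≤ 1 := fun w => by
    by_cases hw : w = FinitePlace.mk D.v₀
    · simp [hw]
    · rw [finprod_eq_if, if_pos hw, ← FinitePlace.norm_embedding_eq, FinitePlace.norm_embedding']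
      have h5 : w.maximalIdeal ∉ ({D.v₀} : Set (HeightOneSpectrum (𝓞 F))) := fun h => hw (by
        rw [← FinitePlace.mk_maximalIdeal w, Set.mem_singleton_iff.mp h])
      have h6 := hx _ h5
      have h7 := (WithZeroMulInt.toNNReal_strictMono
        (NumberField.HeightOneSpectrum.one_lt_absNorm_nnreal w.maximalIdeal)).monotone h6
      rw [map_one] at h7
      exact_mod_cast h7
  have h5 : ∏ᶠ (w : FinitePlace F) (_ : w ≠ FinitePlace.mk D.v₀), w x ≤ 1 :=
    finprod_induction (fun y : ℝ => 0 ≤ y ∧ y ≤ 1) ⟨zero_le_one, le_rfl⟩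
      (fun a b ha hb => ⟨mul_nonneg ha.1 hb.1, mul_le_one₀ ha.2 hb.1 hb.2⟩)
      (fun w => ⟨by
        rw [finprod_eq_if]
        split_ifs
        · exact apply_nonneg w x
        · exact zero_le_one, h4 w⟩) |>.2
  have h6 : 0 ≤ D.height x :=
    mul_nonneg (Finset.prod_nonneg fun w _ => apply_nonneg w x) (norm_nonneg _)
  calc 1 = D.height x * _ := h1.symm
    _ ≤ D.height x := mul_le_of_le_one_right h6 h5

theorem height_mul (x y : F) : D.height (x * y) = D.height x * D.height y := by
  simp only [height, map_mul, norm_mul, Finset.prod_mul_distrib]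
  ring

theorem height_pos {x : F} (hx : x ≠ 0) : 0 < D.height x :=
  mul_pos (Finset.prod_pos fun w _ => w.pos_iff.mpr hx)
    (norm_pos_iff.mpr ((map_ne_zero D.σ).mpr hx))

/-- Elements of bounded denominator and bounded size are few in number. -/
theorem exists_card_le {m : F} (hm : m ≠ 0) {c : ℝ} (hc : 0 < c) :
    ∃ C : ℝ, 0 < C ∧ ∀ x ∈ D.integers, x ≠ 0 → ∀ T : Finset F,
      (∀ y ∈ T, m * y ∈ D.integers ∧ (∀ v : InfinitePlace F, v y ≤ c * v x) ∧
        ‖D.σ y‖ ≤ c * ‖D.σ x‖) → (T.card : ℝ) ≤ C * D.height x := by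
  classical
  have hreal := D.totallyReal
  obtain ⟨v₁⟩ : Nonempty (InfinitePlace F) := inferInstance
  let τ := InfinitePlace.embedding_of_isReal (IsTotallyReal.isReal v₁)
  have hτ : ∀ y, |τ y| = v₁ y := InfinitePlace.norm_embedding_of_isReal _
  let n := Fintype.card (InfinitePlace F)
  let A : ℝ := D.height m * (2 * c) ^ (n + 1)
  have hA : 0 < A := mul_pos (D.height_pos hm) (by positivity)
  refine ⟨A + 3, by positivity, fun x hx hx0 T hT => ?_⟩
  have hxpos : ∀ v : InfinitePlace F, 0 < v x := fun v => v.pos_iff.mpr hx0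
  have hσx : 0 < ‖D.σ x‖ := norm_pos_iff.mpr ((map_ne_zero D.σ).mpr hx0)
  -- An upper bound for the height of m(y − z) with the factor at v₁ removed, for y, z in T.
  let P : ℝ := D.height m * ((∏ v ∈ Finset.univ.erase v₁, (2 * c * v x)) * (2 * c * ‖D.σ x‖))
  have hP : 0 < P := mul_pos (D.height_pos hm) (mul_pos
    (Finset.prod_pos fun v _ => mul_pos (by positivity) (hxpos v)) (by positivity))
  have hPA : v₁ x * P * (2 * c) = A * D.height x := by
    have h1 : ∏ v : InfinitePlace F, (2 * c * v x) = (2 * c) ^ n * ∏ v : InfinitePlace F, v x := by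
      rw [Finset.prod_mul_distrib, Finset.prod_const, Finset.card_univ]
    rw [← Finset.mul_prod_erase _ _ (Finset.mem_univ v₁)] at h1
    have h2 : D.height x = (∏ v : InfinitePlace F, v x) * ‖D.σ x‖ := rfl
    simp only [P, A]
    rw [h2]
    linear_combination (D.height m * (2 * c) * ‖D.σ x‖) * h1
  -- The S-integer m(y − z) has height at least 1. Bounding its factors at all places other than v₁
  -- forces y and z apart at v₁, by at least 1/P.
  have hsep : ∀ y ∈ T, ∀ z ∈ T, y ≠ z → 1 ≤ P * |τ y - τ z| := by
    intro y hy z hz hyz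
    have hint : m * (y - z) ∈ D.integers := by
      rw [mul_sub]
      exact sub_mem (hT y hy).1 (hT z hz).1
    have h1 := D.one_le_height hint (mul_ne_zero hm (sub_ne_zero.mpr hyz))
    rw [height_mul] at h1
    refine h1.trans ?_
    have h2 : ∀ v : InfinitePlace F, v (y - z) ≤ 2 * c * v x := fun v => by
      have h3 := (AbsoluteValue.sub_le v.1 y 0 z)
      rw [sub_zero, zero_sub, AbsoluteValue.map_neg] at h3
      have h4 := (hT y hy).2.1 v
      have h5 := (hT z hz).2.1 v
      change v (y - z) ≤ v y + v z at h3
      linarith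
    have h3 : ‖D.σ (y - z)‖ ≤ 2 * c * ‖D.σ x‖ := by
      rw [map_sub]
      refine (norm_sub_le _ _).trans ?_
      have h4 := (hT y hy).2.2
      have h5 := (hT z hz).2.2
      linarith
    have h4 : D.height (y - z) = |τ y - τ z| *
        ((∏ v ∈ Finset.univ.erase v₁, v (y - z)) * ‖D.σ (y - z)‖) := by
      rw [← map_sub, hτ, height, ← Finset.mul_prod_erase _ _ (Finset.mem_univ v₁), mul_assoc]
    rw [h4]
    have h5 : (∏ v ∈ Finset.univ.erase v₁, v (y - z)) * ‖D.σ (y - z)‖ ≤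
        (∏ v ∈ Finset.univ.erase v₁, (2 * c * v x)) * (2 * c * ‖D.σ x‖) :=
      mul_le_mul (Finset.prod_le_prod (fun v _ => apply_nonneg v _) fun v _ => h2 v) h3
        (norm_nonneg _) (Finset.prod_nonneg fun v _ => (mul_pos (by positivity) (hxpos v)).le)
    refine (mul_le_mul_of_nonneg_left (mul_le_mul_of_nonneg_left h5 (abs_nonneg _))
      (D.height_pos hm).le).trans_eq ?_
    simp only [P]
    ring
  let N : ℤ := ⌊P * (c * v₁ x)⌋ + 1
  -- After scaling by P the points are 1-separated in a real interval of half-length P c v₁(x), so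
  -- they have distinct integer parts.
  have hcard : T.card ≤ (Finset.Icc (-N) N).card := by
    refine Finset.card_le_card_of_injOn (fun y => ⌊P * τ y⌋) (fun y hy => ?_) fun y hy z hz h => ?_
    · have h1 : |P * τ y| ≤ P * (c * v₁ x) := by
        rw [abs_mul, abs_of_pos hP, hτ]
        exact mul_le_mul_of_nonneg_left ((hT y hy).2.1 v₁) hP.le
      have h2 := Int.lt_floor_add_one (P * (c * v₁ x))
      have h3 := abs_le.mp h1
      rw [Finset.coe_Icc, Set.mem_Icc]
      constructor
      · rw [Int.le_floor]
        push_cast [N]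
        linarith
      · exact (Int.floor_le_floor h3.2).trans (by simp [N])
    · by_contra hne
      have h1 := Int.abs_sub_lt_one_of_floor_eq_floor h
      rw [← mul_sub, abs_mul, abs_of_pos hP] at h1
      exact absurd (hsep y hy z hz hne) (not_le.mpr h1)
  have hN0 : 0 ≤ P * (c * v₁ x) := by
    have := hxpos v₁
    positivity
  have hN : (N : ℝ) ≤ P * (c * v₁ x) + 1 := by
    push_cast [N]
    linarith [Int.floor_le (P * (c * v₁ x))]
  have hN1 : 0 ≤ N := by
    have := Int.floor_nonneg.mpr hN0
    omega
  have h1 : (T.card : ℝ) ≤ 2 * N + 1 := by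
    rw [Int.card_Icc] at hcard
    have h2 : (T.card : ℤ) ≤ 2 * N + 1 := by omega
    exact_mod_cast h2
  -- The additive constant 3 is absorbed because ht(x) ≥ 1.
  have h2 := D.one_le_height hx hx0
  nlinarith

end ArithmeticData

end Heights

/-! ### Orthogonal projection through the Gram matrix -/

section GramProjection

variable {F V ι : Type} [Field F] [AddCommGroup V] [Module F V] [Fintype ι] [DecidableEq ι]
  (B : LinearMap.BilinForm F V) (e : ι → V)

/-- The Gram matrix of a family of vectors. -/
def gram : Matrix ι ι F := Matrix.of fun i j => B (e i) (e j)

/-- The orthogonal projection to the span of `e`, if the Gram matrix of `e` is invertible. -/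
noncomputable def gramProj : V →ₗ[F] V where
  toFun X := ∑ j, Matrix.vecMul (fun i => B X (e i)) (gram B e)⁻¹ j • e j
  map_add' X Y := by
    have h : (fun i => B (X + Y) (e i)) = (fun i => B X (e i)) + fun i => B Y (e i) := by
      ext i
      simp
    simp only [h, Matrix.add_vecMul, Pi.add_apply, add_smul, Finset.sum_add_distrib]
  map_smul' c X := by
    have h : (fun i => B (c • X) (e i)) = c • fun i => B X (e i) := by
      ext i
      simp
    simp only [h, Matrix.smul_vecMul, Pi.smul_apply, smul_assoc, Finset.smul_sum, RingHom.id_apply]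

theorem gramProj_apply (X : V) :
    gramProj B e X = ∑ j, Matrix.vecMul (fun i => B X (e i)) (gram B e)⁻¹ j • e j := rfl

variable {B e}

theorem apply_gramProj_left (h : (gram B e).det ≠ 0) (X : V) (k : ι) :
    B (gramProj B e X) (e k) = B X (e k) := by
  have h1 : Matrix.vecMul (Matrix.vecMul (fun i => B X (e i)) (gram B e)⁻¹) (gram B e) k =
      B X (e k) := by
    rw [Matrix.vecMul_vecMul, Matrix.nonsing_inv_mul _ (isUnit_iff_ne_zero.mpr h),
      Matrix.vecMul_one]
  rw [← h1, gramProj_apply, map_sum, LinearMap.sum_apply, Matrix.vecMul, dotProduct]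
  exact Finset.sum_congr rfl fun j _ => by simp [gram]

theorem apply_gramProj_gramProj (h : (gram B e).det ≠ 0) (X Y : V) :
    B (gramProj B e X) (gramProj B e Y) = B X (gramProj B e Y) := by
  simp only [gramProj_apply B e Y, map_sum, map_smul, apply_gramProj_left h]

/-- For a negative semidefinite form, orthogonal projection does not increase |B(Z, Z)|. Polarizing
B(PX, PY) = B(PX, Y) transfers this to all coefficients, with a bound that does not involve the
subspace. -/
theorem abs_apply_gramProj_le (hB : ∀ X Y, B X Y = B Y X) (h : (gram B e).det ≠ 0) (τ : F →+* ℝ)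
    (hτ : ∀ X, τ (B X X) ≤ 0) (X Y : V) :
    |τ (B (gramProj B e X) Y)| ≤
      |τ (B (X + Y) (X + Y))| + |τ (B X X)| + |τ (B Y Y)| := by
  have hsymm : ∀ X Y, B (gramProj B e X) (gramProj B e Y) = B (gramProj B e X) Y := fun X Y => by
    rw [hB, apply_gramProj_gramProj h, hB]
  have hle : ∀ Z, τ (B (gramProj B e Z) (gramProj B e Z)) ≤ 0 ∧
      τ (B Z Z) ≤ τ (B (gramProj B e Z) (gramProj B e Z)) := fun Z => by
    refine ⟨hτ _, ?_⟩
    have h1 := hτ (Z - gramProj B e Z)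
    have h2 : B (Z - gramProj B e Z) (Z - gramProj B e Z) =
        B Z Z - B (gramProj B e Z) (gramProj B e Z) := by
      simp only [map_sub, LinearMap.sub_apply, ← hsymm Z Z, ← apply_gramProj_gramProj h Z Z]
      ring
    rw [h2, map_sub] at h1
    linarith
  have h3 : B (gramProj B e (X + Y)) (gramProj B e (X + Y)) =
      B (gramProj B e X) (gramProj B e X) + 2 * B (gramProj B e X) Y +
        B (gramProj B e Y) (gramProj B e Y) := by
    rw [← hsymm X Y]
    simp only [map_add, LinearMap.add_apply]
    rw [hB (gramProj B e Y) (gramProj B e X)]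
    ring
  have h4 : τ (B (gramProj B e (X + Y)) (gramProj B e (X + Y))) =
      τ (B (gramProj B e X) (gramProj B e X)) + 2 * τ (B (gramProj B e X) Y) +
        τ (B (gramProj B e Y) (gramProj B e Y)) := by
    rw [h3, map_add τ, map_add τ, map_mul τ, map_ofNat τ]
  have := hle (X + Y)
  have := hle X
  have := hle Y
  rw [abs_of_nonpos (hτ (X + Y)), abs_of_nonpos (hτ X), abs_of_nonpos (hτ Y)]
  rw [abs_le]
  have := hτ X
  have := hτ Y
  have := hτ (X + Y)
  constructor <;> linarith

end GramProjection

/-! ### Nondegeneracy of the trace form -/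

section TraceForm

/-- The trace form on traceless matrices is nondegenerate. -/
theorem eq_zero_of_forall_trace_mul_eq_zero {K : Type} [Field K] (h2 : (2 : K) ≠ 0)
    {Z : Matrix (Fin 2) (Fin 2) K} (hZ : Z.trace = 0)
    (h : ∀ Y : Matrix (Fin 2) (Fin 2) K, Y.trace = 0 → (Z * Y).trace = 0) : Z = 0 := by
  have e1 := h !![0, 1; 0, 0] (by simp [Matrix.trace_fin_two])
  have e2 := h !![0, 0; 1, 0] (by simp [Matrix.trace_fin_two])
  have e3 := h !![1, 0; 0, -1] (by simp [Matrix.trace_fin_two])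
  simp [Matrix.trace_fin_two, Matrix.mul_apply, Fin.sum_univ_two] at e1 e2 e3
  rw [Matrix.trace_fin_two] at hZ
  have e4 : 2 * Z 0 0 = 0 := by linear_combination hZ + e3
  have e5 : Z 0 0 = 0 := (mul_eq_zero.mp e4).resolve_left h2
  have e6 : Z 1 1 = 0 := by rw [e5, zero_add] at hZ; exact hZ
  ext i j
  fin_cases i <;> fin_cases j <;> simp [e1, e2, e5, e6]

theorem eq_zero_of_trace_mul_eq_zero {K : Type} [Field K] (h2 : (2 : K) ≠ 0)
    {A : Fin 3 → Matrix (Fin 2) (Fin 2) K} (hA : LinearIndependent K A)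
    (hA0 : ∀ i, (A i).trace = 0) {Z : Matrix (Fin 2) (Fin 2) K} (hZ : Z.trace = 0)
    (h : ∀ i, (Z * A i).trace = 0) : Z = 0 := by
  have h1 : LinearIndependent K fun i => (⟨A i, hA0 i⟩ : sl2 K) :=
    LinearIndependent.of_comp (sl2 K).subtype hA
  have hspan := h1.span_eq_top_of_card_eq_finrank' (by rw [finrank_sl2, Fintype.card_fin])
  have h3 : ∀ Y : sl2 K, (Z * Y.1).trace = 0 := by
    intro Y
    have h4 : Y ∈ Submodule.span K
        (Set.range fun i => (⟨A i, hA0 i⟩ : sl2 K)) := hspan ▸ Submodule.mem_top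
    induction h4 using Submodule.span_induction with
    | mem x hx =>
      obtain ⟨i, rfl⟩ := hx
      exact h i
    | zero => simp
    | add x y _ _ hx hy => simp [mul_add, hx, hy]
    | smul c x _ hx => simp [hx]
  exact eq_zero_of_forall_trace_mul_eq_zero h2 hZ fun Y hY => h3 ⟨Y, hY⟩

end TraceForm

/-! ### Projection to the graph of a conjugation -/

section DiagonalTriple

variable {p : ℕ} [Fact p.Prime] {F : Type} [Field F] [NumberField F] {M : ℕ}
  (D : ArithmeticData p F M)

namespace ArithmeticData

/-- The triple `e` spans, over `ℚ_p`, the graph of conjugation by `a`. -/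
structure IsDiagonal (a : SL(2, ℚ_[p])) (e : Fin 3 → D.𝒢.lieAlgebra) : Prop where
  linearIndependent : LinearIndependent ℚ_[p] fun i => D.d (e i) 0
  d_one : ∀ i, D.d (e i) 1 = Ad a (D.d (e i) 0)

theorem isDiagonal_of_mem_𝔩 {g : G p} {e : Fin 3 → D.𝒢.lieAlgebra} (he : LinearIndependent F e)
    (hmem : ∀ i, e i ∈ D.𝔩 g) : D.IsDiagonal ((proj 1 g)⁻¹ * proj 0 g) e where
  linearIndependent := D.linearIndependent_d_zero he hmem
  d_one i := by rw [Ad_mul, D.Ad_d_eq (hmem i), Ad_inv_Ad]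

variable {D}

theorem IsDiagonal.adjoint {a : SL(2, ℚ_[p])} {e : Fin 3 → D.𝒢.lieAlgebra}
    (h : D.IsDiagonal a e) (γ : D.𝒢.points (RingHom.id F)) :
    D.IsDiagonal (proj 1 (D.toG γ) * a * (proj 0 (D.toG γ))⁻¹) fun i => D.adjoint γ (e i) where
  linearIndependent := by
    have h1 := h.linearIndependent.map' (Ad (proj 0 (D.toG γ))).toLinearMap
      (LinearMap.ker_eq_bot.mpr (Ad_injective _))
    have h2 : (fun i => D.d (D.adjoint γ (e i)) 0) =
        (Ad (proj 0 (D.toG γ))).toLinearMap ∘ fun i => D.d (e i) 0 :=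
      funext fun i => D.d_adjoint γ (e i) 0
    rw [h2]
    exact h1
  d_one i := by
    rw [d_adjoint, d_adjoint, h.d_one, Ad_mul, Ad_mul, Ad_inv_Ad]

theorem d_sum_smul {ι : Type} (s : Finset ι) (c : ι → F) (e : ι → D.𝒢.lieAlgebra) (k : Fin 2) :
    D.d (∑ i ∈ s, c i • e i) k = ∑ i ∈ s, D.σ (c i) • D.d (e i) k := by
  rw [map_sum, Finset.sum_apply]
  exact Finset.sum_congr rfl fun i _ => by rw [map_smulₛₗ, Pi.smul_apply]

/-- On the graph of Ad a both components contribute equally to the Killing form, which becomes 8 tr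
of the first components. A null vector of the Gram matrix is then orthogonal to all of sl₂. -/
theorem IsDiagonal.gram_det_ne_zero {a : SL(2, ℚ_[p])} {e : Fin 3 → D.𝒢.lieAlgebra}
    (h : D.IsDiagonal a e) : (gram (killingForm F D.𝒢.lieAlgebra) e).det ≠ 0 := by
  intro h0
  obtain ⟨c, hc, hc0⟩ := Matrix.exists_vecMul_eq_zero_iff.mpr h0
  let Z := ∑ i, c i • e i
  have hZ : ∀ j, killingForm F D.𝒢.lieAlgebra Z (e j) = 0 := fun j => by
    have h1 := congrFun hc0 j
    rw [Matrix.vecMul, dotProduct, Pi.zero_apply] at h1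
    simpa [Z, gram] using h1
  have hZ1 : D.d Z 1 = Ad a (D.d Z 0) := by
    rw [d_sum_smul, d_sum_smul, map_sum]
    exact Finset.sum_congr rfl fun i _ => by rw [h.d_one, map_smul]
  have hZ0 : D.d Z 0 = 0 := by
    refine eq_zero_of_trace_mul_eq_zero two_ne_zero h.linearIndependent (fun i => D.d_mem _ 0)
      (D.d_mem _ 0) fun j => ?_
    have h1 := congrArg D.σ (hZ j)
    rw [D.σ_killingForm, map_zero, Fin.sum_univ_two, h.d_one, hZ1, ← map_mul, trace_Ad] at h1
    refine mul_left_cancel₀ (a := (8 : ℚ_[p])) (by norm_num) ?_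
    linear_combination h1
  apply hc
  funext i
  have h3 := Fintype.linearIndependent_iff.mp h.linearIndependent (fun i => D.σ (c i))
    (by rw [← d_sum_smul]; exact hZ0) i
  exact D.σ.injective (h3.trans (map_zero _).symm)

/-- Since Ad a is an isometry of the trace form, the projection of (x, y) is the average of the two
graph points (x, Ad a x) and (Ad a⁻¹ y, y). This explicit form gives both the bound at v₀ and the
recovery of a. -/
theorem IsDiagonal.d_gramProj {a : SL(2, ℚ_[p])} {e : Fin 3 → D.𝒢.lieAlgebra}
    (h : D.IsDiagonal a e) (X : D.𝒢.lieAlgebra) :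
    D.d (gramProj (killingForm F D.𝒢.lieAlgebra) e X) 0 =
        (2 : ℚ_[p])⁻¹ • (D.d X 0 + Ad a⁻¹ (D.d X 1)) ∧
      D.d (gramProj (killingForm F D.𝒢.lieAlgebra) e X) 1 =
        (2 : ℚ_[p])⁻¹ • (Ad a (D.d X 0) + D.d X 1) := by
  set Z := gramProj (killingForm F D.𝒢.lieAlgebra) e X with hZdef
  have hZ1 : D.d Z 1 = Ad a (D.d Z 0) := by
    rw [hZdef, gramProj_apply, d_sum_smul, d_sum_smul, map_sum]
    exact Finset.sum_congr rfl fun i _ => by rw [h.d_one, map_smul]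
  have key : D.d Z 0 = (2 : ℚ_[p])⁻¹ • (D.d X 0 + Ad a⁻¹ (D.d X 1)) := by
    rw [← sub_eq_zero]
    refine eq_zero_of_trace_mul_eq_zero two_ne_zero h.linearIndependent (fun i => D.d_mem _ 0)
      ?_ fun j => ?_
    · have t0 := D.d_mem X 0
      have t1 := D.d_mem X 1
      have t2 := D.d_mem Z 0
      rw [Matrix.trace_sub, Matrix.trace_smul, Matrix.trace_add, trace_Ad, t0, t1, t2]
      simp
    · have h1 := congrArg D.σ (apply_gramProj_left h.gram_det_ne_zero X j)
      rw [D.σ_killingForm, D.σ_killingForm, Fin.sum_univ_two, Fin.sum_univ_two, h.d_one, ← hZdef,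
        hZ1, ← map_mul, trace_Ad] at h1
      have h2 : (Ad a⁻¹ (D.d X 1) * D.d (e j) 0).trace =
          (D.d X 1 * Ad a (D.d (e j) 0)).trace := by
        rw [← trace_Ad a, map_mul, Ad_Ad_inv]
      rw [sub_mul, Matrix.smul_mul, add_mul, Matrix.trace_sub, Matrix.trace_smul,
        Matrix.trace_add, h2, smul_eq_mul]
      linear_combination h1 / 8
  refine ⟨key, ?_⟩
  rw [hZ1, key, map_smul, map_add, Ad_Ad_inv]

theorem IsDiagonal.σ_gramProj {a : SL(2, ℚ_[p])} {e : Fin 3 → D.𝒢.lieAlgebra}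
    (h : D.IsDiagonal a e) (X Y : D.𝒢.lieAlgebra) :
    D.σ (killingForm F D.𝒢.lieAlgebra (gramProj (killingForm F D.𝒢.lieAlgebra) e X) Y) =
      2 * (((D.d X 0 + Ad a⁻¹ (D.d X 1)) * D.d Y 0).trace +
        ((Ad a (D.d X 0) + D.d X 1) * D.d Y 1).trace) := by
  rw [D.σ_killingForm, Fin.sum_univ_two, (h.d_gramProj X).1, (h.d_gramProj X).2,
    Matrix.smul_mul, Matrix.smul_mul, Matrix.trace_smul, Matrix.trace_smul, smul_eq_mul,
    smul_eq_mul]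
  ring

end ArithmeticData

end DiagonalTriple

/-! ### Contracting the discriminant vector to the projection -/

section Contraction

/-- Expanding both determinants along the third row leaves sums of products of 2 × 2 minors, which
collapse to twice the cofactors of the contracted matrix. -/
theorem sum_det_mul_det {R ι : Type} [CommRing R] [Fintype ι] (x y : ι → Fin 3 → R)
    (X Y : Fin 3 → R) :
    ∑ k, ∑ l, (Matrix.of ![x k, x l, Y]).det * (Matrix.of ![y k, y l, X]).det =
      2 * (X ⬝ᵥ Matrix.mulVec (Matrix.of fun i j => ∑ k, x k i * y k j).adjugate Y) := by
  set E : Matrix (Fin 3) (Fin 3) R := Matrix.of fun i j => ∑ k, x k i * y k j with hE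
  have h1 : ∀ a b c d, ∑ k, ∑ l, (x k a * y k c) * (x l b * y l d) = E a c * E b d := by
    intro a b c d
    rw [hE, Matrix.of_apply, Matrix.of_apply, Finset.sum_mul_sum]
  have h2 : ∀ a b c d s t, ∑ k, ∑ l, ((x k a * x l b - x k b * x l a) * s) *
      ((y k c * y l d - y k d * y l c) * t) =
      2 * (E a c * E b d - E a d * E b c) * (s * t) := by
    intro a b c d s t
    have h3 : ∀ k l, ((x k a * x l b - x k b * x l a) * s) *
        ((y k c * y l d - y k d * y l c) * t) =
        ((x k a * y k c) * (x l b * y l d) - (x k a * y k d) * (x l b * y l c) -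
        (x k b * y k c) * (x l a * y l d) + (x k b * y k d) * (x l a * y l c)) * (s * t) :=
      fun k l => by ring
    simp only [h3, ← Finset.sum_mul, Finset.sum_add_distrib, Finset.sum_sub_distrib, h1]
    ring
  have hdet : ∀ u v w : Fin 3 → R, (Matrix.of ![u, v, w]).det =
      (u 1 * v 2 - u 2 * v 1) * w 0 + (u 2 * v 0 - u 0 * v 2) * w 1 +
        (u 0 * v 1 - u 1 * v 0) * w 2 := fun u v w => by
    rw [Matrix.det_fin_three]
    simp only [Matrix.of_apply, Matrix.cons_val_zero, Matrix.cons_val_one, Matrix.cons_val]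
    ring
  simp only [hdet, add_mul, mul_add, Finset.sum_add_distrib, h2]
  rw [Matrix.adjugate_fin_three]
  simp only [Matrix.mulVec, dotProduct, Fin.sum_univ_three, Matrix.of_apply,
    Matrix.cons_val_zero, Matrix.cons_val_one, Matrix.cons_val]
  ring

variable {F V : Type} [Field F] [AddCommGroup V] [Module F V] (B : LinearMap.BilinForm F V)

/-- The linear form on `⋀³ V` defined by three vectors and a bilinear form. -/
noncomputable def wedgeForm (u : Fin 3 → V) : ⋀[F]^3 V →ₗ[F] F :=
  exteriorPower.alternatingMapLinearEquiv
    (Matrix.detRowAlternating.compLinearMap (LinearMap.pi fun i => B (u i)))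

theorem wedgeForm_ιMulti (u a : Fin 3 → V) :
    wedgeForm B u (exteriorPower.ιMulti F 3 a) = (Matrix.of fun i j => B (u i) (a j)).det := by
  rw [wedgeForm, exteriorPower.alternatingMapLinearEquiv_apply_ιMulti, ← Matrix.det_transpose]
  rfl

variable {ι : Type} [Fintype ι]

/-- Contraction of `(⋀³ V)^{⊗ 2}` with two dual bases and two vectors. -/
noncomputable def contraction (b b' : ι → V) (X Y : V) :
    (⋀[F]^3 V) ⊗[F] (⋀[F]^3 V) →ₗ[F] F :=
  ∑ k, ∑ l, LinearMap.mul' F F ∘ₗ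
    TensorProduct.map (wedgeForm B ![b k, b l, Y]) (wedgeForm B ![b' k, b' l, X])

theorem contraction_ιMulti_tmul (b b' : ι → V) (X Y : V) (a c : Fin 3 → V) :
    contraction B b b' X Y (exteriorPower.ιMulti F 3 a ⊗ₜ[F] exteriorPower.ιMulti F 3 c) =
      ∑ k, ∑ l, (Matrix.of fun i j => B (![b k, b l, Y] i) (a j)).det *
        (Matrix.of fun i j => B (![b' k, b' l, X] i) (c j)).det := by
  simp only [contraction, LinearMap.sum_apply, LinearMap.comp_apply, TensorProduct.map_tmul,
    LinearMap.mul'_apply, wedgeForm_ιMulti]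

/-- Contracting two slots against dual bases produces the adjugate of the Gram matrix. Divided by
the determinant it is the inverse Gram matrix, that is, the projection. This is how integrality of
the vector defining the discriminant controls denominators of the projection. -/
theorem contraction_smul_ιMulti_tmul_self (hB : ∀ X Y, B X Y = B Y X) {b b' : ι → V}
    (hb : ∀ u v, ∑ k, B (b k) u * B (b' k) v = B u v) (X Y : V) (e : Fin 3 → V) :
    contraction B b b' X Y ((gram B e).det⁻¹ •
      (exteriorPower.ιMulti F 3 e ⊗ₜ[F] exteriorPower.ιMulti F 3 e)) =
      2 * B (gramProj B e X) Y := by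
  have h1 : ∀ u v w : V, (Matrix.of fun i j => B (![u, v, w] i) (e j)) =
      Matrix.of ![fun j => B u (e j), fun j => B v (e j), fun j => B w (e j)] := fun u v w => by
    ext i j
    fin_cases i <;> rfl
  have h2 : (Matrix.of fun i j => ∑ k, B (b k) (e i) * B (b' k) (e j)) = gram B e := by
    ext i j
    exact hb _ _
  rw [map_smul, contraction_ιMulti_tmul]
  simp only [h1]
  rw [sum_det_mul_det (fun k j => B (b k) (e j)) (fun k j => B (b' k) (e j)), h2,
    gramProj_apply, map_sum, LinearMap.sum_apply, Matrix.inv_def, Ring.inverse_eq_inv']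
  simp only [map_smul, LinearMap.smul_apply, Matrix.vecMul_smul, Pi.smul_apply, smul_eq_mul,
    mul_assoc, ← Finset.mul_sum]
  rw [Matrix.dotProduct_mulVec, dotProduct]
  simp only [hB Y]
  ring

end Contraction

/-! ### Bounded denominators and the action of S-arithmetic elements -/

section Integrality

variable {p : ℕ} [Fact p.Prime] {F : Type} [Field F] [NumberField F] {M : ℕ}
  (D : ArithmeticData p F M)

namespace ArithmeticData

theorem killingForm_comm (X Y : D.𝒢.lieAlgebra) :
    killingForm F D.𝒢.lieAlgebra X Y = killingForm F D.𝒢.lieAlgebra Y X :=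
  LieModule.traceForm_comm F D.𝒢.lieAlgebra D.𝒢.lieAlgebra X Y

/-- The images of an F-basis span sl₂ × sl₂ over ℚ_p, so a vector in the radical is orthogonal to
all of it for the sum of the trace forms. -/
theorem killingForm_nondegenerate : (killingForm F D.𝒢.lieAlgebra).Nondegenerate := by
  have h : ∀ X, (∀ Y, killingForm F D.𝒢.lieAlgebra X Y = 0) → X = 0 := by
    intro X hX
    have h1 : ∀ Y : sl2sq ℚ_[p], ∑ k, (D.d X k * Y.1 k).trace = 0 := by
      intro Y
      have hY : Y ∈ Submodule.span ℚ_[p] (Set.range D.padicBasis) :=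
        D.padicBasis.span_eq ▸ Submodule.mem_top
      induction hY using Submodule.span_induction with
      | mem x hx =>
        obtain ⟨i, rfl⟩ := hx
        have h2 := congrArg D.σ (hX (D.basis i))
        rw [D.σ_killingForm, map_zero] at h2
        rw [coe_padicBasis]
        exact (mul_eq_zero.mp h2).resolve_left (by norm_num)
      | zero => simp
      | add x y _ _ hx hy =>
        simp only [Submodule.coe_add, Pi.add_apply, mul_add, Matrix.trace_add,
          Finset.sum_add_distrib, hx, hy, add_zero]
      | smul c x _ hx =>
        simp only [Submodule.coe_smul, Pi.smul_apply, Matrix.mul_smul, Matrix.trace_smul,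
          ← Finset.smul_sum, hx, smul_zero]
    refine D.d_eq_zero (funext fun k => ?_)
    refine eq_zero_of_forall_trace_mul_eq_zero two_ne_zero (D.d_mem X k) fun A hA => ?_
    have h4 := h1 ⟨Pi.single k A, fun l => by
      by_cases hl : l = k
      · subst hl
        simpa using hA
      · simp [Pi.single_eq_of_ne hl]⟩
    rw [Finset.sum_eq_single k] at h4
    · simpa using h4
    · intro l _ hl
      simp [Pi.single_eq_of_ne hl]
    · simp
  refine ⟨h, fun X hX => h X fun Y => ?_⟩
  rw [killingForm_comm]
  exact hX Y

/-- The basis of the Lie algebra dual to `D.basis` for the Killing form. -/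
noncomputable def dualBasis : Module.Basis (Fin 6) F D.𝒢.lieAlgebra :=
  (killingForm F D.𝒢.lieAlgebra).dualBasis D.killingForm_nondegenerate D.basis

theorem sum_killingForm_mul (X Y : D.𝒢.lieAlgebra) :
    ∑ k, killingForm F D.𝒢.lieAlgebra (D.basis k) X *
      killingForm F D.𝒢.lieAlgebra (D.dualBasis k) Y = killingForm F D.𝒢.lieAlgebra X Y := by
  conv_rhs => rw [← D.dualBasis.sum_repr X]
  rw [map_sum, LinearMap.sum_apply]
  refine Finset.sum_congr rfl fun k _ => ?_
  rw [map_smul, LinearMap.smul_apply, smul_eq_mul, dualBasis,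
    LinearMap.BilinForm.dualBasis_repr_apply, D.killingForm_comm X]

/-- The elements of the Lie algebra with entries in the `S`-integers. -/
def IsIntegralVector (X : D.𝒢.lieAlgebra) : Prop := ∀ i j, X.val i j ∈ D.integers

theorem algebraMap_mem_integers (x : 𝓞 F) : (x : F) ∈ D.integers := D.integers.algebraMap_mem x

/-- Finitely many elements of `F` have a common denominator. -/
theorem exists_smul_mem_integers (T : Finset F) :
    ∃ n ∈ D.integers, n ≠ 0 ∧ ∀ y ∈ T, n * y ∈ D.integers := by
  obtain ⟨n, hn⟩ := IsLocalization.exist_integer_multiples_of_finset (nonZeroDivisors (𝓞 F)) T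
  refine ⟨((n : 𝓞 F) : F), D.algebraMap_mem_integers _,
    RingOfIntegers.coe_ne_zero_iff.mpr (nonZeroDivisors.ne_zero n.2), fun y hy => ?_⟩
  obtain ⟨z, hz⟩ := hn y hy
  have h3 : (n : 𝓞 F) • y = ((n : 𝓞 F) : F) * y := Algebra.smul_def _ _
  rw [← h3, ← hz]
  exact D.algebraMap_mem_integers z

/-- Linear forms on the Lie algebra have bounded denominators. -/
theorem exists_denominator (f : D.𝒢.lieAlgebra →ₗ[F] F) :
    ∃ n ∈ D.integers, n ≠ 0 ∧ ∀ X, D.IsIntegralVector X → n * f X ∈ D.integers := by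
  classical
  obtain ⟨φ, hφ⟩ := LinearMap.exists_extend (p := D.𝒢.lieAlgebra.toSubmodule) f
  obtain ⟨n, hn, hn0, hnT⟩ := D.exists_smul_mem_integers
    (Finset.univ.image fun ij : Fin M × Fin M => φ (Matrix.single ij.1 ij.2 1))
  refine ⟨n, hn, hn0, fun X hX => ?_⟩
  have h1 : f X = ∑ i, ∑ j, X.val i j * φ (Matrix.single i j 1) := by
    have h2 : f X = φ X.val := (LinearMap.congr_fun hφ X).symm
    rw [h2]
    conv_lhs => rw [Matrix.matrix_eq_sum_single X.val]
    simp only [map_sum]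
    refine Finset.sum_congr rfl fun i _ => Finset.sum_congr rfl fun j _ => ?_
    rw [← smul_eq_mul, ← map_smul, Matrix.smul_single, smul_eq_mul, mul_one]
  rw [h1, Finset.mul_sum]
  refine sum_mem fun i _ => ?_
  rw [Finset.mul_sum]
  refine sum_mem fun j _ => ?_
  rw [mul_left_comm]
  exact mul_mem (hX i j) (hnT _ (Finset.mem_image.mpr ⟨(i, j), Finset.mem_univ _, rfl⟩))

theorem exists_common_denominator (U : Finset D.𝒢.lieAlgebra) :
    ∃ n ∈ D.integers, n ≠ 0 ∧ ∀ u ∈ U, ∀ X, D.IsIntegralVector X →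
      n * killingForm F D.𝒢.lieAlgebra u X ∈ D.integers := by
  classical
  induction U using Finset.induction_on with
  | empty => exact ⟨1, one_mem _, one_ne_zero, by simp⟩
  | insert u U _ ih =>
    obtain ⟨n, hn, hn0, h⟩ := ih
    obtain ⟨m, hm, hm0, h'⟩ := D.exists_denominator (killingForm F D.𝒢.lieAlgebra u)
    refine ⟨n * m, mul_mem hn hm, mul_ne_zero hn0 hm0, fun v hv X hX => ?_⟩
    rcases Finset.mem_insert.mp hv with rfl | hv
    · rw [mul_assoc]
      exact mul_mem hn (h' X hX)
    · rw [mul_comm n, mul_assoc]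
      exact mul_mem hm (h v hv X hX)

/-- Contractions have bounded denominators on `D.integralV`. -/
theorem exists_denominator_contraction (U : Finset D.𝒢.lieAlgebra) :
    ∃ n ∈ D.integers, n ≠ 0 ∧ ∀ X ∈ U, ∀ Y ∈ U, ∀ w ∈ D.integralV,
      n * contraction (killingForm F D.𝒢.lieAlgebra) D.basis D.dualBasis X Y w ∈
        D.integers := by
  classical
  obtain ⟨n, hn, hn0, h⟩ := D.exists_common_denominator
    (U ∪ (Finset.univ.image D.basis ∪ Finset.univ.image D.dualBasis))
  -- One factor n clears each row of a 3 × 3 determinant, and each summand is a product of two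
  -- determinants.
  refine ⟨n ^ 3 * n ^ 3, mul_mem (pow_mem hn 3) (pow_mem hn 3),
    mul_ne_zero (pow_ne_zero 3 hn0) (pow_ne_zero 3 hn0), fun X hX Y hY w hw => ?_⟩
  have hdet : ∀ u : Fin 3 → D.𝒢.lieAlgebra, (∀ i, u i ∈
      U ∪ (Finset.univ.image D.basis ∪ Finset.univ.image D.dualBasis)) →
      ∀ a : Fin 3 → D.𝒢.lieAlgebra, (∀ i, D.IsIntegralVector (a i)) →
      n ^ 3 * (Matrix.of fun i j => killingForm F D.𝒢.lieAlgebra (u i) (a j)).det ∈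
        D.integers := by
    intro u hu a ha
    have h1 := Matrix.det_smul (Matrix.of fun i j => killingForm F D.𝒢.lieAlgebra (u i) (a j)) n
    rw [Fintype.card_fin] at h1
    rw [← h1, Matrix.det_apply]
    refine sum_mem fun s _ => ?_
    have h2 : ∏ i, (n • Matrix.of fun i j => killingForm F D.𝒢.lieAlgebra (u i) (a j)) (s i) i ∈
        D.integers := prod_mem fun i _ => h _ (hu (s i)) _ (ha i)
    rcases Int.units_eq_one_or (Equiv.Perm.sign s) with hs | hs <;> rw [hs]
    · simpa using h2
    · simpa using h2
  have hmem : ∀ b : Module.Basis (Fin 6) F D.𝒢.lieAlgebra, (b = D.basis ∨ b = D.dualBasis) →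
      ∀ Z ∈ U, ∀ k l, ∀ i, ![b k, b l, Z] i ∈
        U ∪ (Finset.univ.image D.basis ∪ Finset.univ.image D.dualBasis) := by
    intro b hb Z hZ k l i
    have h1 : ∀ k, b k ∈ U ∪ (Finset.univ.image D.basis ∪ Finset.univ.image D.dualBasis) := by
      rcases hb with rfl | rfl <;> simp
    fin_cases i
    · exact h1 k
    · exact h1 l
    · exact Finset.mem_union_left _ hZ
  induction hw using Submodule.span_induction with
  | mem w hw =>
    obtain ⟨a, c, ha, hc, rfl⟩ := hw
    rw [contraction_ιMulti_tmul, Finset.mul_sum]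
    refine sum_mem fun k _ => ?_
    rw [Finset.mul_sum]
    refine sum_mem fun l _ => ?_
    rw [mul_mul_mul_comm]
    exact mul_mem (hdet _ (hmem _ (Or.inl rfl) Y hY k l) a ha)
      (hdet _ (hmem _ (Or.inr rfl) X hX k l) c hc)
  | zero => simp
  | add v w _ _ hv hw =>
    rw [map_add, mul_add]
    exact add_mem hv hw
  | smul c w _ hw =>
    have h1 : c • w = (c : F) • w := rfl
    rw [h1, map_smul, smul_eq_mul, mul_left_comm]
    exact mul_mem c.2 hw

theorem IsIntegralVector.adjoint {X : D.𝒢.lieAlgebra} (hX : D.IsIntegralVector X)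
    {γ : D.𝒢.points (RingHom.id F)} (hγ : γ ∈ D.ΓS) : D.IsIntegralVector (D.adjoint γ X) := by
  have hentry : ∀ γ ∈ D.ΓS, ∀ i j, γ.1.val i j ∈ D.integers := by
    rintro γ hγ i j
    obtain ⟨a, ha⟩ := hγ
    have h1 : γ.1 = Matrix.SpecialLinearGroup.map D.integers.toSubring.subtype a := ha.symm
    rw [h1]
    exact (a.val i j).2
  intro i j
  rw [D.val_adjoint, Ad_apply, Matrix.mul_apply]
  refine sum_mem fun k _ => mul_mem ?_ (hentry γ⁻¹ (inv_mem hγ) k j)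
  rw [Matrix.mul_apply]
  exact sum_mem fun l _ => mul_mem (hentry γ hγ i l) (hX l k)

/-- After applying σ this is invariance of the trace under conjugation in each component. -/
theorem killingForm_adjoint (γ : D.𝒢.points (RingHom.id F)) (X Y : D.𝒢.lieAlgebra) :
    killingForm F D.𝒢.lieAlgebra (D.adjoint γ X) (D.adjoint γ Y) =
      killingForm F D.𝒢.lieAlgebra X Y := by
  refine D.σ.injective ?_
  rw [D.σ_killingForm, D.σ_killingForm]
  simp only [D.d_adjoint, ← map_mul, trace_Ad]

theorem map_adjoint_mem {γ : D.𝒢.points (RingHom.id F)} (hγ : γ ∈ D.ΓS) {w : D.V}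
    (hw : w ∈ D.integralV) : TensorProduct.map (exteriorPower.map 3 (D.adjoint γ))
      (exteriorPower.map 3 (D.adjoint γ)) w ∈ D.integralV := by
  induction hw using Submodule.span_induction with
  | mem w hw =>
    obtain ⟨a, c, ha, hc, rfl⟩ := hw
    rw [TensorProduct.map_tmul, exteriorPower.map_apply_ιMulti, exteriorPower.map_apply_ιMulti]
    exact Submodule.subset_span ⟨D.adjoint γ ∘ a, D.adjoint γ ∘ c,
      fun k => IsIntegralVector.adjoint D (ha k) hγ,
      fun k => IsIntegralVector.adjoint D (hc k) hγ, rfl⟩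
  | zero =>
    rw [map_zero]
    exact zero_mem _
  | add v w _ _ hv hw =>
    rw [map_add]
    exact add_mem hv hw
  | smul c w _ hw =>
    have h1 : c • w = (c : F) • w := rfl
    rw [h1, map_smul]
    exact Submodule.smul_mem D.integralV c hw

theorem vec_adjoint (γ : D.𝒢.points (RingHom.id F)) (e : Fin 3 → D.𝒢.lieAlgebra) :
    D.vec (D.adjoint γ ∘ e) = TensorProduct.map (exteriorPower.map 3 (D.adjoint γ))
      (exteriorPower.map 3 (D.adjoint γ)) (D.vec e) := by
  rw [vec, vec, map_smul, TensorProduct.map_tmul, exteriorPower.map_apply_ιMulti]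
  simp only [Function.comp_apply, killingForm_adjoint]

theorem smul_vec_adjoint_mem {γ : D.𝒢.points (RingHom.id F)} (hγ : γ ∈ D.ΓS) {x : F}
    {e : Fin 3 → D.𝒢.lieAlgebra} (h : x • D.vec e ∈ D.integralV) :
    x • D.vec (D.adjoint γ ∘ e) ∈ D.integralV := by
  rw [vec_adjoint, ← map_smul]
  exact D.map_adjoint_mem hγ h

/-- The matrix coefficients of the projection to a triple `e` have denominators controlled by
those of `D.vec e`. -/
theorem exists_denominator_gramProj (U : Finset D.𝒢.lieAlgebra) :
    ∃ m : F, m ≠ 0 ∧ ∀ X ∈ U, ∀ Y ∈ U, ∀ (e : Fin 3 → D.𝒢.lieAlgebra) (x : F),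
      x • D.vec e ∈ D.integralV →
      m * (x * killingForm F D.𝒢.lieAlgebra (gramProj (killingForm F D.𝒢.lieAlgebra) e X) Y) ∈
        D.integers := by
  obtain ⟨n, hn, hn0, h⟩ := D.exists_denominator_contraction U
  refine ⟨n * 2, mul_ne_zero hn0 two_ne_zero, fun X hX Y hY e x hx => ?_⟩
  have h1 := h X hX Y hY _ hx
  have h2 := contraction_smul_ιMulti_tmul_self (killingForm F D.𝒢.lieAlgebra)
    D.killingForm_comm D.sum_killingForm_mul X Y e
  have h3 : contraction (killingForm F D.𝒢.lieAlgebra) D.basis D.dualBasis X Y (D.vec e) =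
      2 * killingForm F D.𝒢.lieAlgebra (gramProj (killingForm F D.𝒢.lieAlgebra) e X) Y := h2
  rw [map_smul, h3, smul_eq_mul] at h1
  convert h1 using 1
  ring

end ArithmeticData

end Integrality

/-! ### Recovering the conjugation from one projected vector -/

section Separation

variable {p : ℕ} [Fact p.Prime]

/-- An element of `SL₂` that centralizes two noncommuting traceless matrices is central. -/
theorem eq_one_or_eq_neg_one_of_commute {z : SL(2, ℚ_[p])} {X W : Matrix (Fin 2) (Fin 2) ℚ_[p]}
    (hX : X.trace = 0) (hne : X * W - W * X ≠ 0)
    (hzX : Ad z X = X) (hzW : Ad z W = W) : z.val = 1 ∨ z.val = -1 := by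
  have hcomm : ∀ Y, Ad z Y = Y → z.val * Y = Y * z.val := by
    intro Y hY
    conv_rhs => rw [← hY, Ad_apply, mul_assoc, ← Matrix.SpecialLinearGroup.coe_mul,
      inv_mul_cancel, Matrix.SpecialLinearGroup.coe_one, mul_one]
  have hX0 : X ≠ 0 := by
    rintro rfl
    simp at hne
  let t : ℚ_[p] := z.val.trace / 2
  have htr : (z.val - t • (1 : Matrix (Fin 2) (Fin 2) ℚ_[p])).trace = 0 := by
    rw [Matrix.trace_sub, Matrix.trace_smul, Matrix.trace_one, Fintype.card_fin, smul_eq_mul]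
    simp [t]
  have hc : ∀ Y, Ad z Y = Y → Y * (z.val - t • (1 : Matrix (Fin 2) (Fin 2) ℚ_[p])) -
      (z.val - t • (1 : Matrix (Fin 2) (Fin 2) ℚ_[p])) * Y = 0 := by
    intro Y hY
    rw [mul_sub, sub_mul, hcomm Y hY]
    simp
  obtain ⟨c, hcX⟩ := exists_smul_eq_of_commute X _ hX htr hX0 (hc X hzX) two_ne_zero
  have hc0 : c = 0 := by
    by_contra h0
    have h1 := hc W hzW
    rw [hcX, Matrix.mul_smul, Matrix.smul_mul, ← smul_sub] at h1
    have h2 := (smul_eq_zero.mp h1).resolve_left h0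
    exact hne (by rw [← neg_sub, h2, neg_zero])
  rw [hc0, zero_smul, sub_eq_zero] at hcX
  have hdet := z.2
  rw [hcX, Matrix.det_smul, Matrix.det_one, Fintype.card_fin, mul_one] at hdet
  rcases sq_eq_sq_iff_eq_or_eq_neg.mp (hdet.trans (one_pow 2).symm) with h | h
  · left
    rw [hcX, h, one_smul]
  · right
    rw [hcX, h, neg_smul, one_smul]

/-- The entry −2 of −1 − 1 is a p-adic unit because p is odd. -/
theorem neg_one_notMem_principal (hp : 3 < p) {z : SL(2, ℚ_[p])} (hz : z ∈ principal p) :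
    z.val ≠ -1 := by
  intro h
  have h1 := hz 0 0
  rw [h] at h1
  have h2 : ((-1 : Matrix (Fin 2) (Fin 2) ℚ_[p]) - 1) 0 0 = ((-2 : ℤ) : ℚ_[p]) := by
    simp
    norm_num
  rw [h2] at h1
  have h3 := (Padic.norm_intCast_lt_one_iff (p := p) (k := -2)).mp (h1.trans_lt inv_prime_lt_one)
  have h4 := Int.le_of_dvd (by norm_num) ((dvd_neg).mp h3)
  omega

namespace ArithmeticData

variable {F : Type} [Field F] [NumberField F] {M : ℕ} {D : ArithmeticData p F M}

/-- Some sum of two basis vectors has noncommuting components after conjugation by `a`. -/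
theorem exists_not_commute (D : ArithmeticData p F M) (a : SL(2, ℚ_[p])) :
    ∃ i j, D.d (D.basis i + D.basis j) 0 * Ad a (D.d (D.basis i + D.basis j) 1) -
      Ad a (D.d (D.basis i + D.basis j) 1) * D.d (D.basis i + D.basis j) 0 ≠ 0 := by
  by_contra! hall
  let L : sl2sq ℚ_[p] → sl2sq ℚ_[p] → Matrix (Fin 2) (Fin 2) ℚ_[p] := fun X Y =>
    X.1 0 * Ad a (Y.1 1) - Ad a (Y.1 1) * X.1 0
  -- Polarization: if the quadratic map X ↦ [X₀, Ad a X₁] vanishes on all sums of two basis vectors,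
  -- its symmetrization vanishes identically.
  have hb : ∀ i j, L (D.padicBasis i) (D.padicBasis j) + L (D.padicBasis j) (D.padicBasis i) =
      0 := by
    intro i j
    have hd : ∀ i j k, D.d (D.basis i + D.basis j) k = D.d (D.basis i) k + D.d (D.basis j) k :=
      fun i j k => by rw [map_add, Pi.add_apply]
    have h0 : ∀ i, L (D.padicBasis i) (D.padicBasis i) = 0 := fun i => by
      have h1 := hall i i
      simp only [hd, ← two_smul ℚ_[p], map_smul, Matrix.smul_mul, Matrix.mul_smul,
        ← smul_sub] at h1
      have h2 := (smul_eq_zero.mp ((smul_eq_zero.mp h1).resolve_left two_ne_zero)).resolve_left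
        two_ne_zero
      simpa only [L, coe_padicBasis] using h2
    have h1 := hall i j
    have h2 := h0 i
    have h3 := h0 j
    simp only [L, coe_padicBasis] at h2 h3 ⊢
    simp only [hd, map_add, mul_add, add_mul] at h1
    have h4 : ∀ A B C E S T U V : Matrix (Fin 2) (Fin 2) ℚ_[p],
        A - B = 0 → C - E = 0 → A + T + (S + C) - (B + V + (U + E)) = 0 →
        S - V + (T - U) = 0 := by
      intro A B C E S T U V e1 e2 e3
      rw [sub_eq_zero] at e1 e2
      rw [e1, e2] at e3
      rw [← e3]
      abel
    exact h4 _ _ _ _ _ _ _ _ h2 h3 h1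
  have hadd : ∀ X X' Y, L (X + X') Y = L X Y + L X' Y := fun X X' Y => by
    simp only [L, Submodule.coe_add, Pi.add_apply, mul_add, add_mul]
    abel
  have hadd' : ∀ X Y Y', L X (Y + Y') = L X Y + L X Y' := fun X Y Y' => by
    simp only [L, Submodule.coe_add, Pi.add_apply, map_add, mul_add, add_mul]
    abel
  have hsmul : ∀ (c : ℚ_[p]) X Y, L (c • X) Y = c • L X Y := fun c X Y => by
    simp only [L, Submodule.coe_smul, Pi.smul_apply, Matrix.smul_mul, Matrix.mul_smul, smul_sub]
  have hsmul' : ∀ (c : ℚ_[p]) X Y, L X (c • Y) = c • L X Y := fun c X Y => by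
    simp only [L, Submodule.coe_smul, Pi.smul_apply, map_smul, Matrix.smul_mul, Matrix.mul_smul,
      smul_sub]
  let Q : sl2sq ℚ_[p] →ₗ[ℚ_[p]] sl2sq ℚ_[p] →ₗ[ℚ_[p]] Matrix (Fin 2) (Fin 2) ℚ_[p] :=
    LinearMap.mk₂ ℚ_[p] (fun X Y => L X Y + L Y X)
      (fun X X' Y => by
        rw [hadd, hadd']
        abel)
      (fun c X Y => by rw [hsmul, hsmul', smul_add])
      (fun X Y Y' => by
        rw [hadd, hadd']
        abel)
      (fun c X Y => by rw [hsmul, hsmul', smul_add])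
  have hQ : Q = 0 := D.padicBasis.ext fun i => D.padicBasis.ext fun j => hb i j
  have hL : ∀ X Y, L X Y + L Y X = 0 := fun X Y =>
    LinearMap.congr_fun (LinearMap.congr_fun hQ X) Y
  -- Test pair: the first vector lives in the first factor and the second in the other, so one of
  -- the two terms drops out and a nonzero bracket of elementary nilpotents remains.
  have h1 := hL ⟨![!![0, 1; 0, 0], 0], fun k => by
      fin_cases k <;> simp [Matrix.trace_fin_two]⟩
    ⟨![0, Ad a⁻¹ !![0, 0; 1, 0]], fun k => by
      fin_cases k
      · simp
      · change (Ad a⁻¹ !![0, 0; 1, 0]).trace = 0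
        rw [trace_Ad]
        simp [Matrix.trace_fin_two]⟩
  simp only [L, Matrix.cons_val_zero, Matrix.cons_val_one, Ad_Ad_inv, map_zero, mul_zero,
    sub_self, add_zero] at h1
  have h2 := congrFun (congrFun h1 0) 0
  simp at h2

/-- The projections to two diagonal triples agree on a generic vector only if the triples
are conjugate by the same element up to sign. -/
theorem IsDiagonal.eq_or_eq_neg {a a' : SL(2, ℚ_[p])} {e e' : Fin 3 → D.𝒢.lieAlgebra}
    (h : D.IsDiagonal a e) (h' : D.IsDiagonal a' e') {X : D.𝒢.lieAlgebra}
    (hX : D.d X 0 * Ad a⁻¹ (D.d X 1) - Ad a⁻¹ (D.d X 1) * D.d X 0 ≠ 0)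
    (heq : ∀ k, killingForm F D.𝒢.lieAlgebra (gramProj (killingForm F D.𝒢.lieAlgebra) e X)
        (D.basis k) =
      killingForm F D.𝒢.lieAlgebra (gramProj (killingForm F D.𝒢.lieAlgebra) e' X)
        (D.basis k)) : (a'⁻¹ * a).val = 1 ∨ (a'⁻¹ * a).val = -1 := by
  have h1 : gramProj (killingForm F D.𝒢.lieAlgebra) e X =
      gramProj (killingForm F D.𝒢.lieAlgebra) e' X := by
    rw [← sub_eq_zero]
    refine D.killingForm_nondegenerate.1 _ fun Y => ?_
    rw [← D.basis.sum_repr Y, map_sum]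
    refine Finset.sum_eq_zero fun k _ => ?_
    rw [map_smul, map_sub, LinearMap.sub_apply, heq, sub_self, smul_zero]
  have h2 := h.d_gramProj X
  have h3 := h'.d_gramProj X
  rw [h1] at h2
  -- Equal averages give Ad a⁻¹ X₁ = Ad a'⁻¹ X₁ and Ad a X₀ = Ad a' X₀. So a'⁻¹a fixes the
  -- noncommuting pair X₀ and Ad a⁻¹ X₁.
  have h4 := smul_right_injective _ (inv_ne_zero (two_ne_zero (α := ℚ_[p]))) (h2.1.symm.trans h3.1)
  have h5 := smul_right_injective _ (inv_ne_zero (two_ne_zero (α := ℚ_[p]))) (h2.2.symm.trans h3.2)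
  refine eq_one_or_eq_neg_one_of_commute (D.d_mem X 0) hX ?_ ?_
  · rw [Ad_mul, add_right_cancel h5, Ad_inv_Ad]
  · rw [Ad_mul, Ad_Ad_inv, ← add_left_cancel h4]

end ArithmeticData

end Separation

/-! ### Uniform bounds at the places of S -/

section Bounds

variable {p : ℕ} [Fact p.Prime]

theorem norm_apply_le_sum (X : Matrix (Fin 2) (Fin 2) ℚ_[p]) (i j : Fin 2) :
    ‖X i j‖ ≤ ∑ i, ∑ j, ‖X i j‖ :=
  (Finset.single_le_sum (f := fun j => ‖X i j‖) (fun _ _ => norm_nonneg _)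
    (Finset.mem_univ j)).trans (Finset.single_le_sum (f := fun i => ∑ j, ‖X i j‖)
    (fun _ _ => Finset.sum_nonneg fun _ _ => norm_nonneg _) (Finset.mem_univ i))

theorem norm_trace_le {X : Matrix (Fin 2) (Fin 2) ℚ_[p]} {r : ℝ} (h : ∀ i j, ‖X i j‖ ≤ r) :
    ‖X.trace‖ ≤ r := by
  rw [Matrix.trace_fin_two]
  exact (Padic.nonarchimedean _ _).trans (max_le (h 0 0) (h 1 1))

theorem norm_Ad_apply_le {a : SL(2, ℚ_[p])} {b t : ℝ} (ha : ∀ i j, ‖a.val i j‖ ≤ b)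
    (ha' : ∀ i j, ‖(a⁻¹).val i j‖ ≤ b) {X : Matrix (Fin 2) (Fin 2) ℚ_[p]}
    (hX : ∀ i j, ‖X i j‖ ≤ t) (i j : Fin 2) : ‖(Ad a X) i j‖ ≤ b * t * b :=
  norm_mul_apply_le (norm_mul_apply_le ha hX) ha' i j

namespace ArithmeticData

variable {F : Type} [Field F] [NumberField F] {M : ℕ} (D : ArithmeticData p F M)

/-- Uniform bounds, at all places in `S`, for matrix coefficients of projections. -/
theorem exists_bound_gramProj (U : Finset D.𝒢.lieAlgebra) (b : ℝ) :
    ∃ c : ℝ, 0 < c ∧ ∀ (a : SL(2, ℚ_[p])) (e : Fin 3 → D.𝒢.lieAlgebra), D.IsDiagonal a e →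
      (∀ i j, ‖a.val i j‖ ≤ b) → (∀ i j, ‖(a⁻¹).val i j‖ ≤ b) → ∀ X ∈ U, ∀ Y ∈ U,
      (∀ v : InfinitePlace F, v (killingForm F D.𝒢.lieAlgebra
        (gramProj (killingForm F D.𝒢.lieAlgebra) e X) Y) ≤ c) ∧
      ‖D.σ (killingForm F D.𝒢.lieAlgebra
        (gramProj (killingForm F D.𝒢.lieAlgebra) e X) Y)‖ ≤ c := by
  classical
  have hreal := D.totallyReal
  let t : ℝ := ∑ X ∈ U, ∑ k, ∑ i, ∑ j, ‖D.d X k i j‖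
  have ht : ∀ X ∈ U, ∀ k i j, ‖D.d X k i j‖ ≤ t := by
    intro X hX k i j
    refine (norm_apply_le_sum (D.d X k) i j).trans ?_
    refine (Finset.single_le_sum (f := fun k => ∑ i, ∑ j, ‖D.d X k i j‖)
      (fun _ _ => by positivity) (Finset.mem_univ k)).trans ?_
    exact Finset.single_le_sum (f := fun X => ∑ k, ∑ i, ∑ j, ‖D.d X k i j‖)
      (fun _ _ => by positivity) hX
  have ht0 : 0 ≤ t := by positivity
  let q : InfinitePlace F → D.𝒢.lieAlgebra → ℝ := fun v X => v (killingForm F D.𝒢.lieAlgebra X X)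
  have hq : ∀ v X, 0 ≤ q v X := fun v X => apply_nonneg v _
  let c₁ : ℝ := ∑ v, ∑ X ∈ U, ∑ Y ∈ U, (q v (X + Y) + q v X + q v Y)
  have hc₁ : 0 ≤ c₁ := Finset.sum_nonneg fun v _ => Finset.sum_nonneg fun X _ =>
    Finset.sum_nonneg fun Y _ => add_nonneg (add_nonneg (hq _ _) (hq _ _)) (hq _ _)
  -- Bounds both summands in the explicit projection formula at v₀: a component of X and a conjugate
  -- of one by a.
  let s : ℝ := max t (b * t * b)
  have hs0 : 0 ≤ s := le_max_of_le_left ht0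
  refine ⟨c₁ + s * t + 1, by positivity, fun a e he ha ha' X hX Y hY => ⟨fun v => ?_, ?_⟩⟩
  · let τ := InfinitePlace.embedding_of_isReal (IsTotallyReal.isReal v)
    have hτ : ∀ y, |τ y| = v y := InfinitePlace.norm_embedding_of_isReal _
    have h1 := abs_apply_gramProj_le D.killingForm_comm he.gram_det_ne_zero τ
      (D.killingForm_self_nonpos τ) X Y
    rw [hτ, hτ, hτ, hτ] at h1
    have h2 : q v (X + Y) + q v X + q v Y ≤ c₁ := by
      have hn : ∀ v X Y, 0 ≤ q v (X + Y) + q v X + q v Y := fun v X Y =>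
        add_nonneg (add_nonneg (hq _ _) (hq _ _)) (hq _ _)
      refine (Finset.single_le_sum (f := fun Y => q v (X + Y) + q v X + q v Y)
        (fun _ _ => hn _ _ _) hY).trans ?_
      refine (Finset.single_le_sum (f := fun X => ∑ Y ∈ U, (q v (X + Y) + q v X + q v Y))
        (fun _ _ => Finset.sum_nonneg fun _ _ => hn _ _ _) hX).trans ?_
      exact Finset.single_le_sum
        (f := fun v => ∑ X ∈ U, ∑ Y ∈ U, (q v (X + Y) + q v X + q v Y))
        (fun _ _ => Finset.sum_nonneg fun _ _ => Finset.sum_nonneg fun _ _ => hn _ _ _)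
        (Finset.mem_univ v)
    have h3 : 0 ≤ s * t := mul_nonneg hs0 ht0
    exact (h1.trans h2).trans (by linarith)
  · rw [he.σ_gramProj, norm_mul]
    have h2 : ‖(2 : ℚ_[p])‖ ≤ 1 := Padic.norm_int_le_one 2
    have ha'' : ∀ i j, ‖((a⁻¹)⁻¹).val i j‖ ≤ b := by
      rw [inv_inv]
      exact ha
    have h3 : ∀ i j, ‖(D.d X 0 + Ad a⁻¹ (D.d X 1)) i j‖ ≤ s := norm_add_apply_le
      (fun i j => (ht X hX 0 i j).trans (le_max_left _ _))
      (fun i j => (norm_Ad_apply_le ha' ha'' (ht X hX 1) i j).trans (le_max_right _ _))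
    have h4 : ∀ i j, ‖(Ad a (D.d X 0) + D.d X 1) i j‖ ≤ s := norm_add_apply_le
      (fun i j => (norm_Ad_apply_le ha ha' (ht X hX 0) i j).trans (le_max_right _ _))
      (fun i j => (ht X hX 1 i j).trans (le_max_left _ _))
    have h5 : ‖((D.d X 0 + Ad a⁻¹ (D.d X 1)) * D.d Y 0).trace +
        ((Ad a (D.d X 0) + D.d X 1) * D.d Y 1).trace‖ ≤ s * t :=
      (Padic.nonarchimedean _ _).trans (max_le
        (norm_trace_le (norm_mul_apply_le h3 (ht Y hY 0)))
        (norm_trace_le (norm_mul_apply_le h4 (ht Y hY 1))))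
    exact (mul_le_of_le_one_left (norm_nonneg _) h2).trans (h5.trans (by linarith))

end ArithmeticData

end Bounds

/-! ### Counting double cosets -/

section Count

variable {p : ℕ} [Fact p.Prime] {F : Type} [Field F] [NumberField F] {M : ℕ}
  (D : ArithmeticData p F M)

/-- The conjugating elements attached to all double cosets lie in finitely many translates of the
compact principal subgroup, hence in one bounded set independent of the orbit. -/
theorem exists_entry_bound (R : Finset (G p)) : ∃ b : ℝ, ∀ r ∈ R, ∀ v ∈ principal p,
    (∀ i j, ‖((proj 1 r)⁻¹ * v * proj 0 r).val i j‖ ≤ b) ∧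
      ∀ i j, ‖(((proj 1 r)⁻¹ * v * proj 0 r)⁻¹).val i j‖ ≤ b := by
  obtain ⟨b, hb⟩ : ∃ b : ℝ, ∀ r ∈ R, ∀ k, (∀ i j, ‖(proj k r).val i j‖ ≤ b) ∧
      ∀ i j, ‖((proj k r)⁻¹).val i j‖ ≤ b := by
    let f : G p → ℝ := fun r => ∑ k, ((∑ i, ∑ j, ‖(proj k r).val i j‖) +
      ∑ i, ∑ j, ‖((proj k r)⁻¹).val i j‖)
    have h1 : ∀ r ∈ R, ∀ k, ((∑ i, ∑ j, ‖(proj k r).val i j‖) +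
        ∑ i, ∑ j, ‖((proj k r)⁻¹).val i j‖) ≤ ∑ r ∈ R, f r := fun r hr k =>
      (Finset.single_le_sum (f := fun k => (∑ i, ∑ j, ‖(proj k r).val i j‖) +
        ∑ i, ∑ j, ‖((proj k r)⁻¹).val i j‖) (fun _ _ => by positivity) (Finset.mem_univ k)).trans
        (Finset.single_le_sum (f := f) (fun _ _ => by positivity) hr)
    refine ⟨∑ r ∈ R, f r, fun r hr k => ⟨fun i j => le_trans ?_ (h1 r hr k),
      fun i j => le_trans ?_ (h1 r hr k)⟩⟩
    · exact (norm_apply_le_sum _ i j).trans (le_add_of_nonneg_right (by positivity))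
    · exact (norm_apply_le_sum _ i j).trans (le_add_of_nonneg_left (by positivity))
  have hv : ∀ v ∈ principal p, ∀ i j, ‖v.val i j‖ ≤ 1 := by
    intro v hv i j
    have h1 : v.val = (v.val - 1) + 1 := by abel
    rw [h1]
    refine norm_add_apply_le (fun i j => (hv i j).trans inv_prime_lt_one.le) (fun i j => ?_) i j
    rw [Matrix.one_apply]
    split_ifs <;> simp
  refine ⟨b * 1 * b, fun r hr v hv' => ⟨fun i j => ?_, fun i j => ?_⟩⟩
  · exact norm_mul_apply_le (norm_mul_apply_le (hb r hr 1).2 (hv v hv')) (hb r hr 0).1 i j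
  · have h1 : ((proj 1 r)⁻¹ * v * proj 0 r)⁻¹ = (proj 0 r)⁻¹ * v⁻¹ * proj 1 r := by group
    rw [h1]
    exact norm_mul_apply_le (norm_mul_apply_le (hb r hr 0).2 (hv _ (inv_mem hv'))) (hb r hr 1).1 i j

/-- Two translates of `g` in the same double coset, with the same relative position of their
components up to sign, lie in the same double coset in `H`. -/
theorem exists_mem_principalH_mem_stab (hp : 3 < p) {Γ : Subgroup (G p)} {g r u u' γ γ' : G p}
    {s s' : H p} (hu : u ∈ principalSq p) (hu' : u' ∈ principalSq p) (hγ : γ ∈ Γ) (hγ' : γ' ∈ Γ)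
    (hs : s.1 * g = u * r * γ) (hs' : s'.1 * g = u' * r * γ')
    (h : ((r.2⁻¹ * (u'.2⁻¹ * u'.1) * r.1)⁻¹ * (r.2⁻¹ * (u.2⁻¹ * u.1) * r.1)).val = 1 ∨
      ((r.2⁻¹ * (u'.2⁻¹ * u'.1) * r.1)⁻¹ * (r.2⁻¹ * (u.2⁻¹ * u.1) * r.1)).val = -1) :
    ∃ w ∈ principalH p, ∃ t ∈ stab Γ g, s' = w * s * t := by
  have hconj : (r.2⁻¹ * (u'.2⁻¹ * u'.1) * r.1)⁻¹ * (r.2⁻¹ * (u.2⁻¹ * u.1) * r.1) =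
      r.1⁻¹ * ((u'.2⁻¹ * u'.1)⁻¹ * (u.2⁻¹ * u.1)) * r.1 := by group
  rw [hconj] at h
  have hmem : (u'.2⁻¹ * u'.1)⁻¹ * (u.2⁻¹ * u.1) ∈ principal p :=
    mul_mem (inv_mem (mul_mem (inv_mem hu'.2) hu'.1)) (mul_mem (inv_mem hu.2) hu.1)
  have hz : ∀ z : SL(2, ℚ_[p]), z.val = Ad r.1 ((r.1⁻¹ * z * r.1).val) := fun z => by
    have h1 : r.1 * (r.1⁻¹ * z * r.1) * r.1⁻¹ = z := by group
    rw [Ad_coe, h1]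
  -- The quotient of the relative positions is central and lies in the principal subgroup, which
  -- excludes −1.
  have hv : (u'.2⁻¹ * u'.1)⁻¹ * (u.2⁻¹ * u.1) = 1 := by
    rcases h with h | h
    · refine Subtype.ext ?_
      rw [hz, h, map_one]
      rfl
    · refine absurd ?_ (neg_one_notMem_principal hp hmem)
      rw [hz, h, map_neg, map_one]
  have hw : u'.1 * u.1⁻¹ = u'.2 * u.2⁻¹ := by
    have h1 : u.2⁻¹ * u.1 = u'.2⁻¹ * u'.1 := by
      rw [inv_mul_eq_one] at hv
      exact hv.symm
    have h2 : u'.2 * (u.2⁻¹ * u.1) = u'.1 := by rw [h1, mul_inv_cancel_left]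
    rw [← h2]
    group
  let w : H p := ⟨u' * u⁻¹, mem_H.mpr hw⟩
  refine ⟨w, Subgroup.mem_subgroupOf.mpr (mul_mem hu' (inv_mem hu)), s⁻¹ * w⁻¹ * s', ?_, by group⟩
  rw [mem_stab]
  have h3 : g⁻¹ * (s⁻¹ * w⁻¹ * s').1 * g = (s.1 * g)⁻¹ * (u' * u⁻¹)⁻¹ * (s'.1 * g) := by
    change g⁻¹ * (s.1⁻¹ * (u' * u⁻¹)⁻¹ * s'.1) * g = _
    group
  have h4 : (u * r * γ)⁻¹ * (u' * u⁻¹)⁻¹ * (u' * r * γ') = γ⁻¹ * γ' := by group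
  rw [h3, hs, hs', h4]
  exact mul_mem (inv_mem hγ) hγ'

namespace ArithmeticData

/-- Left multiplication of g by H does not change g₂⁻¹g₁, so transporting by γ replaces this element
by the one attached to u r. Integrality survives because γ lifts to an S-arithmetic element. -/
theorem exists_isDiagonal {Γ : Subgroup (G p)} (hΓ : Γ ≤ D.arithmeticGroup)
    {g r u γ : G p} {s : H p} (hγ : γ ∈ Γ) (hs : s.1 * g = u * r * γ)
    {e : Fin 3 → D.𝒢.lieAlgebra} (he : LinearIndependent F e) (hmem : ∀ i, e i ∈ D.𝔩 g)
    {x : F} (hxe : x • D.vec e ∈ D.integralV) :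
    ∃ E : Fin 3 → D.𝒢.lieAlgebra,
      D.IsDiagonal ((proj 1 r)⁻¹ * (u.2⁻¹ * u.1) * proj 0 r) E ∧
      x • D.vec E ∈ D.integralV := by
  obtain ⟨γS, hγS, rfl⟩ := hΓ hγ
  refine ⟨D.adjoint γS ∘ e, ?_, D.smul_vec_adjoint_mem hγS hxe⟩
  have h1 := (D.isDiagonal_of_mem_𝔩 he hmem).adjoint γS
  have h2 : proj 1 (D.toG γS) * ((proj 1 g)⁻¹ * proj 0 g) * (proj 0 (D.toG γS))⁻¹ =
      (proj 1 r)⁻¹ * (u.2⁻¹ * u.1) * proj 0 r := by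
    change (D.toG γS).2 * (g.2⁻¹ * g.1) * (D.toG γS).1⁻¹ = r.2⁻¹ * (u.2⁻¹ * u.1) * r.1
    have h3 : s.1.1 * g.1 = u.1 * r.1 * (D.toG γS).1 := congrArg Prod.fst hs
    have h4 : s.1.2 * g.2 = u.2 * r.2 * (D.toG γS).2 := congrArg Prod.snd hs
    have h5 : g.2⁻¹ * g.1 = (s.1.2 * g.2)⁻¹ * (s.1.1 * g.1) := by
      rw [mem_H.mp s.2]
      group
    rw [h5, h3, h4]
    group
  rw [h2] at h1
  exact h1

theorem exists_finset_basis : ∃ U : Finset D.𝒢.lieAlgebra,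
    (∀ k, D.basis k ∈ U) ∧ ∀ i j, D.basis i + D.basis j ∈ U := by
  have h := (Set.finite_range D.basis).union
    (Set.finite_range fun ij : Fin 6 × Fin 6 => D.basis ij.1 + D.basis ij.2)
  exact ⟨h.toFinset, fun k => h.mem_toFinset.mpr (Or.inl ⟨k, rfl⟩),
    fun i j => h.mem_toFinset.mpr (Or.inr ⟨(i, j), rfl⟩)⟩

/-- The number of double cosets in a closed orbit is bounded by the sixth power of the height
of a denominator of `D.vec e`. -/
theorem exists_card_le_height_pow (hp : 3 < p) {Γ : Subgroup (G p)} (hΓ : Γ ≤ D.arithmeticGroup)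
    {R : Finset (G p)}
    (hR : ∀ x : G p, ∃ u ∈ principalSq p, ∃ r ∈ R, ∃ γ ∈ Γ, x = u * r * γ) :
    ∃ C : ℝ, 0 < C ∧ ∀ (g : G p) (S : Finset (H p)),
      (∀ s ∈ S, ∀ s' ∈ S, ∀ u ∈ principalH p, ∀ t ∈ stab Γ g, s' = u * s * t → s = s') →
      ∀ e : Fin 3 → D.𝒢.lieAlgebra, LinearIndependent F e → (∀ i, e i ∈ D.𝔩 g) →
      ∀ x ∈ D.integers, x ≠ 0 → x • D.vec e ∈ D.integralV →
      (S.card : ℝ) ≤ C * D.height x ^ 6 := by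
  classical
  obtain ⟨U, hU1, hU2⟩ := D.exists_finset_basis
  obtain ⟨b, hb⟩ := exists_entry_bound R
  obtain ⟨m, hm0, hm⟩ := D.exists_denominator_gramProj U
  obtain ⟨c, hc0, hc⟩ := D.exists_bound_gramProj U b
  obtain ⟨C, hC0, hC⟩ := D.exists_card_le hm0 hc0
  -- One factor for r, one for the 36 pairs of basis vectors defining X, and C ht(x) choices for
  -- each of the six coefficients of the projected vector.
  refine ⟨(R.card + 1) * 36 * C ^ 6, by positivity, fun g S hS e he hmem x hx hx0 hxe => ?_⟩
  choose u hu r hr γ hγ hs using fun s : H p => hR (s.1 * g)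
  choose E hE hxE using fun s : H p => D.exists_isDiagonal hΓ (hγ s) (hs s) he hmem hxe
  let a : H p → SL(2, ℚ_[p]) := fun s =>
    (proj 1 (r s))⁻¹ * ((u s).2⁻¹ * (u s).1) * proj 0 (r s)
  have huv : ∀ s, (u s).2⁻¹ * (u s).1 ∈ principal p := fun s =>
    mul_mem (inv_mem (hu s).2) (hu s).1
  choose i j hij using fun s : H p => D.exists_not_commute (a s)⁻¹
  let P : H p → Fin 6 → F := fun s k => killingForm F D.𝒢.lieAlgebra
    (gramProj (killingForm F D.𝒢.lieAlgebra) (E s) (D.basis (i s) + D.basis (j s))) (D.basis k)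
  let T : Finset F := (S ×ˢ Finset.univ).image fun sk : H p × Fin 6 => x * P sk.1 sk.2
  have hT : (T.card : ℝ) ≤ C * D.height x := by
    refine hC x hx hx0 T fun y hy => ?_
    obtain ⟨⟨s, k⟩, -, rfl⟩ := Finset.mem_image.mp hy
    have h1 := hc (a s) (E s) (hE s) (hb _ (hr s) _ (huv s)).1 (hb _ (hr s) _ (huv s)).2
      _ (hU2 (i s) (j s)) _ (hU1 k)
    refine ⟨hm _ (hU2 (i s) (j s)) _ (hU1 k) (E s) x (hxE s), fun v => ?_, ?_⟩
    · rw [map_mul, mul_comm]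
      exact mul_le_mul_of_nonneg_right (h1.1 v) (apply_nonneg v x)
    · rw [map_mul, norm_mul, mul_comm]
      exact mul_le_mul_of_nonneg_right h1.2 (norm_nonneg _)
  -- The test vector depends on s, so the pair (i, j) is recorded along with r and the coefficients;
  -- together they determine s within S.
  let f : H p → G p × (Fin 6 × Fin 6) × (Fin 6 → F) := fun s =>
    (r s, (i s, j s), fun k => x * P s k)
  have hcard : S.card ≤ (R ×ˢ (Finset.univ : Finset (Fin 6 × Fin 6)) ×ˢ
      Fintype.piFinset fun _ : Fin 6 => T).card := by
    refine Finset.card_le_card_of_injOn f ?_ ?_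
    · intro s hs
      have hs' : s ∈ S := hs
      simp only [Finset.coe_product, Set.mem_prod, Finset.mem_coe, f]
      refine ⟨hr s, Finset.mem_univ _, Fintype.mem_piFinset.mpr fun k => ?_⟩
      exact Finset.mem_image.mpr ⟨(s, k), Finset.mem_product.mpr ⟨hs', Finset.mem_univ k⟩, rfl⟩
    · intro s hsS s' hsS' hff
      have h1 : r s = r s' := congrArg Prod.fst hff
      have h2 : (i s, j s) = (i s', j s') := congrArg (fun t => t.2.1) hff
      have h3 : ∀ k, x * P s k = x * P s' k := congrFun (congrArg (fun t => t.2.2) hff)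
      have hi : i s = i s' := congrArg Prod.fst h2
      have hj : j s = j s' := congrArg Prod.snd h2
      have h4 := (hE s).eq_or_eq_neg (hE s') (hij s) fun k => by
        have h5 := mul_left_cancel₀ hx0 (h3 k)
        simpa only [P, hi, hj] using h5
      have hs1 : s'.1 * g = u s' * r s * γ s' := h1 ▸ hs s'
      obtain ⟨w, hw, t, ht, hst⟩ := exists_mem_principalH_mem_stab hp (hu s) (hu s') (hγ s) (hγ s')
        (hs s) hs1 (by
          simp only [← h1] at h4
          exact h4)
      exact hS s hsS s' hsS' w hw t ht hst
  rw [Finset.card_product, Finset.card_product, Fintype.card_piFinset_const, Finset.card_univ,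
    Fintype.card_prod, Fintype.card_fin] at hcard
  have h6 : (S.card : ℝ) ≤ R.card * (36 * (T.card : ℝ) ^ 6) := by exact_mod_cast hcard
  calc (S.card : ℝ) ≤ R.card * (36 * (T.card : ℝ) ^ 6) := h6
    _ ≤ (R.card + 1) * (36 * (C * D.height x) ^ 6) := by
        gcongr
        linarith
    _ = (R.card + 1) * 36 * C ^ 6 * D.height x ^ 6 := by ring

end ArithmeticData

end Count

/-! ### Passage to the discriminant -/

section Main

variable {p : ℕ} [Fact p.Prime] {F : Type} [Field F] [NumberField F] {M : ℕ}
  (D : ArithmeticData p F M)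

namespace ArithmeticData

/-- The set whose infimum is the discriminant is nonempty if `D.𝔩 g` has dimension three. -/
theorem exists_smul_vec_mem {g : G p} (b : Module.Basis (Fin 3) F (D.𝔩 g)) :
    ∃ x ∈ D.integers, x ≠ 0 ∧ ∃ e : Module.Basis (Fin 3) F (D.𝔩 g),
      x • D.vec (fun i => (e i : D.𝒢.lieAlgebra)) ∈ D.integralV := by
  classical
  obtain ⟨n, -, hn0, hnT⟩ := D.exists_smul_mem_integers (Finset.univ.image
    fun kij : Fin 3 × Fin M × Fin M => (b kij.1 : D.𝒢.lieAlgebra).val kij.2.1 kij.2.2)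
  -- Scaling the basis clears the denominators of its entries; a multiple of the Gram determinant
  -- then clears the denominator of the vector itself.
  let e : Module.Basis (Fin 3) F (D.𝔩 g) := b.unitsSMul fun _ => Units.mk0 n hn0
  have hint : ∀ k i j, (e k : D.𝒢.lieAlgebra).val i j ∈ D.integers := by
    intro k i j
    have h1 : (e k : D.𝒢.lieAlgebra).val i j = n * (b k : D.𝒢.lieAlgebra).val i j := by
      simp only [e, Module.Basis.unitsSMul_apply]
      rfl
    rw [h1]
    exact hnT _ (Finset.mem_image.mpr ⟨(k, i, j), Finset.mem_univ _, rfl⟩)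
  have he : LinearIndependent F fun i => (e i : D.𝒢.lieAlgebra) :=
    e.linearIndependent.map' (D.𝔩 g).subtype (Submodule.ker_subtype _)
  have hdet := (D.isDiagonal_of_mem_𝔩 he fun i => (e i).2).gram_det_ne_zero
  obtain ⟨m, hm, hm0, hmT⟩ := D.exists_smul_mem_integers
    {(gram (killingForm F D.𝒢.lieAlgebra) fun i => (e i : D.𝒢.lieAlgebra)).det}
  refine ⟨_, hmT _ (Finset.mem_singleton_self _), mul_ne_zero hm0 hdet, e, ?_⟩
  have h2 : (m * (gram (killingForm F D.𝒢.lieAlgebra) fun i => (e i : D.𝒢.lieAlgebra)).det) •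
      D.vec (fun i => (e i : D.𝒢.lieAlgebra)) =
      m • (exteriorPower.ιMulti F 3 (fun i => (e i : D.𝒢.lieAlgebra)) ⊗ₜ[F]
        exteriorPower.ιMulti F 3 fun i => (e i : D.𝒢.lieAlgebra)) := by
    rw [vec, smul_smul, mul_assoc]
    congr 1
    exact (congrArg (m * ·) (mul_inv_cancel₀ hdet)).trans (mul_one m)
  rw [h2]
  exact Submodule.smul_mem D.integralV ⟨m, hm⟩
    (Submodule.subset_span ⟨_, _, hint, hint, rfl⟩)

/-- A bound by the sixth power of all the heights that define the discriminant passes to the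
discriminant. -/
theorem le_mul_disc_pow {g : G p} (b : Module.Basis (Fin 3) F (D.𝔩 g)) {C N : ℝ} (hC : 0 < C)
    (hN : 0 ≤ N) (h : ∀ (e : Module.Basis (Fin 3) F (D.𝔩 g)), ∀ x ∈ D.integers, x ≠ 0 →
      x • D.vec (fun i => (e i : D.𝒢.lieAlgebra)) ∈ D.integralV → N ≤ C * D.height x ^ 6) :
    N ≤ C * D.disc g ^ 6 := by
  let q : ℝ := (N / C) ^ ((6 : ℕ) : ℝ)⁻¹
  have hq0 : 0 ≤ q := Real.rpow_nonneg (div_nonneg hN hC.le) _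
  have hq : q ^ 6 = N / C := Real.rpow_inv_natCast_pow (div_nonneg hN hC.le) (by norm_num)
  have hle : q ≤ D.disc g := by
    -- Nonemptiness is essential, as the infimum of the empty set is 0 by convention. The sixth root
    -- q of N / C then bounds every height from below, hence the infimum, whether or not it is
    -- attained.
    obtain ⟨x, hx, hx0, e, he⟩ := D.exists_smul_vec_mem b
    refine le_csInf ⟨_, x, hx, hx0, ⟨e, he⟩, rfl⟩ ?_
    rintro r ⟨x, hx, hx0, ⟨e, he⟩, rfl⟩
    refine le_of_pow_le_pow_left₀ (n := 6) (by norm_num) (D.height_pos hx0).le ?_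
    rw [hq, div_le_iff₀ hC, mul_comm]
    exact h e x hx hx0 he
  have h1 : q ^ 6 ≤ D.disc g ^ 6 := pow_le_pow_left₀ hq0 hle 6
  rw [hq, div_le_iff₀ hC, mul_comm] at h1
  exact h1

end ArithmeticData

end Main

end PadicOrbit

open PadicOrbit in
theorem lemma5p4 (p : ℕ) [Fact p.Prime] (hp : 3 < p)
    [MeasurableSpace (G p)] [BorelSpace (G p)]
    (μG : Measure (G p)) [μG.IsHaarMeasure]
    (μH : Measure (H p)) [μH.IsHaarMeasure] (hμH : μH ((K p).subgroupOf (H p)) = 1)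
    (F : Type) [Field F] [NumberField F] (M : ℕ) (D : ArithmeticData p F M)
    (Γ : Subgroup (G p)) (hΓ : Γ ≤ D.arithmeticGroup) (hfin : Γ.relIndex D.arithmeticGroup ≠ 0)
    (hlat : IsLattice μG Γ) :
    ∃ C : ℝ, 0 < C ∧ ∀ g : G p, IsClosed (orbit Γ g) →
      IsLattice μH (stab Γ g) ∧ vol μH Γ g ≤ ENNReal.ofReal (C * D.disc g ^ 6) := by
  have := hlat.1
  obtain ⟨R, hR⟩ := exists_finite_double_cosets_G hp μG hlat
  obtain ⟨C, hC0, hC⟩ := D.exists_card_le_height_pow hp hΓ hR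
  refine ⟨C, hC0, fun g hcl => ?_⟩
  obtain ⟨hstab, S, hcover, hinj, hvol⟩ := isLattice_stab hp μH hμH hR hcl
  refine ⟨hstab, ?_⟩
  obtain ⟨r, hr⟩ := exists_isCocompactSemisimple hp hcover
  have b : Module.Basis (Fin 3) F (D.𝔩 g) :=
    Module.finBasisOfFinrankEq F (D.𝔩 g) (D.finrank_𝔩 hΓ hr)
  have hcard : (S.card : ℝ) ≤ C * D.disc g ^ 6 := by
    refine D.le_mul_disc_pow b hC0 (Nat.cast_nonneg _) fun e x hx hx0 hxe => ?_
    exact hC g S hinj _ (e.linearIndependent.map' (D.𝔩 g).subtype (Submodule.ker_subtype _))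
      (fun i => (e i).2) x hx hx0 hxe
  refine hvol.trans ?_
  rw [← ENNReal.ofReal_natCast]
  exact ENNReal.ofReal_le_ofReal hcard
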